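/- Let $G_0=\mathrm{SL}(2,\mathbb C)$, $K_0=\mathrm{SU}(2)$, let $du$ be the Haar measure of mass $1$ on $K_0$, and put $$n(z)=\begin{pmatrix}1&z\\0&1\end{pmatrix},\qquad a(t)=\begin{pmatrix}e^{t/2}&0\\0&e^{-t/2}\end{pmatrix}\qquad(z\in\mathbb C,\ t\in\mathbb R).$$ For $g\in G_0$ let $A(g)\in\mathbb R$ be the Iwasawa height, i.e. $g\in n(z)\,a(A(g))\,K_0$ for some $z\in\mathbb C$. Let $H'$ be the normalizer of $\mathrm{SL}(2,\mathbb R)$ in $G_0$ (equivalently, the stabilizer of $\mathbb H^2$ in $\mathbb H^3=G_0/K_0$), let $d$ be the left-invariant Riemannian distance on $G_0$ induced by the norm $(|Z_1|^2+|Z_2|^2+|Z_3|^2)^{1/2}$ of $\begin{pmatrix}Z_1&Z_2\\Z_3&-Z_1\end{pmatrix}\in\mathfrak{sl}(2,\mathbb C)$, and let $d(g,H')=\inf_{h\in H'}d(g,h)$. Let $dg$ be the Haar measure on $G_0$ given by $\int_{G_0} f\,dg=\int_{\mathbb C}\int_{\mathbb R}\int_{K_0} f(n(z)a(t)u)\,e^{-2t}\,du\,dt\,dz$.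 Let $\varphi_s(g)=\int_{K_0}e^{(1+is)A(ug)}\,du$ be the spherical functions, and let $\widehat f(s)=\int_{G_0}f(g)\varphi_{-s}(g)\,dg$ be the spherical transform. Fix a nonnegative function $h$ on $\mathbb R$ of Paley–Wiener type (the Fourier transform of a function in $C_c^\infty(\mathbb R)$) with $h(0)=1$. For $\lambda\in\mathbb R$ put $h^0_\lambda(s)=h(s-\lambda)+h(-s-\lambda)$, let $$k^0_\lambda(g)=\frac1{2\pi^2}\int_0^\infty h_\lambda^0(s)\varphi_s(g)s^2\,ds ,\qquad k_\lambda=k_\lambda^0*k_\lambda^0 ,$$ the convolution being $(f_1*f_2)(g)=\int_{G_0}f_1(x)f_2(x^{-1}g)\,dx$. For $b\in C_c^\infty(\mathbb R^2)$ (a function on $\mathbb H^2$ in the coordinates $(x,t)\mapsto(x,e^t)$), $g\in G_0$ and $s\in\mathbb R$, write $m=a(-t_1)n(-x_1)\,g\,n(x_2)a(t_2)$ and define $$I(\lambda,g)=\int_{\mathbb R^4} b(x_1,t_1)\overline{b(x_2,t_2)}\,k_\lambda(m)\,e^{-t_1-t_2}\,dx_1dt_1dx_2dt_2,$$ $$J(s,g)=\int_{\mathbb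 R^4}\int_{K_0} b(x_1,t_1)\overline{b(x_2,t_2)}\,e^{A(um)-t_1-t_2}\,e^{isA(um)}\,du\,dx_1dt_1dx_2dt_2 .$$ Then the following hold. 1. For every $\lambda\in\mathbb R$, $k_\lambda^0$ is continuous, compactly supported and $K_0$-bi-invariant, and its spherical transform is $h_\lambda^0$. 2. For all $\lambda\in\mathbb R$ and all $g\in G_0$ with $d(g,e)\le 1$, $\;|I(\lambda,g)|\le C_1\,(1+|\lambda|\,d(g,H'))^{-1}$. 3. For all real $s\ne0$ and all $g\in G_0$ with $d(g,e)\le 1$, $\;|J(s,g)|\le C_2\,s^{-2}(1+|s|\,d(g,H'))^{-1}$. Here $C_2$ depends only on a compact set containing the support of $b$ and on a bound for the sup-norms of $b$ and its derivatives up to some absolute order; $C_1$ depends only on these data and on $h$. -/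

import Mathlib

open MeasureTheory
open scoped MatrixGroups ContDiff ComplexConjugate

noncomputable section

namespace HypPeriod

/-- `G₀ = SL(2, ℂ)`, with Mathlib's topology (that of the matrix entries). -/
abbrev G : Type := SL(2, ℂ)

/-! ### Subgroups and the Iwasawa decomposition -/

/-- `K₀ = SU(2)`, as a subgroup of `SL(2, ℂ)`. -/
def SU2 : Subgroup G where
  carrier := {g | (g : Matrix (Fin 2) (Fin 2) ℂ) ∈ Matrix.unitaryGroup (Fin 2) ℂ}
  one_mem' := by
    simp only [Set.mem_ofPred_eq, Matrix.SpecialLinearGroup.coe_one]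
    exact one_mem _
  mul_mem' := by
    intro x y hx hy
    simp only [Set.mem_ofPred_eq, Matrix.SpecialLinearGroup.coe_mul] at *
    exact mul_mem hx hy
  inv_mem' := by
    intro x hx
    simp only [Set.mem_ofPred_eq] at *
    have h1 : (x : Matrix (Fin 2) (Fin 2) ℂ) * ((x⁻¹ : G) : Matrix (Fin 2) (Fin 2) ℂ) = 1 := by
      rw [← Matrix.SpecialLinearGroup.coe_mul, mul_inv_cancel, Matrix.SpecialLinearGroup.coe_one]
    have h2 := Matrix.mem_unitaryGroup_iff'.mp hx
    have h3 : ((x⁻¹ : G) : Matrix (Fin 2) (Fin 2) ℂ) = star (x : Matrix (Fin 2) (Fin 2) ℂ) := by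
      calc ((x⁻¹ : G) : Matrix (Fin 2) (Fin 2) ℂ)
          = (star (x : Matrix (Fin 2) (Fin 2) ℂ) * (x : Matrix (Fin 2) (Fin 2) ℂ))
              * ((x⁻¹ : G) : Matrix (Fin 2) (Fin 2) ℂ) := by rw [h2, one_mul]
        _ = star (x : Matrix (Fin 2) (Fin 2) ℂ) := by rw [mul_assoc, h1, mul_one]
    rw [h3]
    exact Unitary.star_mem hx

/-- `n(z) = exp(z X)`, the unipotent matrix with upper right entry `z`. -/
def n (z : ℂ) : G := ⟨!![1, z; 0, 1], by simp [Matrix.det_fin_two]⟩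

/-- `a(t) = exp(t H) = diag(e^{t/2}, e^{-t/2})`. -/
def a (t : ℝ) : G :=
  ⟨!![((Real.exp (t / 2) : ℝ) : ℂ), 0; 0, ((Real.exp (-t / 2) : ℝ) : ℂ)], by
    rw [Matrix.det_fin_two_of, mul_zero, sub_zero, ← Complex.ofReal_mul, ← Real.exp_add]
    simp [neg_div]⟩

/-- The Iwasawa height `A(g)`: if `g = n(z) a(t) k` with `k ∈ SU(2)`, then `A(g) = t`
(see `height_iwasawa` and `exists_iwasawa`). -/
def height (g : G) : ℝ := -Real.log (‖g 1 0‖ ^ 2 + ‖g 1 1‖ ^ 2)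

theorem SU2_row (k : G) (hk : k ∈ SU2) (i : Fin 2) : ‖k i 0‖ ^ 2 + ‖k i 1‖ ^ 2 = 1 := by
  have h := Matrix.mem_unitaryGroup_iff.mp (show (k : Matrix (Fin 2) (Fin 2) ℂ) ∈ _ from hk)
  have h2 := congrFun (congrFun h i) i
  rw [Matrix.mul_apply, Fin.sum_univ_two, Matrix.star_apply, Matrix.star_apply,
    Matrix.one_apply_eq] at h2
  simp only [RCLike.star_def, Complex.mul_conj, Complex.normSq_eq_norm_sq] at h2
  exact_mod_cast h2

theorem height_iwasawa (z : ℂ) (t : ℝ) (k : G) (hk : k ∈ SU2) : height (n z * a t * k) = t := by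
  have h := SU2_row k hk 1
  have e : ∀ j, (n z * a t * k) 1 j = ((Real.exp (-t / 2) : ℝ) : ℂ) * k 1 j := by
    intro j
    change ((n z).1 * (a t).1 * k.1) 1 j = _
    simp [n, a, Matrix.mul_apply, Fin.sum_univ_two]
  rw [height, e 0, e 1, norm_mul, norm_mul, Complex.norm_real, Real.norm_eq_abs,
    abs_of_pos (Real.exp_pos _), mul_pow, mul_pow, ← mul_add, h, mul_one, ← Real.exp_nat_mul,
    Real.log_exp]
  push_cast
  ring

theorem exists_iwasawa (g : G) : ∃ z : ℂ, ∃ k ∈ SU2, g = n z * a (height g) * k := by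
  have hdet : g 0 0 * g 1 1 - g 0 1 * g 1 0 = 1 := by
    rw [← Matrix.det_fin_two]; exact g.2
  set r : ℝ := ‖g 1 0‖ ^ 2 + ‖g 1 1‖ ^ 2 with hr
  have hr0 : 0 < r := by
    by_contra hneg
    have h1 : ‖g 1 0‖ ^ 2 = 0 := by nlinarith [sq_nonneg ‖g 1 0‖, sq_nonneg ‖g 1 1‖]
    have h2 : ‖g 1 1‖ ^ 2 = 0 := by nlinarith [sq_nonneg ‖g 1 0‖, sq_nonneg ‖g 1 1‖]
    have h3 : g 1 0 = 0 := by simpa using h1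
    have h4 : g 1 1 = 0 := by simpa using h2
    rw [h3, h4] at hdet
    simp at hdet
  have hrC : (r : ℂ) ≠ 0 := by exact_mod_cast hr0.ne'
  have hrr : (r : ℂ) = g 1 0 * conj (g 1 0) + g 1 1 * conj (g 1 1) := by
    rw [Complex.mul_conj, Complex.mul_conj, Complex.normSq_eq_norm_sq, Complex.normSq_eq_norm_sq,
      hr]
    push_cast
    rfl
  set q : ℝ := Real.exp (height g / 2) with hq
  have hq0 : q ≠ 0 := (Real.exp_pos _).ne'
  have hqC : (q : ℂ) ≠ 0 := by exact_mod_cast hq0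
  have hqinv : Real.exp (-height g / 2) = q⁻¹ := by rw [hq, ← Real.exp_neg, neg_div]
  have hq2 : q ^ 2 = r⁻¹ := by
    rw [hq, ← Real.exp_nat_mul, height, ← hr]
    rw [show ((2 : ℕ) : ℝ) * (-Real.log r / 2) = -Real.log r by push_cast; ring, Real.exp_neg,
      Real.exp_log hr0]
  have hq2C : (q : ℂ) ^ 2 * r = 1 := by
    rw [← Complex.ofReal_pow, hq2, ← Complex.ofReal_mul, inv_mul_cancel₀ hr0.ne',
      Complex.ofReal_one]
  have hkdet : Matrix.det !![(q : ℂ) * conj (g 1 1), -(q * conj (g 1 0)); q * g 1 0, q * g 1 1]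
      = 1 := by
    rw [Matrix.det_fin_two_of]
    linear_combination hq2C - (q : ℂ) ^ 2 * hrr
  refine ⟨(g 0 0 * conj (g 1 0) + g 0 1 * conj (g 1 1)) / r, ⟨_, hkdet⟩, ?_, ?_⟩
  · change _ ∈ Matrix.unitaryGroup (Fin 2) ℂ
    rw [Matrix.mem_unitaryGroup_iff]
    ext i j
    fin_cases i <;> fin_cases j <;>
      simp [Matrix.mul_apply, Fin.sum_univ_two, Matrix.star_apply] <;>
      first
        | ring1
        | linear_combination hq2C - (q : ℂ) ^ 2 * hrr
  · have hz : (g 0 0 * conj (g 1 0) + g 0 1 * conj (g 1 1)) / r * r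
        = g 0 0 * conj (g 1 0) + g 0 1 * conj (g 1 1) := div_mul_cancel₀ _ hrC
    apply Subtype.ext
    change g.1 = (n _).1 * (a _).1 * _
    simp only [n, a, ← hq, hqinv]
    ext i j
    have hqq : ∀ x : ℂ, q * (q * x) = x / r := by
      intro x
      rw [eq_div_iff hrC]
      linear_combination x * hq2C
    fin_cases i <;> fin_cases j <;>
      simp only [Matrix.mul_apply, Fin.sum_univ_two, Fin.zero_eta, Fin.mk_one, Matrix.of_apply,
        Matrix.cons_val', Matrix.cons_val_zero, Matrix.cons_val_one, Matrix.cons_val_fin_one,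
        Complex.ofReal_inv, one_mul, zero_mul, mul_zero, add_zero, zero_add, mul_neg, neg_zero, hqq,
        mul_assoc, inv_mul_cancel_left₀ hqC]
    · field_simp
      linear_combination g 0 0 * hrr + conj (g 1 1) * hdet
    · field_simp
      linear_combination g 0 1 * hrr - conj (g 1 0) * hdet

/-- `H₀ = SL(2, ℝ)` inside `SL(2, ℂ)`. -/
def H0 : Subgroup G := (Matrix.SpecialLinearGroup.map (n := Fin 2) (algebraMap ℝ ℂ)).range

/-- `H'`, the normalizer of `SL(2, ℝ)` in `SL(2, ℂ)`. -/
def Hprime : Subgroup G := Subgroup.normalizer (H0 : Set G)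

theorem mem_H0_iff (g : G) : g ∈ H0 ↔ ∀ i j, (g i j).im = 0 := by
  constructor
  · rintro ⟨h, rfl⟩ i j
    simp
  · intro hg
    have hre : ∀ i j, (((g i j).re : ℝ) : ℂ) = g i j := fun i j =>
      Complex.ext (by simp) (by simp [hg i j])
    refine ⟨⟨Matrix.of fun i j => (g i j).re, ?_⟩, ?_⟩
    · have h1 : g 0 0 * g 1 1 - g 0 1 * g 1 0 = 1 := by
        rw [← Matrix.det_fin_two]; exact g.2
      rw [Matrix.det_fin_two]
      have h2 := congrArg Complex.re h1
      simpa [hg] using h2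
    · apply Subtype.ext
      ext i j
      exact hre i j

/-- `H'` consists of the real and of the purely imaginary matrices in `SL(2, ℂ)`, that is,
`H' = H₀ ∪ !![0, i; i, 0] H₀`. -/
theorem mem_Hprime_iff (g : G) :
    g ∈ Hprime ↔ (∀ i j, (g i j).im = 0) ∨ (∀ i j, (g i j).re = 0) := by
  have hinv : ∀ x : G, (x⁻¹ : G).1 = !![x 1 1, -x 0 1; -x 1 0, x 0 0] := fun x => by
    rw [Matrix.SpecialLinearGroup.coe_inv, Matrix.adjugate_fin_two]
  have hconj : ∀ x h : G, (x * h * x⁻¹ : G).1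
      = x.1 * h.1 * !![x 1 1, -x 0 1; -x 1 0, x 0 0] := fun x h => by
    rw [← hinv]; rfl
  constructor
  · intro hg
    have key : ∀ h : G, h ∈ H0 → ∀ i j,
        ((g.1 * h.1 * !![g 1 1, -g 0 1; -g 1 0, g 0 0] : Matrix (Fin 2) (Fin 2) ℂ) i j).im
          = 0 := by
      intro h hh i j
      rw [← hconj]
      exact (mem_H0_iff _).mp ((Subgroup.mem_normalizer_iff.mp hg h).mp hh) i j
    have k1 := key ⟨!![1, 1; 0, 1], by simp [Matrix.det_fin_two]⟩
      ((mem_H0_iff _).mpr fun i j => by fin_cases i <;> fin_cases j <;> simp)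
    have k2 := key ⟨!![1, 0; 1, 1], by simp [Matrix.det_fin_two]⟩
      ((mem_H0_iff _).mpr fun i j => by fin_cases i <;> fin_cases j <;> simp)
    have k3 := key ⟨!![2, 1; 1, 1], by rw [Matrix.det_fin_two_of]; norm_num⟩
      ((mem_H0_iff _).mpr fun i j => by fin_cases i <;> fin_cases j <;> simp)
    have hdet : g 0 0 * g 1 1 - g 0 1 * g 1 0 = 1 := by
      rw [← Matrix.det_fin_two]; exact g.2
    have hd := congrArg Complex.im hdet
    have k100 := k1 0 0
    have k101 := k1 0 1
    have k110 := k1 1 0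
    have k200 := k2 0 0
    have k201 := k2 0 1
    have k210 := k2 1 0
    have k300 := k3 0 0
    have k301 := k3 0 1
    have k310 := k3 1 0
    simp [Matrix.mul_apply, Fin.sum_univ_two] at k100 k101 k110 k200 k201 k210 k300 k301 k310 hd
    have hsq : ∀ z : ℂ, (z * z).im = 0 → z.re ≠ 0 → z.im = 0 := by
      intro z hz hz0
      rw [Complex.mul_im] at hz
      have : z.re * z.im = 0 := by linarith
      exact (mul_eq_zero.mp this).resolve_left hz0
    have hpr : ∀ i j i' j', (g i j * g i' j').im = 0 := by
      intro i j i' j'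
      fin_cases i <;> fin_cases j <;> fin_cases i' <;> fin_cases j' <;>
        simp [Complex.mul_im] <;> linarith
    by_cases hall : ∀ i j, (g i j).re = 0
    · exact Or.inr hall
    · left
      push Not at hall
      obtain ⟨i, j, hij⟩ := hall
      have him := hsq _ (hpr i j i j) hij
      intro i' j'
      have h := hpr i j i' j'
      rw [Complex.mul_im, him, zero_mul, add_zero] at h
      exact (mul_eq_zero.mp h).resolve_left hij
  · rintro (hg | hg)
    · exact Subgroup.le_normalizer ((mem_H0_iff g).mpr hg)
    · have key : ∀ x : G, (∀ i j, (x i j).re = 0) → ∀ h ∈ H0, x * h * x⁻¹ ∈ H0 := by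
        intro x hx h hh
        rw [mem_H0_iff] at hh ⊢
        intro i j
        rw [hconj]
        fin_cases i <;> fin_cases j <;>
          simp [Matrix.mul_apply, Fin.sum_univ_two, hx, hh]
      have hg' : ∀ i j, ((g⁻¹ : G) i j).re = 0 := by
        intro i j
        rw [hinv]
        fin_cases i <;> fin_cases j <;> simp [hg]
      refine Subgroup.mem_normalizer_iff.mpr fun h => ⟨key g hg h, fun hh => ?_⟩
      have := key g⁻¹ hg' _ hh
      simpa [mul_assoc] using this

/-! ### The left-invariant metric -/

/-- The norm `(|Z₁|² + |Z₂|² + |Z₃|²)^{1/2}` of `!![Z₁, Z₂; Z₃, -Z₁]`. -/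
def slNorm (Z : Matrix (Fin 2) (Fin 2) ℂ) : ℝ :=
  Real.sqrt (‖Z 0 0‖ ^ 2 + ‖Z 0 1‖ ^ 2 + ‖Z 1 0‖ ^ 2)

/-- Length `∫₀¹ ‖γ(t)⁻¹ γ'(t)‖ dt` of a curve for the left-invariant Riemannian metric
defined by `slNorm` on the Lie algebra. -/
def pathLength (γ : ℝ → G) : ℝ :=
  ∫ t in (0 : ℝ)..1, slNorm (((γ t)⁻¹ : G).1 * Matrix.of fun i j => deriv (fun τ => γ τ i j) t)

/-- The left-invariant distance on `G₀`: the infimum of the lengths of `C¹` curves. -/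
def dG (g h : G) : ℝ :=
  sInf {L : ℝ | ∃ γ : ℝ → G, (∀ i j, ContDiff ℝ 1 fun t => γ t i j) ∧ γ 0 = g ∧ γ 1 = h ∧
    L = pathLength γ}

/-- The distance `d(g, H')`. -/
def dHprime (g : G) : ℝ := ⨅ h : Hprime, dG g h

/-! ### Haar measures, spherical functions, spherical transform, convolution -/

theorem isCompact_SU2 : IsCompact (SU2 : Set G) := by
  have hind : Topology.IsInducing fun g : G => (g : Matrix (Fin 2) (Fin 2) ℂ) :=
    Matrix.SpecialLinearGroup.isClosedEmbedding_val.isInducing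
  rw [hind.isCompact_iff]
  have himg : ((fun g : G => (g : Matrix (Fin 2) (Fin 2) ℂ)) '' (SU2 : Set G))
      = {A | star A * A = 1} ∩ {A | A.det = 1} := by
    ext A
    constructor
    · rintro ⟨g, hg, rfl⟩
      exact ⟨Matrix.mem_unitaryGroup_iff'.mp hg, g.2⟩
    · rintro ⟨h1, h2⟩
      exact ⟨⟨A, h2⟩, Matrix.mem_unitaryGroup_iff'.mpr h1, rfl⟩
  have hK : IsCompact (Set.univ.pi fun _ : Fin 2 => Set.univ.pi fun _ : Fin 2 =>
      Metric.closedBall (0 : ℂ) 1) :=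
    isCompact_univ_pi fun _ => isCompact_univ_pi fun _ => isCompact_closedBall 0 1
  rw [himg]
  refine IsCompact.of_isClosed_subset hK ?_ ?_
  · exact (isClosed_eq (by fun_prop) continuous_const).inter
      (isClosed_eq (by fun_prop) continuous_const)
  · rintro A ⟨h1, -⟩ i - j -
    rw [mem_closedBall_zero_iff]
    exact entry_norm_bound_of_unitary (Matrix.mem_unitaryGroup_iff'.mpr h1) i j

instance : CompactSpace SU2 := isCompact_iff_compactSpace.mp isCompact_SU2

instance : MeasurableSpace SU2 := borel SU2

instance : BorelSpace SU2 := ⟨rfl⟩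

/-- The Haar measure of total mass `1` on `K₀`. -/
def haarK : Measure SU2 := Measure.haarMeasure ⊤

/-- Integration over `G₀` against the Haar measure `dg` that extends the hyperbolic volume
`e^{-2t} dz dt` of `ℍ³` (at the point `(z, e^t) = n(z) a(t) (0, 1)`) by the measure of mass `1`
on `K₀`. -/
def intG (f : G → ℂ) : ℂ :=
  ∫ p : ℂ × ℝ, (Real.exp (-2 * p.2) : ℂ) * ∫ k : SU2, f (n p.1 * a p.2 * k) ∂haarK

/-- Convolution on `G₀`. -/
def conv (f₁ f₂ : G → ℂ) (g : G) : ℂ := intG fun x => f₁ x * f₂ (x⁻¹ * g)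

/-- Harish-Chandra's spherical function `φ_s(g) = ∫_K e^{(1 + i s) A(u g)} du` of `ℍ³`. -/
def sph (s : ℝ) (g : G) : ℂ :=
  ∫ u : SU2, Complex.exp ((1 + Complex.I * s) * height (u * g)) ∂haarK

/-- The spherical transform `s ↦ ∫_G f(g) φ_{-s}(g) dg`. -/
def sphTransform (f : G → ℂ) (s : ℝ) : ℂ := intG fun g => f g * sph (-s) g

/-- The inverse spherical transform of an even function `F`: the integral of `F(s) φ_s` against
the Plancherel measure `(2π²)⁻¹ s² ds` on `(0, ∞)`. -/
def invSphTransform (F : ℝ → ℂ) (g : G) : ℂ :=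
  (1 / (2 * (Real.pi : ℂ) ^ 2)) * ∫ s in Set.Ioi (0 : ℝ), F s * sph s g * (s : ℂ) ^ 2

/-! ### The kernel `k_λ` -/

/-- Functions of Paley-Wiener type on `ℝ`: Fourier transforms of functions in `C_c^∞(ℝ)`. -/
def PaleyWiener (h : ℝ → ℝ) : Prop :=
  ∃ w : ℝ → ℂ, ContDiff ℝ ∞ w ∧ HasCompactSupport w ∧
    ∀ s : ℝ, (h s : ℂ) = ∫ x : ℝ, w x * Complex.exp (-(Complex.I * s * x))

/-- `h_λ⁰(s) = h(s - λ) + h(-s - λ)`. -/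
def h0 (h : ℝ → ℝ) (l s : ℝ) : ℂ := ((h (s - l) + h (-s - l) : ℝ) : ℂ)

/-- `k_λ⁰`, the `K₀`-bi-invariant function with spherical transform `h_λ⁰`. -/
def k0 (h : ℝ → ℝ) (l : ℝ) : G → ℂ := invSphTransform (h0 h l)

/-- `k_λ = k_λ⁰ * k_λ⁰`. -/
def kl (h : ℝ → ℝ) (l : ℝ) : G → ℂ := conv (k0 h l) (k0 h l)

/-! ### The integrals `I(λ, g)` and `J(s, g)`

A function `b` on `ℍ²` is written in the coordinates `(x, t) ∈ ℝ²` of the point `(x, e^t)`. -/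

/-- `a(-t₁) n(-x₁) g n(x₂) a(t₂)` for `p = (x₁, t₁)` and `q = (x₂, t₂)`. -/
def mid (p q : ℝ × ℝ) (g : G) : G :=
  a (-p.2) * n ((-p.1 : ℝ) : ℂ) * g * n (q.1 : ℂ) * a q.2

/-- The double period integral `I(λ, g)`. -/
def I (b : ℝ × ℝ → ℂ) (h : ℝ → ℝ) (l : ℝ) (g : G) : ℂ :=
  ∫ p : (ℝ × ℝ) × (ℝ × ℝ),
    b p.1 * conj (b p.2) * kl h l (mid p.1 p.2 g) * (Real.exp (-p.1.2 - p.2.2) : ℂ)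

/-- The amplitude `b₀`. -/
def b0 (b : ℝ × ℝ → ℂ) (g : G) (p q : ℝ × ℝ) (u : G) : ℂ :=
  b p * conj (b q) * (Real.exp (height (u * mid p q g) - p.2 - q.2) : ℂ)

/-- The oscillatory integral `J(s, g)` over `ℍ² × ℍ² × K₀`. -/
def J (b : ℝ × ℝ → ℂ) (s : ℝ) (g : G) : ℂ :=
  ∫ p : (ℝ × ℝ) × (ℝ × ℝ), ∫ u : SU2,
    b0 b g p.1 p.2 u * Complex.exp (Complex.I * s * height (u * mid p.1 p.2 g)) ∂haarK

/-- `b` is smooth with compact support in `S`, and it and its derivatives of order at most `N`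
are bounded by `M`. -/
def Admissible (N : ℕ) (S : Set (ℝ × ℝ)) (M : ℝ) (b : ℝ × ℝ → ℂ) : Prop :=
  ContDiff ℝ ∞ b ∧ HasCompactSupport b ∧ tsupport b ⊆ S ∧
    ∀ j ≤ N, ∀ x, ‖iteratedFDeriv ℝ j b x‖ ≤ M

end HypPeriod

end

/-!
Write `r` for the distance in `ℍ³` between the base point and its image under `g`, so that
`cosh r = ch g`. The whole proof runs on the explicit form `φ_s = sin(s r) / (s sinh r)` of the
spherical functions (`sph_mul_sinh`). It holds because `|e₂ u g|²`, for `u` uniformly distributed in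
`SU(2)`, is uniformly distributed between the squares of the singular values of `g`
(`integral_SU2_nsq`), which is seen by comparing `SU(2)` with Gaussian integrals on `ℂ²`.

*The function `k_λ⁰`.* The spectral function `h_λ⁰` is even and the Fourier transform of a test
function `w`, so by Fourier inversion `k_λ⁰` equals `-w'(r) / (2π sinh r)`. This vanishes for large
`r`, which gives the compact support, and its integrals over horocycles give back `w`
(`IsEvenPW.integral_invSph_horocycle`). As the hyperbolic volume `e^{-2t} dz dt` is invariant under
`G` (`integral_iwasawa_mul_left`), the waves `e^{(1 + i s) A}`, and hence the spherical functions,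
are eigenfunctions of convolution with `k_λ⁰` with eigenvalue `h_λ⁰(s)`. This determines the
spherical transform of `k_λ⁰` (`IsEvenPW.sphTransform_invSph`), and shows that `k_λ` has spherical
transform `(h_λ⁰)²` (`IsEvenPW.conv_invSph`).

*The integral `J`.* It is the pairing of `b` with itself under the kernel `φ_s(dist(p, g q))`, for
`p` and `q` in `ℍ²`. For fixed `p`, the plane `g ℍ²` has a unique point nearest to `p`, at distance
`|δ(p)|`, and in suitable coordinates `v` around it `cosh r = cosh δ (1 + |v|² / 2)`
(`ch_mid_moved`). Integration by parts in the radial direction shows that the `q`-integral equals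
`2π cos(s δ) / (s² cosh δ)` times the value of the amplitude at the nearest point, up to `O(|s|⁻³)`
(`norm_integral_plane_sub_le`). Here `sinh δ` is the function
`ℓ(x, t) = A e^t + (A x² + B x + C) e^{-t}`, whose coefficients are explicit in the entries of `g`,
and `d(g, H') = O(D)` for `D = |A| + |B| + |C|` (`dHprime_le`): when these coefficients are small, a
short path leads from `g` to `H'`. It remains to gain a factor `(|s| D)⁻¹` in the integral of
`cos(s δ) / cosh δ` over `ℍ²`. On bounded sets the gradient of `ℓ` is at least of size `D` times the
distance to one point (`exists_grad_lower_bound`), which allows for an integration by parts along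
`∇ℓ / (|∇ℓ|² + s⁻²)` (`integral_cosKer_eq`, `exists_bound_integral_cosKer`); this field is
divergence free up to a term concentrated near that point.

*The integral `I`.* By the first part `I(λ, g)` is the integral of `J(s, g)` against
`h_λ⁰(s)² s² ds / (2π²)` over `s > 0` (`I_eq`). The weight `h_λ⁰(s)²` is concentrated near
`s = |λ|`, so the bound for `I` follows from the one for `J`.
-/

noncomputable section

namespace HypPeriod

/-! ### Integration over `SU(2)` by means of Gaussian integrals on `ℂ²` -/

/-- The row vector `v A`, with vectors of `ℂ²` written as pairs. -/
def rowMul (v : ℂ × ℂ) (A : Matrix (Fin 2) (Fin 2) ℂ) : ℂ × ℂ :=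
  (v.1 * A 0 0 + v.2 * A 1 0, v.1 * A 0 1 + v.2 * A 1 1)

/-- The squared Euclidean norm on `ℂ²` (the norm of the product type is the maximum). -/
def nsq (v : ℂ × ℂ) : ℝ := ‖v.1‖ ^ 2 + ‖v.2‖ ^ 2

theorem rowMul_rowMul (v : ℂ × ℂ) (A B : Matrix (Fin 2) (Fin 2) ℂ) :
    rowMul (rowMul v A) B = rowMul v (A * B) := by
  simp only [rowMul, Matrix.mul_apply, Fin.sum_univ_two]
  ext <;> simp <;> ring

theorem rowMul_one (v : ℂ × ℂ) : rowMul v 1 = v := by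
  simp [rowMul]

theorem continuous_rowMul : Continuous fun p : (ℂ × ℂ) × Matrix (Fin 2) (Fin 2) ℂ =>
    rowMul p.1 p.2 := by
  unfold rowMul
  fun_prop

theorem continuous_nsq : Continuous nsq := by
  unfold nsq
  fun_prop

theorem nsq_nonneg (v : ℂ × ℂ) : 0 ≤ nsq v := by
  unfold nsq
  positivity

theorem nsq_eq_zero_iff (v : ℂ × ℂ) : nsq v = 0 ↔ v = 0 := by
  unfold nsq
  rw [add_eq_zero_iff_of_nonneg (by positivity) (by positivity)]
  simp [Prod.ext_iff]

theorem nsq_smul (c : ℝ) (v : ℂ × ℂ) : nsq (c • v) = c ^ 2 * nsq v := by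
  simp only [nsq, Prod.smul_fst, Prod.smul_snd, norm_smul, Real.norm_eq_abs, mul_pow, sq_abs]
  ring

theorem rowMul_smul (c : ℝ) (v : ℂ × ℂ) (A : Matrix (Fin 2) (Fin 2) ℂ) :
    rowMul (c • v) A = c • rowMul v A := by
  simp only [rowMul, Prod.smul_fst, Prod.smul_snd, Complex.real_smul]
  ext <;> simp <;> ring

/-- `|v A|² = v (A Aᴴ) vᴴ`. -/
theorem nsq_rowMul (v : ℂ × ℂ) (A : Matrix (Fin 2) (Fin 2) ℂ) :
    (nsq (rowMul v A) : ℂ) =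
      v.1 * ((A * star A) 0 0) * conj v.1 + v.1 * ((A * star A) 0 1) * conj v.2
      + v.2 * ((A * star A) 1 0) * conj v.1 + v.2 * ((A * star A) 1 1) * conj v.2 := by
  simp only [nsq, rowMul, Complex.ofReal_add, Complex.ofReal_pow, ← Complex.mul_conj',
    Matrix.mul_apply, Fin.sum_univ_two, Matrix.star_apply, RCLike.star_def, map_add, map_mul]
  ring

theorem nsq_rowMul_unitary (v : ℂ × ℂ) {U : Matrix (Fin 2) (Fin 2) ℂ}
    (hU : U ∈ Matrix.unitaryGroup (Fin 2) ℂ) : nsq (rowMul v U) = nsq v := by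
  have h := nsq_rowMul v U
  have h1 := nsq_rowMul v 1
  rw [Matrix.mem_unitaryGroup_iff.mp hU] at h
  rw [star_one, mul_one, rowMul_one] at h1
  exact_mod_cast h.trans h1.symm

/-- Right multiplication by a matrix, as a real linear map of `ℂ²`. -/
def rowMulLin (A : Matrix (Fin 2) (Fin 2) ℂ) : (ℂ × ℂ) →ₗ[ℝ] (ℂ × ℂ) where
  toFun v := rowMul v A
  map_add' v w := by simp only [rowMul]; ext <;> simp <;> ring
  map_smul' c v := by simp [rowMul_smul]

instance : (volume : Measure (ℂ × ℂ)).IsAddHaarMeasure :=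
  inferInstanceAs ((volume : Measure ℂ).prod (volume : Measure ℂ)).IsAddHaarMeasure

/-- Unitary matrices preserve the Lebesgue measure on `ℂ²`, because they preserve the unit ball. -/
theorem measurePreserving_rowMul {U : Matrix (Fin 2) (Fin 2) ℂ}
    (hU : U ∈ Matrix.unitaryGroup (Fin 2) ℂ) :
    MeasurePreserving (fun v : ℂ × ℂ => rowMul v U) volume volume := by
  have hU' : star U ∈ Matrix.unitaryGroup (Fin 2) ℂ := Unitary.star_mem hU
  have himg : rowMulLin U '' {v | nsq v ≤ 1} = {v | nsq v ≤ 1} := by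
    ext v
    constructor
    · rintro ⟨w, hw, rfl⟩
      change nsq (rowMul w U) ≤ 1
      rw [nsq_rowMul_unitary _ hU]
      exact hw
    · intro hv
      refine ⟨rowMul v (star U), ?_, ?_⟩
      · change nsq _ ≤ 1
        rw [nsq_rowMul_unitary _ hU']
        exact hv
      · change rowMul _ U = v
        rw [rowMul_rowMul, Matrix.mem_unitaryGroup_iff'.mp hU, rowMul_one]
  have hvol := Measure.addHaar_image_linearMap (volume : Measure (ℂ × ℂ)) (rowMulLin U)
    {v | nsq v ≤ 1}
  rw [himg] at hvol
  have hsub : {v : ℂ × ℂ | nsq v ≤ 1} ⊆ Metric.closedBall 0 1 := by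
    intro v hv
    have hv : ‖v.1‖ ^ 2 + ‖v.2‖ ^ 2 ≤ 1 := hv
    rw [mem_closedBall_zero_iff, Prod.norm_def]
    refine max_le ?_ ?_ <;> nlinarith [norm_nonneg v.1, norm_nonneg v.2]
  have hfin : volume {v : ℂ × ℂ | nsq v ≤ 1} ≠ ⊤ :=
    ((measure_mono hsub).trans_lt measure_closedBall_lt_top).ne
  have hpos : volume {v : ℂ × ℂ | nsq v ≤ 1} ≠ 0 := by
    have hopen : IsOpen {v : ℂ × ℂ | nsq v < 1} := isOpen_lt continuous_nsq continuous_const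
    have : 0 < volume {v : ℂ × ℂ | nsq v < 1} := hopen.measure_pos _ ⟨0, by simp [nsq]⟩
    exact (this.trans_le (measure_mono fun v (hv : nsq v < 1) => hv.le)).ne'
  have hdet : ENNReal.ofReal |LinearMap.det (rowMulLin U)| = 1 := by
    have h1 : (1 : ENNReal) * volume {v : ℂ × ℂ | nsq v ≤ 1}
        = ENNReal.ofReal |LinearMap.det (rowMulLin U)| * volume {v : ℂ × ℂ | nsq v ≤ 1} := by
      rw [one_mul]; exact hvol
    exact ((ENNReal.mul_left_inj hpos hfin).mp h1).symm
  have habs : |LinearMap.det (rowMulLin U)| = 1 := by simpa using hdet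
  refine ⟨by unfold rowMul; fun_prop, ?_⟩
  have hne : LinearMap.det (rowMulLin U) ≠ 0 := by
    intro h; simp [h] at habs
  have := Measure.map_linearMap_addHaar_eq_smul_addHaar (volume : Measure (ℂ × ℂ)) hne
  rw [abs_inv, habs] at this
  simpa [rowMulLin] using this

theorem integral_rowMul {U : Matrix (Fin 2) (Fin 2) ℂ}
    (hU : U ∈ Matrix.unitaryGroup (Fin 2) ℂ) (f : ℂ × ℂ → ℂ) :
    ∫ v, f (rowMul v U) = ∫ v, f v := by
  have hinj : Function.Injective fun v : ℂ × ℂ => rowMul v U := by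
    intro v w h
    have := congrArg (fun x => rowMul x (star U)) h
    simpa only [rowMul_rowMul, Matrix.mem_unitaryGroup_iff.mp hU, rowMul_one] using this
  have hcont : Continuous fun v : ℂ × ℂ => rowMul v U := by unfold rowMul; fun_prop
  exact (measurePreserving_rowMul hU).integral_comp (hcont.measurableEmbedding hinj) f

theorem integrable_gaussian_nsq : Integrable fun v : ℂ × ℂ => Real.exp (-nsq v) := by
  have h : Integrable fun z : ℂ => Real.exp (-‖z‖ ^ 2) := by
    have := GaussianFourier.integrable_cexp_neg_mul_sq_norm_add (V := ℂ) (b := 1) (by simp) 0 0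
    have := this.norm
    refine this.congr (Filter.Eventually.of_forall fun z => ?_)
    simp [Complex.norm_exp, ← Complex.ofReal_pow]
  have := h.mul_prod h
  refine this.congr (Filter.Eventually.of_forall fun z => ?_)
  simp [nsq, ← Real.exp_add]
  ring

/-- Integration in polar coordinates on `ℂ`, with the squared radius as variable. -/
theorem integral_norm_sq (f : ℝ → ℂ) :
    ∫ z : ℂ, f (‖z‖ ^ 2) = Real.pi * ∫ y in Set.Ioi (0 : ℝ), f y := by
  have h := integral_fun_norm_addHaar (volume : Measure ℂ) fun y => f (y ^ 2)
  rw [h]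
  have h2 := integral_comp_rpow_Ioi_of_pos (g := f) (p := 2) (by norm_num)
  rw [← h2]
  simp [Complex.finrank_real_complex, Measure.real, Complex.volume_ball]
  rw [← integral_const_mul, ← integral_const_mul, ← integral_const_mul]
  congr 1
  ext y
  norm_num
  ring

theorem integral_Ioi_comp_div_one_add (f : ℝ → ℂ) :
    ∫ u in Set.Ioi (0 : ℝ), ((1 / (1 + u) ^ 2 : ℝ) : ℂ) * f (u / (1 + u))
      = ∫ x in (0 : ℝ)..1, f x := by
  have himg : (fun u : ℝ => u / (1 + u)) '' Set.Ioi 0 = Set.Ioo 0 1 := by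
    ext x
    constructor
    · rintro ⟨u, hu, rfl⟩
      have hu : 0 < u := hu
      exact ⟨by positivity, by rw [div_lt_one (by positivity)]; linarith⟩
    · rintro ⟨h0, h1⟩
      have : 0 < 1 - x := by linarith
      refine ⟨x / (1 - x), by simp only [Set.mem_Ioi]; positivity, ?_⟩
      field_simp
      ring
  have hinj : Set.InjOn (fun u : ℝ => u / (1 + u)) (Set.Ioi 0) := by
    intro u hu v hv h
    have hu : 0 < u := hu
    have hv : 0 < v := hv
    simp only at h
    rw [div_eq_div_iff (by positivity) (by positivity)] at h
    linarith
  have hd : ∀ u ∈ Set.Ioi (0 : ℝ), HasDerivWithinAt (fun u : ℝ => u / (1 + u))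
      (1 / (1 + u) ^ 2) (Set.Ioi 0) u := by
    intro u hu
    have hu : 0 < u := hu
    have h := (hasDerivAt_id u).div ((hasDerivAt_id u).const_add 1) (by positivity)
    refine (h.congr_deriv ?_).hasDerivWithinAt
    simp
  have h := integral_image_eq_integral_abs_deriv_smul measurableSet_Ioi hd hinj f
  rw [himg] at h
  rw [intervalIntegral.integral_of_le zero_le_one, integral_Ioc_eq_integral_Ioo, h]
  refine setIntegral_congr_fun measurableSet_Ioi fun u hu => ?_
  rw [abs_of_nonneg (by positivity), Complex.real_smul]

/-- The ratio `X / (X + Y)` of two independent exponential variables is uniform on `[0, 1]`. -/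
theorem integral_exp_ratio (f : ℝ → ℂ) (hf : Measurable f) (hb : ∃ M, ∀ x, ‖f x‖ ≤ M) :
    ∫ y in Set.Ioi (0 : ℝ), ∫ x in Set.Ioi (0 : ℝ), (Real.exp (-(x + y)) : ℂ) * f (x / (x + y))
      = ∫ x in (0 : ℝ)..1, f x := by
  obtain ⟨M, hM⟩ := hb
  have h1 : ∀ y ∈ Set.Ioi (0 : ℝ),
      ∫ x in Set.Ioi (0 : ℝ), (Real.exp (-(x + y)) : ℂ) * f (x / (x + y))
      = ∫ u in Set.Ioi (0 : ℝ), (y * Real.exp (-((1 + u) * y)) : ℝ) * f (u / (1 + u)) := by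
    intro y hy
    have hy : 0 < y := hy
    have := integral_comp_mul_left_Ioi'
      (fun x : ℝ => (Real.exp (-(x + y)) : ℂ) * f (x / (x + y))) 0 hy
    rw [mul_zero] at this
    rw [← this, ← integral_smul]
    refine integral_congr_ae (Filter.Eventually.of_forall fun u => ?_)
    simp only [Complex.real_smul]
    rw [show y * u + y = y * (1 + u) by ring, mul_div_mul_left _ _ hy.ne', ← mul_assoc,
      ← Complex.ofReal_mul, mul_comm y (1 + u)]
  -- substituting `x = u y` makes the second factor independent of `y`
  have hint : ∀ u ∈ Set.Ioi (0 : ℝ),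
      ∫ y in Set.Ioi (0 : ℝ), y * Real.exp (-((1 + u) * y)) = 1 / (1 + u) ^ 2 := by
    intro u hu
    have hu : 0 < u := hu
    have := Real.integral_rpow_mul_exp_neg_mul_Ioi (a := 2) (r := 1 + u) (by norm_num)
      (by positivity)
    rw [Real.Gamma_two, mul_one, Real.rpow_two] at this
    rw [div_pow, one_pow] at this
    rw [← this]
    refine setIntegral_congr_fun measurableSet_Ioi fun y hy => ?_
    norm_num
  -- the integral is not zero, which it would be by convention without integrability
  have hint' : ∀ u ∈ Set.Ioi (0 : ℝ),
      IntegrableOn (fun y : ℝ => y * Real.exp (-((1 + u) * y))) (Set.Ioi 0) := by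
    intro u hu
    by_contra hcon
    have := hint u hu
    rw [integral_undef hcon] at this
    have hu : 0 < u := hu
    have h2 : 0 < 1 / (1 + u) ^ 2 := by positivity
    linarith
  have hint2 : IntegrableOn (fun u : ℝ => 1 / (1 + u) ^ 2) (Set.Ioi 0) := by
    have h := integral_Ioi_comp_div_one_add fun _ => 1
    simp only [mul_one, intervalIntegral.integral_const, sub_zero, one_smul] at h
    by_contra hcon
    have h2 : ∫ u in Set.Ioi (0 : ℝ), (1 / (1 + u) ^ 2 : ℝ) = 1 := by
      rw [integral_complex_ofReal] at h
      exact_mod_cast h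
    rw [integral_undef hcon] at h2
    norm_num at h2
  rw [setIntegral_congr_fun measurableSet_Ioi h1, integral_integral_swap]
  · rw [← integral_Ioi_comp_div_one_add]
    refine setIntegral_congr_fun measurableSet_Ioi fun u hu => ?_
    rw [integral_mul_const, integral_complex_ofReal, hint u hu]
  · have hmeas : Measurable (Function.uncurry fun y u : ℝ =>
        ((y * Real.exp (-((1 + u) * y)) : ℝ) : ℂ) * f (u / (1 + u))) := by
      unfold Function.uncurry
      refine Measurable.mul (by fun_prop) (hf.comp (by fun_prop))
    have hmaj : Integrable (fun p : ℝ × ℝ => M * (p.1 * Real.exp (-((1 + p.2) * p.1))))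
        ((volume.restrict (Set.Ioi 0)).prod (volume.restrict (Set.Ioi 0))) := by
      refine Integrable.const_mul ?_ M
      refine (integrable_prod_iff' (by fun_prop)).mpr ⟨?_, ?_⟩
      · exact (ae_restrict_mem measurableSet_Ioi).mono fun u hu => hint' u hu
      · refine hint2.congr ?_
        refine (ae_restrict_mem measurableSet_Ioi).mono fun u hu => ?_
        simp only
        rw [← hint u hu]
        refine setIntegral_congr_fun measurableSet_Ioi fun y hy => ?_
        have hy : 0 < y := hy
        rw [Real.norm_of_nonneg (by positivity)]
    refine hmaj.mono' hmeas.aestronglyMeasurable ?_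
    rw [Measure.prod_restrict]
    refine (ae_restrict_mem (measurableSet_Ioi.prod measurableSet_Ioi)).mono ?_
    rintro ⟨y, u⟩ ⟨hy, hu⟩
    have hy : 0 < y := hy
    simp only [Function.uncurry]
    rw [norm_mul, Complex.norm_real]
    rw [Real.norm_of_nonneg (show 0 ≤ y * Real.exp (-((1 + u) * y)) by positivity), mul_comm M]
    exact mul_le_mul_of_nonneg_left (hM _) (by positivity)

instance : IsProbabilityMeasure haarK :=
  ⟨by rw [haarK, ← TopologicalSpace.PositiveCompacts.coe_top (α := SU2)]
      exact Measure.haarMeasure_self⟩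

instance : haarK.IsMulLeftInvariant := inferInstanceAs (Measure.haarMeasure _).IsMulLeftInvariant

theorem continuous_val : Continuous fun g : G => (g : Matrix (Fin 2) (Fin 2) ℂ) :=
  continuous_subtype_val

theorem continuous_entry (i j : Fin 2) : Continuous fun g : G => g i j :=
  (continuous_apply_apply i j).comp continuous_val

instance : SecondCountableTopology G :=
  have : SecondCountableTopology (Matrix (Fin 2) (Fin 2) ℂ) :=
    inferInstanceAs (SecondCountableTopology (Fin 2 → Fin 2 → ℂ))
  (Matrix.SpecialLinearGroup.isClosedEmbedding_val
    (n := Fin 2) (R := ℂ)).isEmbedding.secondCountableTopology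

instance : SecondCountableTopology SU2 :=
  TopologicalSpace.Subtype.secondCountableTopology (SU2 : Set G)

/-- The matrix in `SU(2)` whose bottom row is a given unit vector. -/
theorem exists_SU2_row (v : ℂ × ℂ) (hv : nsq v = 1) : ∃ k ∈ SU2, k 1 0 = v.1 ∧ k 1 1 = v.2 := by
  have hv' : v.1 * conj v.1 + v.2 * conj v.2 = 1 := by
    rw [Complex.mul_conj', Complex.mul_conj']
    exact_mod_cast hv
  refine ⟨⟨!![conj v.2, -conj v.1; v.1, v.2], ?_⟩, ?_, ?_, ?_⟩
  · rw [Matrix.det_fin_two_of]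
    linear_combination hv'
  · change _ ∈ Matrix.unitaryGroup (Fin 2) ℂ
    rw [Matrix.mem_unitaryGroup_iff]
    ext i j
    fin_cases i <;> fin_cases j <;>
      simp [Matrix.mul_apply, Fin.sum_univ_two, Matrix.star_apply] <;>
      first
        | ring1
        | linear_combination hv'
  · rfl
  · rfl

/-- The Haar measure of `SU(2)` is the angular part of the Gaussian measure of `ℂ²`. -/
theorem integral_SU2_row (f : ℂ × ℂ → ℂ) (hf : Measurable f) (hb : ∃ M, ∀ v, ‖f v‖ ≤ M)
    (hhom : ∀ c : ℝ, 0 < c → ∀ v, f (c • v) = f v) :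
    ∫ v : ℂ × ℂ, (Real.exp (-nsq v) : ℂ) * f v
      = (∫ v : ℂ × ℂ, (Real.exp (-nsq v) : ℂ)) * ∫ u : SU2, f (u.1 1 0, u.1 1 1) ∂haarK := by
  obtain ⟨M, hM⟩ := hb
  have hrow : Continuous fun p : (ℂ × ℂ) × SU2 => rowMul p.1 p.2.1.1 :=
    continuous_rowMul.comp (continuous_fst.prodMk
      (continuous_val.comp (continuous_subtype_val.comp continuous_snd)))
  -- average over rotations of the variable
  have h1 : ∀ u : SU2, ∫ v : ℂ × ℂ, (Real.exp (-nsq v) : ℂ) * f (rowMul v u.1.1)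
      = ∫ v : ℂ × ℂ, (Real.exp (-nsq v) : ℂ) * f v := by
    intro u
    rw [← integral_rowMul (U := u.1.1) u.2 fun v => (Real.exp (-nsq v) : ℂ) * f v]
    simp only [nsq_rowMul_unitary _ (show u.1.1 ∈ Matrix.unitaryGroup (Fin 2) ℂ from u.2)]
  -- as `SU(2)` is transitive on the unit sphere, the average over it does not depend on `v`
  have h2 : ∀ v : ℂ × ℂ, v ≠ 0 →
      ∫ u : SU2, f (rowMul v u.1.1) ∂haarK = ∫ u : SU2, f (u.1 1 0, u.1 1 1) ∂haarK := by
    intro v hv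
    have hn : 0 < nsq v :=
      lt_of_le_of_ne (nsq_nonneg v) fun h => hv ((nsq_eq_zero_iff v).mp h.symm)
    have hs : 0 < (Real.sqrt (nsq v))⁻¹ := by positivity
    obtain ⟨k, hk, hk0, hk1⟩ := exists_SU2_row ((Real.sqrt (nsq v))⁻¹ • v) (by
      rw [nsq_smul, inv_pow, Real.sq_sqrt hn.le, inv_mul_cancel₀ hn.ne'])
    rw [← integral_mul_left_eq_self (μ := haarK) (fun u : SU2 => f (u.1 1 0, u.1 1 1)) ⟨k, hk⟩]
    refine integral_congr_ae (Filter.Eventually.of_forall fun u => ?_)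
    simp only
    rw [← hhom _ hs, ← rowMul_smul]
    congr 1
    change _ = ((k.1 * u.1.1) 1 0, (k.1 * u.1.1) 1 1)
    simp only [rowMul, Matrix.mul_apply, Fin.sum_univ_two, ← hk0, ← hk1]
  have hint : Integrable (fun p : SU2 × (ℂ × ℂ) => (Real.exp (-nsq p.2) : ℂ) * f (rowMul p.2 p.1.1.1))
      (haarK.prod volume) := by
    have hmaj : Integrable (fun p : SU2 × (ℂ × ℂ) => (1 : ℝ) * (M * Real.exp (-nsq p.2)))
        (haarK.prod volume) :=
      (integrable_const (1 : ℝ)).mul_prod (integrable_gaussian_nsq.const_mul M)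
    refine hmaj.mono' ?_ (Filter.Eventually.of_forall fun p => ?_)
    · refine Measurable.aestronglyMeasurable (Measurable.mul ?_ (hf.comp ?_))
      · have := continuous_nsq
        fun_prop
      · exact (hrow.comp continuous_swap).measurable
    · rw [norm_mul, Complex.norm_real, Real.norm_of_nonneg (Real.exp_pos _).le, one_mul, mul_comm M]
      exact mul_le_mul_of_nonneg_left (hM _) (Real.exp_pos _).le
  calc ∫ v : ℂ × ℂ, (Real.exp (-nsq v) : ℂ) * f v
      = ∫ u : SU2, (∫ v : ℂ × ℂ, (Real.exp (-nsq v) : ℂ) * f (rowMul v u.1.1)) ∂haarK := by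
        simp only [h1, integral_const, probReal_univ, one_smul]
    _ = ∫ v : ℂ × ℂ, ∫ u : SU2, (Real.exp (-nsq v) : ℂ) * f (rowMul v u.1.1) ∂haarK :=
        integral_integral_swap hint
    _ = ∫ v : ℂ × ℂ, (Real.exp (-nsq v) : ℂ) * ∫ u : SU2, f (u.1 1 0, u.1 1 1) ∂haarK := by
        refine integral_congr_ae ?_
        have : ∀ᵐ v : ℂ × ℂ, v ≠ 0 := by
          simp [ae_iff, measure_singleton]
        filter_upwards [this] with v hv
        rw [integral_const_mul, h2 v hv]
    _ = _ := integral_mul_const _ _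

/-! ### The spherical functions in polar coordinates -/

/-- Half the squared Hilbert-Schmidt norm. It is the hyperbolic cosine of the distance in `ℍ³`
from the base point to its image under `g`. -/
def ch (g : G) : ℝ := (‖g 0 0‖ ^ 2 + ‖g 0 1‖ ^ 2 + ‖g 1 0‖ ^ 2 + ‖g 1 1‖ ^ 2) / 2

theorem continuous_ch : Continuous ch := by
  unfold ch
  have := continuous_entry
  fun_prop

theorem det_entries (g : G) : g 0 0 * g 1 1 - g 0 1 * g 1 0 = 1 := by
  rw [← Matrix.det_fin_two]; exact g.2

theorem mul_entry (g h : G) (i j : Fin 2) : (g * h) i j = g i 0 * h 0 j + g i 1 * h 1 j := by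
  change (g.1 * h.1) i j = _
  rw [Matrix.mul_apply, Fin.sum_univ_two]

theorem inv_val (g : G) : (g⁻¹ : G).1 = !![g 1 1, -g 0 1; -g 1 0, g 0 0] := by
  rw [Matrix.SpecialLinearGroup.coe_inv, Matrix.adjugate_fin_two]

theorem one_le_ch (g : G) : 1 ≤ ch g := by
  have h := congrArg norm (det_entries g)
  rw [norm_one] at h
  have h1 := norm_sub_le (g 0 0 * g 1 1) (g 0 1 * g 1 0)
  rw [norm_mul, norm_mul, h] at h1
  unfold ch
  nlinarith [sq_nonneg (‖g 0 0‖ - ‖g 1 1‖), sq_nonneg (‖g 0 1‖ - ‖g 1 0‖)]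

theorem ch_inv (g : G) : ch g⁻¹ = ch g := by
  unfold ch
  rw [inv_val]
  simp
  ring

theorem row_norms (g : G) (i : Fin 2) :
    (((g.1 * star g.1) i i : ℂ)) = ((‖g i 0‖ ^ 2 + ‖g i 1‖ ^ 2 : ℝ) : ℂ) := by
  simp only [Matrix.mul_apply, Fin.sum_univ_two, Matrix.star_apply, RCLike.star_def,
    Complex.mul_conj']
  push_cast
  rfl

theorem trace_mul_star (g : G) : (g.1 * star g.1).trace = (2 * ch g : ℝ) := by
  rw [Matrix.trace_fin_two, row_norms, row_norms]
  unfold ch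
  push_cast
  ring

theorem ch_mul_SU2 (g k : G) (hk : k ∈ SU2) : ch (g * k) = ch g := by
  have h : (g * k).1 * star (g * k).1 = g.1 * star g.1 := by
    change (g.1 * k.1) * star (g.1 * k.1) = _
    rw [star_mul, mul_assoc, ← mul_assoc k.1, Matrix.mem_unitaryGroup_iff.mp hk, one_mul]
  have h1 := trace_mul_star (g * k)
  rw [h, trace_mul_star g] at h1
  have : 2 * ch g = 2 * ch (g * k) := by exact_mod_cast h1
  linarith

theorem ch_SU2_mul (g k : G) (hk : k ∈ SU2) : ch (k * g) = ch g := by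
  rw [← ch_inv, mul_inv_rev, ch_mul_SU2 _ _ (SU2.inv_mem hk), ch_inv]

theorem height_eq (u g : G) :
    height (u * g) = -Real.log (nsq (rowMul (u 1 0, u 1 1) g.1)) := by
  unfold height nsq rowMul
  rw [mul_entry, mul_entry]

/-- Diagonalization of the Hermitian form `v ↦ |v g|²`. -/
theorem exists_diagonalization (g : G) : ∃ U ∈ Matrix.unitaryGroup (Fin 2) ℂ, ∃ c d : ℝ,
    0 < c ∧ 0 < d ∧ c * d = 1 ∧ c + d = 2 * ch g ∧
    ∀ v : ℂ × ℂ, nsq (rowMul (rowMul v U) g.1) = c * ‖v.1‖ ^ 2 + d * ‖v.2‖ ^ 2 := by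
  have hH : (g.1 * star g.1).IsHermitian := Matrix.isHermitian_mul_conjTranspose_self _
  have hU := hH.eigenvectorUnitary.2
  set W : Matrix (Fin 2) (Fin 2) ℂ := hH.eigenvectorUnitary.1
  have hdiag : star W * (g.1 * star g.1) * W
      = Matrix.diagonal fun i => ((hH.eigenvalues i : ℝ) : ℂ) := by
    conv_lhs => rw [hH.spectral_theorem]
    rw [Unitary.conjStarAlgAut_apply]
    change star W * (W * _ * star W) * W = _
    have h1 := Matrix.mem_unitaryGroup_iff'.mp hU
    rw [mul_assoc, mul_assoc, h1, mul_one, ← mul_assoc, h1, one_mul]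
    rfl
  have hform : ∀ v : ℂ × ℂ, nsq (rowMul (rowMul v (star W)) g.1)
      = hH.eigenvalues 0 * ‖v.1‖ ^ 2 + hH.eigenvalues 1 * ‖v.2‖ ^ 2 := by
    intro v
    have h := nsq_rowMul v (star W * g.1)
    have he : star W * g.1 * star (star W * g.1) = star W * (g.1 * star g.1) * W := by
      simp only [star_mul, star_star, mul_assoc]
    rw [he, hdiag] at h
    rw [rowMul_rowMul]
    apply Complex.ofReal_injective
    rw [h]
    simp only [Matrix.diagonal_apply_eq, Matrix.diagonal_apply_ne _ (show (0 : Fin 2) ≠ 1 by decide),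
      Matrix.diagonal_apply_ne _ (show (1 : Fin 2) ≠ 0 by decide)]
    push_cast
    rw [← Complex.mul_conj', ← Complex.mul_conj']
    ring
  have hprod : hH.eigenvalues 0 * hH.eigenvalues 1 = 1 := by
    have h := hH.det_eq_prod_eigenvalues
    have hdet : (g.1 * star g.1).det = 1 := by
      rw [Matrix.det_mul, g.2, one_mul, Matrix.star_eq_conjTranspose,
        Matrix.det_conjTranspose, g.2, star_one]
    rw [Fin.prod_univ_two] at h
    apply Complex.ofReal_injective
    push_cast
    exact (hdet.symm.trans h).symm
  have hsum : hH.eigenvalues 0 + hH.eigenvalues 1 = 2 * ch g := by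
    have h := hH.trace_eq_sum_eigenvalues
    rw [Fin.sum_univ_two, trace_mul_star] at h
    apply Complex.ofReal_injective
    rw [h]
    push_cast
    rfl
  have hc : 0 ≤ hH.eigenvalues 0 := by
    have h := hform (1, 0)
    have h2 := nsq_nonneg (rowMul (rowMul ((1 : ℂ), (0 : ℂ)) (star W)) g.1)
    rw [h] at h2
    simpa using h2
  have hc' : 0 < hH.eigenvalues 0 := lt_of_le_of_ne hc fun h => by simp [← h] at hprod
  refine ⟨star W, Unitary.star_mem hU, _, _, hc', ?_, hprod, hsum, hform⟩
  exact pos_of_mul_pos_right (hprod ▸ one_pos) hc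

theorem integral_gaussian_diag (f : ℝ → ℂ) (hf : Measurable f) (hb : ∃ M, ∀ x, ‖f x‖ ≤ M) :
    ∫ v : ℂ × ℂ, (Real.exp (-nsq v) : ℂ) * f (‖v.1‖ ^ 2 / nsq v)
      = Real.pi ^ 2 * ∫ x in (0 : ℝ)..1, f x := by
  have hbd := hb
  obtain ⟨M, hM⟩ := hb
  have hint : Integrable fun v : ℂ × ℂ => (Real.exp (-nsq v) : ℂ) * f (‖v.1‖ ^ 2 / nsq v) := by
    refine (integrable_gaussian_nsq.const_mul M).mono' ?_ (Filter.Eventually.of_forall fun p => ?_)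
    · have := continuous_nsq.measurable
      exact Measurable.aestronglyMeasurable
        (Measurable.mul (by fun_prop) (hf.comp (by fun_prop)))
    · rw [norm_mul, Complex.norm_real, Real.norm_of_nonneg (Real.exp_pos _).le, mul_comm M]
      exact mul_le_mul_of_nonneg_left (hM _) (Real.exp_pos _).le
  rw [← integral_exp_ratio f hf hbd, Measure.volume_eq_prod, integral_prod_symm _ hint]
  have h1 : ∀ w : ℂ, ∫ z : ℂ, (Real.exp (-nsq (z, w)) : ℂ) * f (‖z‖ ^ 2 / nsq (z, w))
      = Real.pi * ∫ x in Set.Ioi (0 : ℝ), (Real.exp (-(x + ‖w‖ ^ 2)) : ℂ) *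
          f (x / (x + ‖w‖ ^ 2)) := by
    intro w
    rw [← integral_norm_sq]
    rfl
  simp only [h1]
  rw [integral_norm_sq fun y => (Real.pi : ℂ) * ∫ x in Set.Ioi (0 : ℝ),
    (Real.exp (-(x + y)) : ℂ) * f (x / (x + y)), integral_const_mul]
  ring

/-- The distribution of `|e₂ u g|²` for `u` in `SU(2)`: it is uniform between the squares of the
singular values of `g`. -/
theorem integral_SU2_nsq (g : G) : ∃ c d : ℝ, 0 < c ∧ 0 < d ∧ c * d = 1 ∧ c + d = 2 * ch g ∧
    ∀ f : ℝ → ℂ, Measurable f → (∃ M, ∀ x, ‖f x‖ ≤ M) →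
    ∫ u : SU2, f (nsq (rowMul (u.1 1 0, u.1 1 1) g.1)) ∂haarK
      = ∫ x in (0 : ℝ)..1, f (c * x + d * (1 - x)) := by
  obtain ⟨U, hU, c, d, hc, hd, hcd, hsum, hform⟩ := exists_diagonalization g
  refine ⟨c, d, hc, hd, hcd, hsum, fun f hf hb => ?_⟩
  have hnm := continuous_nsq.measurable
  have hrm : Measurable fun v : ℂ × ℂ => rowMul v g.1 := by
    unfold rowMul; fun_prop
  have hE : ∫ v : ℂ × ℂ, (Real.exp (-nsq v) : ℂ) = Real.pi ^ 2 := by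
    have := integral_gaussian_diag (fun _ => 1) measurable_const ⟨1, by simp⟩
    simpa using this
  -- dividing by `nsq v` makes the integrand homogeneous without changing it on the unit sphere
  have h1 := integral_SU2_row (fun v => f (nsq (rowMul v g.1) / nsq v))
    (hf.comp (by fun_prop)) ⟨hb.choose, fun v => hb.choose_spec _⟩ (by
      intro t ht v
      rw [rowMul_smul, nsq_smul, nsq_smul, mul_div_mul_left _ _ (by positivity)])
  have h2 : ∀ u : SU2, nsq (u.1 1 0, u.1 1 1) = 1 := fun u => SU2_row u.1 u.2 1
  simp only [h2, div_one, hE] at h1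
  rw [← integral_rowMul hU] at h1
  simp only [hform, nsq_rowMul_unitary _ hU] at h1
  have h3 : ∫ v : ℂ × ℂ, (Real.exp (-nsq v) : ℂ) *
      f ((c * ‖v.1‖ ^ 2 + d * ‖v.2‖ ^ 2) / nsq v) = Real.pi ^ 2 *
      ∫ x in (0 : ℝ)..1, f (c * x + d * (1 - x)) := by
    rw [← integral_gaussian_diag (fun x => f (c * x + d * (1 - x))) (hf.comp (by fun_prop))
      ⟨hb.choose, fun v => hb.choose_spec _⟩]
    refine integral_congr_ae ?_
    have : ∀ᵐ v : ℂ × ℂ, v ≠ 0 := by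
      simp [ae_iff, measure_singleton]
    filter_upwards [this] with v hv
    have hn : nsq v ≠ 0 := fun h => hv ((nsq_eq_zero_iff v).mp h)
    congr 2
    field_simp
    unfold nsq
    ring
  rw [h3] at h1
  exact (mul_left_cancel₀ (by simp [Real.pi_ne_zero]) h1).symm

/-- The integrand of the spherical function, as a function of `y = |e₂ u g|²`. -/
def sphPow (s y : ℝ) : ℂ := Complex.exp ((1 + Complex.I * s) * ((-Real.log y : ℝ) : ℂ))

theorem norm_sphPow (s : ℝ) {y : ℝ} (hy : 0 < y) : ‖sphPow s y‖ = y⁻¹ := by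
  rw [sphPow, Complex.norm_exp]
  simp [Real.exp_neg, Real.exp_log hy]

theorem sphPow_exp (s x : ℝ) :
    sphPow s (Real.exp x) = Complex.exp ((1 + Complex.I * s) * ((-x : ℝ) : ℂ)) := by
  rw [sphPow, Real.log_exp]

theorem continuousOn_sphPow (s : ℝ) : ContinuousOn (sphPow s) (Set.Ioi 0) := by
  unfold sphPow
  refine Complex.continuous_exp.comp_continuousOn (continuousOn_const.mul ?_)
  refine Complex.continuous_ofReal.comp_continuousOn (ContinuousOn.neg ?_)
  exact Real.continuousOn_log.mono fun x hx => (ne_of_gt hx)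

/-- The spherical function `φ_s` at distance `r` from the base point. -/
theorem sph_eq (s r : ℝ) (g : G) (hg : ch g = Real.cosh r) :
    sph s g = ∫ x in (0 : ℝ)..1, sphPow s (Real.exp r * x + Real.exp (-r) * (1 - x)) := by
  obtain ⟨c, d, hc, hd, hcd, hsum, H⟩ := integral_SU2_nsq g
  have hm : ∀ x ∈ Set.Icc (0 : ℝ) 1, min c d ≤ c * x + d * (1 - x) := by
    intro x hx
    nlinarith [min_le_left c d, min_le_right c d, hx.1, hx.2]
  have hm0 : 0 < min c d := lt_min hc hd
  have h1 := H (fun y => sphPow s (max y (min c d))) (by unfold sphPow; fun_prop)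
    ⟨(min c d)⁻¹, fun x => by
      rw [norm_sphPow s (lt_max_of_lt_right hm0)]
      exact inv_anti₀ hm0 (le_max_right _ _)⟩
  -- the values of the quadratic form on the unit sphere are at least `min c d`
  have hlow : ∀ u : SU2, min c d ≤ nsq (rowMul (u.1 1 0, u.1 1 1) g.1) := by
    intro u
    by_contra! hcon
    obtain ⟨U, hU, c', d', hc', hd', hcd', hsum', hform⟩ := exists_diagonalization g
    have h2 := hform (rowMul (u.1 1 0, u.1 1 1) (star U))
    rw [rowMul_rowMul _ (star U) U, Matrix.mem_unitaryGroup_iff'.mp hU, rowMul_one] at h2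
    have h3 := nsq_rowMul_unitary (u.1 1 0, u.1 1 1) (Unitary.star_mem hU)
    rw [show nsq (u.1 1 0, u.1 1 1) = 1 from SU2_row u.1 u.2 1] at h3
    unfold nsq at h3
    rw [h2] at hcon
    set x := ‖(rowMul (u.1 1 0, u.1 1 1) (star U)).1‖ ^ 2
    set y := ‖(rowMul (u.1 1 0, u.1 1 1) (star U)).2‖ ^ 2
    have hx : 0 ≤ x := by positivity
    have hy : 0 ≤ y := by positivity
    have hroot : (c' - c) * (c' - d) = 0 := by
      have e : (c' - c) * (c' - d) = c' ^ 2 - (c + d) * c' + c * d := by ring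
      rw [e, hcd, hsum, ← hsum', ← hcd']
      ring
    rcases mul_eq_zero.mp hroot with h | h
    · have e1 : c' = c := by linarith
      have e2 : d' = d := by linarith
      rw [e1, e2] at hcon
      nlinarith [min_le_left c d, min_le_right c d]
    · have e1 : c' = d := by linarith
      have e2 : d' = c := by linarith
      rw [e1, e2] at hcon
      nlinarith [min_le_left c d, min_le_right c d]
  have h2 : sph s g = ∫ x in (0 : ℝ)..1, sphPow s (c * x + d * (1 - x)) := by
    rw [sph]
    have e1 : ∀ u : SU2, Complex.exp ((1 + Complex.I * s) * height (u.1 * g))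
        = sphPow s (max (nsq (rowMul (u.1 1 0, u.1 1 1) g.1)) (min c d)) := by
      intro u
      rw [max_eq_left (hlow u), sphPow, height_eq]
    simp only [e1]
    rw [h1]
    refine intervalIntegral.integral_congr fun x hx => ?_
    rw [Set.uIcc_of_le zero_le_one] at hx
    rw [max_eq_left (hm x hx)]
  have hroot : (c - Real.exp r) * (c - Real.exp (-r)) = 0 := by
    have e : Real.exp r * Real.exp (-r) = 1 := by rw [← Real.exp_add]; simp
    have e2 : c + d = Real.exp r + Real.exp (-r) := by
      rw [hsum, hg, Real.cosh_eq]; ring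
    have e3 : (c - Real.exp r) * (c - Real.exp (-r))
      = c ^ 2 - (Real.exp r + Real.exp (-r)) * c + Real.exp r * Real.exp (-r) := by ring
    rw [e3, e, ← e2, ← hcd]
    ring
  have hsum' : c + d = Real.exp r + Real.exp (-r) := by
    rw [hsum, hg, Real.cosh_eq]; ring
  rw [h2]
  rcases mul_eq_zero.mp hroot with h | h
  · rw [show c = Real.exp r by linarith, show d = Real.exp (-r) by linarith]
  · rw [show c = Real.exp (-r) by linarith, show d = Real.exp r by linarith]
    have := intervalIntegral.integral_comp_sub_left (a := 0) (b := 1)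
      (fun x => sphPow s (Real.exp (-r) * x + Real.exp r * (1 - x))) 1
    rw [sub_self, sub_zero] at this
    rw [← this]
    refine intervalIntegral.integral_congr fun x hx => ?_
    congr 1
    ring

theorem sph_eq_of_ch_eq (s : ℝ) {g g' : G} (h : ch g = ch g') : sph s g = sph s g' := by
  have hg := Real.cosh_arcosh (one_le_ch g)
  rw [sph_eq s _ g hg.symm, sph_eq s (Real.arcosh (ch g)) g' (h ▸ hg.symm)]

theorem sph_eq_one (s : ℝ) {g : G} (h : ch g = 1) : sph s g = 1 := by
  rw [sph_eq s 0 g (by rw [h, Real.cosh_zero])]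
  simp [sphPow]

theorem integral_sphPow (s a b : ℝ) :
    ∫ y in Real.exp a..Real.exp b, sphPow s y
      = ∫ x in a..b, Complex.exp (-(Complex.I * s * x)) := by
  have h := intervalIntegral.integral_deriv_smul_comp'' (a := a) (b := b) (f := Real.exp)
    (f' := Real.exp) (g := sphPow s) Real.continuous_exp.continuousOn
    (fun x _ => (Real.hasDerivAt_exp x).hasDerivWithinAt) Real.continuous_exp.continuousOn
    ((continuousOn_sphPow s).mono (by
      rintro _ ⟨x, -, rfl⟩
      exact Real.exp_pos x))
  rw [← h]
  refine intervalIntegral.integral_congr fun x _ => ?_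
  simp only [Function.comp]
  rw [sphPow_exp, Complex.real_smul, Complex.ofReal_exp, ← Complex.exp_add]
  congr 1
  push_cast
  ring

theorem integral_exp_neg_symm (s r : ℝ) :
    ∫ x in -r..r, Complex.exp (-(Complex.I * s * x))
      = 2 * ((∫ x in (0 : ℝ)..r, Real.cos (s * x) : ℝ) : ℂ) := by
  have hc : Continuous fun x : ℝ => Complex.exp (-(Complex.I * s * x)) := by fun_prop
  rw [← intervalIntegral.integral_add_adjacent_intervals (b := 0)
    (hc.intervalIntegrable _ _) (hc.intervalIntegrable _ _)]
  have h1 := intervalIntegral.integral_comp_neg (a := 0) (b := r)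
    fun x : ℝ => Complex.exp (-(Complex.I * s * x))
  rw [neg_zero] at h1
  have hc' : Continuous fun x : ℝ => Complex.exp (-(Complex.I * s * (-x : ℝ))) := by fun_prop
  rw [← h1, ← intervalIntegral.integral_add
    (hc'.intervalIntegrable _ _) (hc.intervalIntegrable _ _),
    ← intervalIntegral.integral_ofReal, ← intervalIntegral.integral_const_mul]
  refine intervalIntegral.integral_congr fun x _ => ?_
  rw [Complex.ofReal_cos, Complex.cos]
  push_cast
  rw [mul_div_cancel₀ _ two_ne_zero]
  congr 2 <;> ring

/-- The explicit form `φ_s = sin(s r) / (s sinh r)` of the spherical functions. -/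
theorem sph_mul_sinh (s r : ℝ) (g : G) (hg : ch g = Real.cosh r) :
    sph s g * (Real.sinh r : ℂ) = ((∫ x in (0 : ℝ)..r, Real.cos (s * x) : ℝ) : ℂ) := by
  have h2 := intervalIntegral.smul_integral_comp_mul_add (a := 0) (b := 1) (sphPow s)
    (Real.exp r - Real.exp (-r)) (Real.exp (-r))
  rw [mul_zero, zero_add, mul_one, sub_add_cancel, integral_sphPow, integral_exp_neg_symm] at h2
  have e : ∀ x : ℝ, Real.exp r * x + Real.exp (-r) * (1 - x)
      = (Real.exp r - Real.exp (-r)) * x + Real.exp (-r) := fun x => by ring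
  rw [sph_eq s r g hg, Real.sinh_eq]
  simp only [e]
  rw [Complex.real_smul] at h2
  push_cast at h2 ⊢
  linear_combination h2 / 2

theorem norm_sph_le_one (s : ℝ) (g : G) : ‖sph s g‖ ≤ 1 := by
  have hg := Real.cosh_arcosh (one_le_ch g)
  set r := Real.arcosh (ch g)
  have hr0 : 0 ≤ r := Real.arcosh_nonneg (one_le_ch g)
  rcases hr0.eq_or_lt with h0 | h0
  · rw [sph_eq_one s (by rw [← hg, ← h0, Real.cosh_zero]), norm_one]
  · have h := congrArg norm (sph_mul_sinh s r g hg.symm)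
    have hs : 0 < Real.sinh r := Real.sinh_pos_iff.mpr h0
    rw [norm_mul, Complex.norm_real, Complex.norm_real, Real.norm_of_nonneg hs.le] at h
    have h2 : ‖∫ x in (0 : ℝ)..r, Real.cos (s * x)‖ ≤ 1 * |r - 0| :=
      intervalIntegral.norm_integral_le_of_norm_le_const fun x _ => Real.abs_cos_le_one _
    rw [sub_zero, abs_of_pos h0, one_mul] at h2
    have h3 : r ≤ Real.sinh r := Real.self_le_sinh_iff.mpr h0.le
    by_contra! hcon
    nlinarith

theorem height_pos_arg (g : G) : 0 < ‖g 1 0‖ ^ 2 + ‖g 1 1‖ ^ 2 := by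
  by_contra hneg
  have h1 : ‖g 1 0‖ ^ 2 = 0 := by nlinarith [sq_nonneg ‖g 1 0‖, sq_nonneg ‖g 1 1‖]
  have h2 : ‖g 1 1‖ ^ 2 = 0 := by nlinarith [sq_nonneg ‖g 1 0‖, sq_nonneg ‖g 1 1‖]
  have h3 : g 1 0 = 0 := by simpa using h1
  have h4 : g 1 1 = 0 := by simpa using h2
  have := det_entries g
  simp [h3, h4] at this

theorem continuous_height : Continuous height := by
  unfold height
  have := continuous_entry
  refine (Continuous.log (by fun_prop) fun g => (height_pos_arg g).ne').neg

instance : LocallyCompactSpace G :=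
  have : LocallyCompactSpace (Matrix (Fin 2) (Fin 2) ℂ) :=
    inferInstanceAs (LocallyCompactSpace (Fin 2 → Fin 2 → ℂ))
  (Matrix.SpecialLinearGroup.isClosedEmbedding_val (n := Fin 2) (R := ℂ)).locallyCompactSpace

theorem continuous_sph : Continuous fun p : ℝ × G => sph p.1 p.2 := by
  unfold sph
  have h : Continuous (Function.uncurry fun (p : ℝ × G) (u : SU2) =>
      Complex.exp ((1 + Complex.I * p.1) * height (u * p.2))) := by
    unfold Function.uncurry
    have := continuous_height
    fun_prop
  simpa using continuous_parametric_integral_of_continuous (μ := haarK) h isCompact_univ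

/-! ### Invariance of the hyperbolic volume -/

instance : MeasurableSpace G := borel G

instance : BorelSpace G := ⟨rfl⟩

/-- The group `AN` of upper triangular matrices `n(z) a(t)`, parametrized by `(z, t)`. -/
def AN : Type := ℂ × ℝ

namespace AN

instance : TopologicalSpace AN := inferInstanceAs (TopologicalSpace (ℂ × ℝ))
instance : T2Space AN := inferInstanceAs (T2Space (ℂ × ℝ))
instance : SecondCountableTopology AN := inferInstanceAs (SecondCountableTopology (ℂ × ℝ))
instance : LocallyCompactSpace AN := inferInstanceAs (LocallyCompactSpace (ℂ × ℝ))
instance : MeasurableSpace AN := inferInstanceAs (MeasurableSpace (ℂ × ℝ))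
instance : BorelSpace AN := inferInstanceAs (BorelSpace (ℂ × ℝ))

instance : Group AN where
  mul x y := (x.1 + Real.exp x.2 * y.1, x.2 + y.2)
  one := ((0 : ℂ), (0 : ℝ))
  inv x := (-(Real.exp (-x.2) * x.1), -x.2)
  mul_assoc x y z := by
    refine Prod.ext ?_ (add_assoc _ _ _)
    change x.1 + Real.exp x.2 * y.1 + Real.exp (x.2 + y.2) * z.1
      = x.1 + Real.exp x.2 * (y.1 + Real.exp y.2 * z.1)
    rw [Real.exp_add]; push_cast; ring
  one_mul x := by
    refine Prod.ext ?_ (zero_add _)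
    change (0 : ℂ) + Real.exp 0 * x.1 = x.1
    simp
  mul_one x := by
    refine Prod.ext ?_ (add_zero _)
    change x.1 + Real.exp x.2 * (0 : ℂ) = x.1
    simp
  inv_mul_cancel x := by
    refine Prod.ext ?_ (neg_add_cancel _)
    change -(Real.exp (-x.2) * x.1) + Real.exp (-x.2) * x.1 = 0
    ring

theorem mul_def (x y : AN) : x * y = ((x.1 + Real.exp x.2 * y.1, x.2 + y.2) : ℂ × ℝ) := rfl

instance : IsTopologicalGroup AN where
  continuous_mul := by
    change Continuous fun p : (ℂ × ℝ) × (ℂ × ℝ) =>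
      ((p.1.1 + Real.exp p.1.2 * p.2.1, p.1.2 + p.2.2) : ℂ × ℝ)
    fun_prop
  continuous_inv := by
    change Continuous fun x : ℂ × ℝ => ((-(Real.exp (-x.2) * x.1), -x.2) : ℂ × ℝ)
    fun_prop

/-- The hyperbolic volume `e^{-2t} dz dt`, which is a left Haar measure of `AN`. -/
def vol : Measure AN :=
  (volume : Measure (ℂ × ℝ)).withDensity fun p => ENNReal.ofReal (Real.exp (-2 * p.2))

theorem map_mul_left_volume (x : AN) :
    Measure.map (fun y : ℂ × ℝ => ((x.1 + Real.exp x.2 * y.1, x.2 + y.2) : ℂ × ℝ)) volume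
      = ENNReal.ofReal (Real.exp (-2 * x.2)) • (volume : Measure (ℂ × ℝ)) := by
  have h1 : Measure.map (fun z : ℂ => x.1 + Real.exp x.2 * z) volume
      = ENNReal.ofReal (Real.exp (-2 * x.2)) • (volume : Measure ℂ) := by
    have h := Measure.map_addHaar_smul (volume : Measure ℂ) (r := Real.exp x.2)
      (Real.exp_pos _).ne'
    have e : (fun z : ℂ => x.1 + Real.exp x.2 * z)
        = (fun z => x.1 + z) ∘ fun z : ℂ => Real.exp x.2 • z := by
      ext z; simp
    rw [e, ← Measure.map_map (by fun_prop) (by fun_prop), h, Measure.map_smul,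
      map_add_left_eq_self, Complex.finrank_real_complex]
    congr 2
    rw [abs_of_pos (by positivity), ← Real.exp_nat_mul, ← Real.exp_neg]
    push_cast
    ring_nf
  have h2 : Measure.map (fun t : ℝ => x.2 + t) volume = volume := map_add_left_eq_self _ _
  have h3 := Measure.map_prod_map (volume : Measure ℂ) (volume : Measure ℝ)
    (f := fun z : ℂ => x.1 + Real.exp x.2 * z) (g := fun t : ℝ => x.2 + t)
    (by fun_prop) (by fun_prop)
  rw [h1, h2, Measure.prod_smul_left] at h3
  exact h3.symm

theorem measurable_density : Measurable fun p : ℂ × ℝ => ENNReal.ofReal (Real.exp (-2 * p.2)) := by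
  fun_prop

theorem lintegral_vol (f : AN → ENNReal) (hf : Measurable f) :
    ∫⁻ x, f x ∂vol = ∫⁻ p : ℂ × ℝ, ENNReal.ofReal (Real.exp (-2 * p.2)) * f p :=
  lintegral_withDensity_eq_lintegral_mul (volume : Measure (ℂ × ℝ)) measurable_density (g := f) hf

theorem integral_vol (f : AN → ℂ) :
    ∫ x, f x ∂vol = ∫ p : ℂ × ℝ, (Real.exp (-2 * p.2) : ℂ) * f p := by
  have h := integral_withDensity_eq_integral_toReal_smul (μ := (volume : Measure (ℂ × ℝ)))
    measurable_density (Filter.Eventually.of_forall fun _ => ENNReal.ofReal_lt_top)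
    (g := (f : ℂ × ℝ → ℂ))
  refine Eq.trans h (integral_congr_ae (Filter.Eventually.of_forall fun p => ?_))
  simp only
  rw [ENNReal.toReal_ofReal (Real.exp_pos _).le, Complex.real_smul]

instance : vol.IsMulLeftInvariant := by
  refine ⟨fun x => ?_⟩
  have hm : Measurable fun y : AN => x * y := (continuous_const_mul x).measurable
  refine Measure.ext_of_lintegral _ fun f hf => ?_
  rw [lintegral_map hf hm, lintegral_vol _ hf]
  refine (lintegral_vol _ (hf.comp hm)).trans ?_
  have hf' : Measurable (f : ℂ × ℝ → ENNReal) := hf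
  have h1 := lintegral_map (μ := (volume : Measure (ℂ × ℝ)))
    (f := fun p : ℂ × ℝ => ENNReal.ofReal (Real.exp (-2 * p.2)) * f p)
    (g := fun y : ℂ × ℝ => ((x.1 + Real.exp x.2 * y.1, x.2 + y.2) : ℂ × ℝ))
    (measurable_density.mul hf') (by fun_prop)
  rw [map_mul_left_volume, lintegral_smul_measure] at h1
  have h2 : ∀ p : ℂ × ℝ, ENNReal.ofReal (Real.exp (-2 * (x.2 + p.2)))
      = ENNReal.ofReal (Real.exp (-2 * x.2)) * ENNReal.ofReal (Real.exp (-2 * p.2)) := by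
    intro p
    rw [← ENNReal.ofReal_mul (Real.exp_pos _).le, ← Real.exp_add]
    ring_nf
  simp only [h2, mul_assoc] at h1
  rw [lintegral_const_mul _ (by exact measurable_density.mul (hf.comp hm)), smul_eq_mul] at h1
  exact ((ENNReal.mul_right_inj (by simp [Real.exp_pos]) ENNReal.ofReal_ne_top).mp h1).symm

theorem withDensity_ne_zero {U : Set (ℂ × ℝ)} (hU : IsOpen U) (hne : U.Nonempty) :
    (volume : Measure (ℂ × ℝ)).withDensity
      (fun p => ENNReal.ofReal (Real.exp (-2 * p.2))) U ≠ 0 := by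
  have hac : (volume : Measure (ℂ × ℝ)) ≪ (volume : Measure (ℂ × ℝ)).withDensity
      fun p => ENNReal.ofReal (Real.exp (-2 * p.2)) :=
    withDensity_absolutelyContinuous' measurable_density.aemeasurable
      (Filter.Eventually.of_forall fun p => by simp [Real.exp_pos])
  intro h
  exact (hU.measure_pos volume hne).ne' (hac h)

theorem withDensity_lt_top {K : Set (ℂ × ℝ)} (hK : IsCompact K) :
    (volume : Measure (ℂ × ℝ)).withDensity
      (fun p => ENNReal.ofReal (Real.exp (-2 * p.2))) K < ⊤ := by
  have hcont : ContinuousOn (fun p : ℂ × ℝ => Real.exp (-2 * p.2)) K := by fun_prop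
  obtain ⟨c, hc⟩ := hK.exists_bound_of_continuousOn hcont
  rw [withDensity_apply _ hK.measurableSet]
  calc ∫⁻ p in K, ENNReal.ofReal (Real.exp (-2 * p.2))
      ≤ ∫⁻ p : ℂ × ℝ in K, ENNReal.ofReal c := by
        refine setLIntegral_mono measurable_const fun p hp => ENNReal.ofReal_le_ofReal ?_
        exact (le_abs_self _).trans (hc p hp)
    _ < ⊤ := by
        rw [setLIntegral_const]
        exact ENNReal.mul_lt_top ENNReal.ofReal_lt_top hK.measure_lt_top

instance : vol.IsHaarMeasure where
  lt_top_of_isCompact _ hK := withDensity_lt_top hK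
  open_pos _ hU hne := withDensity_ne_zero hU hne

/-- The inclusion `(z, t) ↦ n(z) a(t)`. -/
def toG (x : AN) : G := n x.1 * a x.2

theorem toG_val (x : AN) : (toG x).1 =
    !![((Real.exp (x.2 / 2) : ℝ) : ℂ), x.1 * (Real.exp (-x.2 / 2) : ℝ);
      0, ((Real.exp (-x.2 / 2) : ℝ) : ℂ)] := by
  change (n x.1).1 * (a x.2).1 = _
  ext i j
  fin_cases i <;> fin_cases j <;> simp [n, a, Matrix.mul_apply, Fin.sum_univ_two]

theorem toG_mul (x y : AN) : toG (x * y) = toG x * toG y := by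
  apply Subtype.ext
  change _ = (toG x).1 * (toG y).1
  rw [toG_val, toG_val, toG_val, mul_def]
  have h : ∀ s t : ℝ, Real.exp ((s + t) / 2) = Real.exp (s / 2) * Real.exp (t / 2) := by
    intro s t; rw [← Real.exp_add]; ring_nf
  have h' : ∀ s t : ℝ, Real.exp (-(s + t) / 2) = Real.exp (-s / 2) * Real.exp (-t / 2) := by
    intro s t; rw [← Real.exp_add]; ring_nf
  have h2 : ∀ s : ℝ, Real.exp s * Real.exp (-s / 2) = Real.exp (s / 2) := by
    intro s; rw [← Real.exp_add]; ring_nf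
  ext i j
  fin_cases i <;> fin_cases j <;> simp only [Matrix.mul_apply, Fin.sum_univ_two, Fin.zero_eta, Fin.mk_one, Matrix.of_apply,
        Matrix.cons_val', Matrix.cons_val_zero, Matrix.cons_val_one, Matrix.cons_val_fin_one, h, h',
        mul_zero, zero_mul, add_zero, zero_add, Complex.ofReal_mul]
  rw [← h2 x.2]
  push_cast
  ring

/-- The `AN` component of the Iwasawa decomposition. -/
def ofG (g : G) : AN :=
  ((g 0 0 * conj (g 1 0) + g 0 1 * conj (g 1 1)) / ((‖g 1 0‖ ^ 2 + ‖g 1 1‖ ^ 2 : ℝ) : ℂ), height g)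

theorem continuous_ofG : Continuous ofG := by
  have := continuous_entry
  refine Continuous.prodMk (Continuous.div (by fun_prop) (by fun_prop) fun g => ?_)
    continuous_height
  exact_mod_cast (height_pos_arg g).ne'

theorem continuous_toG : Continuous toG := by
  refine Continuous.subtype_mk ?_ _
  change Continuous fun x : ℂ × ℝ => (n x.1).1 * (a x.2).1
  refine Continuous.mul ?_ ?_
  · refine continuous_matrix fun i j => ?_
    fin_cases i <;> fin_cases j <;> simp [n] <;> fun_prop
  · refine continuous_matrix fun i j => ?_
    fin_cases i <;> fin_cases j <;> simp [a] <;> fun_prop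

theorem ofG_toG_mul (x : AN) (k : G) (hk : k ∈ SU2) : ofG (toG x * k) = x := by
  refine Prod.ext ?_ (height_iwasawa x.1 x.2 k hk)
  have h : (toG x * k).1 * star (toG x * k).1 = (toG x).1 * star (toG x).1 := by
    change ((toG x).1 * k.1) * star ((toG x).1 * k.1) = _
    rw [star_mul, mul_assoc, ← mul_assoc k.1, Matrix.mem_unitaryGroup_iff.mp hk, one_mul]
  have h01 := congrFun (congrFun h 0) 1
  have h11 := congrFun (congrFun h 1) 1
  rw [row_norms, row_norms, toG_val] at h11
  rw [toG_val] at h01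
  simp only [Matrix.mul_apply, Fin.sum_univ_two, Matrix.star_apply, RCLike.star_def,
    Matrix.of_apply, Matrix.cons_val', Matrix.cons_val_zero, Matrix.cons_val_one,
    Matrix.cons_val_fin_one, map_zero, mul_zero, zero_add, Complex.conj_ofReal] at h01
  change (_ / _ : ℂ) = x.1
  rw [h11]
  refine Eq.trans (congrArg (· / _) h01) ?_
  simp only [Matrix.of_apply, Matrix.cons_val', Matrix.cons_val_zero, Matrix.cons_val_one,
    Matrix.cons_val_fin_one, norm_zero, Complex.norm_real, Real.norm_eq_abs, sq_abs]
  push_cast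
  field_simp
  simp

theorem exists_toG_mul (g : G) : ∃ k ∈ SU2, g = toG (ofG g) * k := by
  obtain ⟨z, k, hk, hg⟩ := exists_iwasawa g
  have h : g = toG ((z, height g) : ℂ × ℝ) * k := hg
  have h2 := ofG_toG_mul ((z, height g) : ℂ × ℝ) k hk
  rw [← h] at h2
  exact ⟨k, hk, by rw [h2]; exact h⟩

theorem ofG_toG_mul_left (x : AN) (g : G) : ofG (toG x * g) = x * ofG g := by
  obtain ⟨k, hk, hg⟩ := exists_toG_mul g
  conv_lhs => rw [hg, ← mul_assoc, ← toG_mul]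
  exact ofG_toG_mul _ _ hk

/-- The push-forward of the Haar measure of `G` to `AN = G / K`. -/
def pushHaar : Measure AN := Measure.map ofG Measure.haar

instance : pushHaar.IsMulLeftInvariant := by
  refine ⟨fun x => ?_⟩
  unfold pushHaar
  rw [Measure.map_map (continuous_const_mul x).measurable continuous_ofG.measurable]
  have : (fun y => x * y) ∘ ofG = ofG ∘ fun g => toG x * g := by
    ext1 g
    exact (ofG_toG_mul_left x g).symm
  rw [this, ← Measure.map_map continuous_ofG.measurable (continuous_const_mul _).measurable,
    map_mul_left_eq_self]

instance : pushHaar.IsHaarMeasure := by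
  obtain ⟨K, hK, hK1⟩ := exists_compact_mem_nhds (1 : AN)
  refine Measure.isHaarMeasure_of_isCompact_nonempty_interior _ K hK ⟨1, mem_interior_iff_mem_nhds.mpr hK1⟩ ?_ ?_
  · unfold pushHaar
    rw [Measure.map_apply continuous_ofG.measurable hK.measurableSet]
    have hopen : IsOpen (ofG ⁻¹' interior K) := isOpen_interior.preimage continuous_ofG
    have hne : (ofG ⁻¹' interior K).Nonempty := by
      refine ⟨toG 1 * 1, ?_⟩
      rw [Set.mem_preimage, ofG_toG_mul 1 1 SU2.one_mem]
      exact mem_interior_iff_mem_nhds.mpr hK1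
    exact ((hopen.measure_pos Measure.haar hne).trans_le
      (measure_mono (Set.preimage_mono interior_subset))).ne'
  · unfold pushHaar
    rw [Measure.map_apply continuous_ofG.measurable hK.measurableSet]
    have hsub : ofG ⁻¹' K ⊆ (fun p : G × G => p.1 * p.2) '' ((toG '' K) ×ˢ (SU2 : Set G)) := by
      intro g hg
      obtain ⟨k, hk, h⟩ := exists_toG_mul g
      exact ⟨(toG (ofG g), k), ⟨⟨_, hg, rfl⟩, hk⟩, h.symm⟩
    have hc : IsCompact ((fun p : G × G => p.1 * p.2) '' ((toG '' K) ×ˢ (SU2 : Set G))) :=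
      ((hK.image continuous_toG).prod isCompact_SU2).image continuous_mul
    exact ((measure_mono hsub).trans_lt hc.measure_lt_top).ne

end AN

/-- The hyperbolic volume `e^{-2t} dz dt` on `ℍ³` is invariant under the whole of `G`. The
push-forward of the Haar measure of `G` to `G / K = AN` is a left Haar measure of `AN`, hence a
multiple of `e^{-2t} dz dt`. -/
theorem integral_iwasawa_mul_left (f : G → ℂ) (hf : Continuous f)
    (hK : ∀ g, ∀ k ∈ SU2, f (g * k) = f g) (y : G) :
    ∫ p : ℂ × ℝ, (Real.exp (-2 * p.2) : ℂ) * f (y * (n p.1 * a p.2))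
      = ∫ p : ℂ × ℝ, (Real.exp (-2 * p.2) : ℂ) * f (n p.1 * a p.2) := by
  have key : ∀ f : G → ℂ, Continuous f → (∀ g, ∀ k ∈ SU2, f (g * k) = f g) →
      ∫ g, f g ∂(Measure.haar : Measure G)
        = (Measure.haarScalarFactor AN.pushHaar AN.vol) • ∫ x, f (AN.toG x) ∂AN.vol := by
    intro f hf hK
    have hm : AEStronglyMeasurable (fun x => f (AN.toG x))
        (Measure.map AN.ofG (Measure.haar : Measure G)) :=
      (hf.comp AN.continuous_toG).aestronglyMeasurable
    rw [← integral_smul_nnreal_measure, ← Measure.isMulLeftInvariant_eq_smul AN.pushHaar AN.vol,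
      AN.pushHaar, integral_map AN.continuous_ofG.measurable.aemeasurable hm]
    refine integral_congr_ae (Filter.Eventually.of_forall fun g => ?_)
    obtain ⟨k, hk, hg⟩ := AN.exists_toG_mul g
    conv_lhs => rw [hg]
    exact hK _ _ hk
  have hpos : Measure.haarScalarFactor AN.pushHaar AN.vol ≠ 0 :=
    (Measure.haarScalarFactor_pos_of_isHaarMeasure AN.pushHaar AN.vol).ne'
  have h1 := key f hf hK
  have h2 := key (fun g => f (y * g)) (by fun_prop) (fun g k hk => by rw [← mul_assoc, hK _ _ hk])
  rw [integral_mul_left_eq_self, h1] at h2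
  have h3 := smul_right_injective ℂ hpos h2
  rw [AN.integral_vol, AN.integral_vol] at h3
  exact h3.symm

/-! ### Inversion of the spherical transform for functions of Paley-Wiener type -/

/-- `H` is the Fourier transform of the even test function `w`. -/
structure IsEvenPW (H w : ℝ → ℂ) : Prop where
  smooth : ContDiff ℝ ∞ w
  compact : HasCompactSupport w
  even : ∀ x, w (-x) = w x
  eq : ∀ s : ℝ, H s = ∫ x : ℝ, w x * Complex.exp (-(Complex.I * s * x))

/-- The spectral functions `h_λ⁰` are even and of Paley-Wiener type. -/
theorem PaleyWiener.exists_isEvenPW {h : ℝ → ℝ} (hh : PaleyWiener h) (l : ℝ) :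
    ∃ w, IsEvenPW (h0 h l) w := by
  obtain ⟨w, hw, hwc, hws⟩ := hh
  have hE : ∀ c : ℂ, ContDiff ℝ ∞ fun x : ℝ => Complex.exp (c * x) := fun c =>
    (contDiff_const.mul Complex.ofRealCLM.contDiff).cexp
  have hint : ∀ (c : ℂ), Integrable fun x : ℝ => w x * Complex.exp (c * x) := fun c =>
    (hw.continuous.mul (hE c).continuous).integrable_of_hasCompactSupport hwc.mul_right
  have hwn : HasCompactSupport fun x : ℝ => w (-x) := hwc.comp_homeomorph (Homeomorph.neg ℝ)
  -- translation of `h` by `l` becomes modulation of `w`, reflection becomes reflection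
  refine ⟨fun x => w x * Complex.exp ((Complex.I * l) * x)
    + w (-x) * Complex.exp ((-(Complex.I * l)) * x), ⟨?_, ?_, ?_, ?_⟩⟩
  · exact (hw.mul (hE _)).add ((hw.comp contDiff_neg).mul (hE _))
  · exact hwc.mul_right.add hwn.mul_right
  · intro x
    simp only [neg_neg]
    push_cast
    rw [add_comm]
    congr 2 <;> ring_nf
  · intro s
    have h1 : (h (s - l) : ℂ) = ∫ x : ℝ, w x * Complex.exp ((Complex.I * l) * x) *
        Complex.exp (-(Complex.I * s * x)) := by
      rw [hws]
      refine integral_congr_ae (Filter.Eventually.of_forall fun x => ?_)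
      simp only
      rw [mul_assoc (w _), ← Complex.exp_add]
      push_cast
      ring_nf
    have h2 : (h (-s - l) : ℂ) = ∫ x : ℝ, w (-x) * Complex.exp ((-(Complex.I * l)) * x) *
        Complex.exp (-(Complex.I * s * x)) := by
      rw [hws, ← integral_neg_eq_self]
      refine integral_congr_ae (Filter.Eventually.of_forall fun x => ?_)
      simp only
      rw [mul_assoc (w _), ← Complex.exp_add]
      push_cast
      ring_nf
    unfold h0
    push_cast
    rw [h1, h2, ← integral_add]
    · simp only [add_mul]
    · refine (hint (Complex.I * l - Complex.I * s)).congr (Filter.Eventually.of_forall fun x => ?_)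
      simp only
      rw [mul_assoc, ← Complex.exp_add]
      ring_nf
    · refine (hint (Complex.I * l + Complex.I * s)).comp_neg.congr
        (Filter.Eventually.of_forall fun x => ?_)
      simp only
      rw [mul_assoc, ← Complex.exp_add]
      push_cast
      ring_nf

namespace IsEvenPW

variable {H w : ℝ → ℂ}

theorem map_neg (hH : IsEvenPW H w) (s : ℝ) : H (-s) = H s := by
  rw [hH.eq, hH.eq, ← integral_neg_eq_self]
  refine integral_congr_ae (Filter.Eventually.of_forall fun x => ?_)
  simp only [hH.even]
  push_cast
  ring_nf

theorem fourier_eq (hH : IsEvenPW H w) (ξ : ℝ) :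
    FourierTransform.fourier w ξ = H (2 * Real.pi * ξ) := by
  rw [Real.fourier_eq', hH.eq]
  refine integral_congr_ae (Filter.Eventually.of_forall fun x => ?_)
  simp only [smul_eq_mul]
  rw [mul_comm]
  congr 2
  simp
  ring

theorem exists_schwartz (hH : IsEvenPW H w) :
    ∃ F : SchwartzMap ℝ ℂ, ∀ s, H s = F (s / (2 * Real.pi)) := by
  refine ⟨FourierTransform.fourier (hH.compact.toSchwartzMap hH.smooth), fun s => ?_⟩
  rw [SchwartzMap.fourier_coe]
  change _ = FourierTransform.fourier w _
  rw [hH.fourier_eq]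
  congr 1
  field_simp

theorem continuous (hH : IsEvenPW H w) : Continuous H := by
  obtain ⟨F, hF⟩ := hH.exists_schwartz
  have : H = fun s => F (s / (2 * Real.pi)) := funext hF
  rw [this]
  exact F.continuous.comp (by fun_prop)

theorem integrable_pow (hH : IsEvenPW H w) (k : ℕ) :
    Integrable fun s : ℝ => (s : ℂ) ^ k * H s := by
  obtain ⟨F, hF⟩ := hH.exists_schwartz
  have h1 := (F.integrable_pow_mul volume k).comp_div (R := 2 * Real.pi) (by positivity)
  have h2 := h1.const_mul ((2 * Real.pi) ^ k)
  have hc := hH.continuous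
  refine h2.mono' (by fun_prop) (Filter.Eventually.of_forall fun s => le_of_eq ?_)
  rw [norm_mul, norm_pow, Complex.norm_real, ← hF, ← mul_assoc, norm_div,
    Real.norm_of_nonneg (show 0 ≤ 2 * Real.pi by positivity), ← mul_pow,
    mul_div_cancel₀ _ (by positivity)]

theorem deriv_eq (hH : IsEvenPW H w) (x : ℝ) :
    deriv w x = (1 / (2 * Real.pi)) * ∫ s : ℝ, Complex.exp (Complex.I * s * x) *
      (Complex.I * s * H s) := by
  have hd : ContDiff ℝ ∞ (deriv w) := hH.smooth.deriv'
  have hwi : Integrable w := hH.smooth.continuous.integrable_of_hasCompactSupport hH.compact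
  have hdi : Integrable (deriv w) := hd.continuous.integrable_of_hasCompactSupport hH.compact.deriv
  have hF := Real.fourier_deriv hwi (hH.smooth.differentiable (by simp)) hdi
  have hFi : Integrable (FourierTransform.fourier (deriv w)) := by
    rw [hF]
    have h1 := ((hH.integrable_pow 1).comp_mul_left' (R := 2 * Real.pi) (by positivity)).const_mul
      Complex.I
    refine h1.congr (Filter.Eventually.of_forall fun ξ => ?_)
    simp only [smul_eq_mul, hH.fourier_eq]
    push_cast
    ring
  have hinv := congrFun (hd.continuous.fourierInv_fourier_eq hdi hFi) x
  rw [← hinv, Real.fourierInv_eq', hF]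
  have hsub := Measure.integral_comp_mul_left (fun s : ℝ => Complex.exp (Complex.I * s * x) *
      (Complex.I * s * H s)) (2 * Real.pi)
  have e : ((1 / (2 * Real.pi) : ℝ) : ℂ) = 1 / (2 * (Real.pi : ℂ)) := by push_cast; rfl
  rw [abs_of_pos (by positivity), Complex.real_smul, inv_eq_one_div, e] at hsub
  rw [← hsub]
  refine integral_congr_ae (Filter.Eventually.of_forall fun ξ => ?_)
  simp only [smul_eq_mul, hH.fourier_eq]
  push_cast
  congr 1
  · congr 1
    simp
    ring
  · ring

theorem deriv_eq_sin (hH : IsEvenPW H w) (x : ℝ) :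
    deriv w x = -(1 / Real.pi) * ∫ s in Set.Ioi (0 : ℝ), H s * (s * Real.sin (s * x) : ℝ) := by
  have hint : Integrable fun s : ℝ => Complex.exp (Complex.I * s * x) * (Complex.I * s * H s) := by
    have hc := hH.continuous
    refine (hH.integrable_pow 1).norm.mono' (by fun_prop) (Filter.Eventually.of_forall fun s => ?_)
    rw [norm_mul, Complex.norm_exp]
    simp
  -- as `H` is even, the two half lines combine to a sine transform
  have hneg : ∫ s in Set.Iic (0 : ℝ), Complex.exp (Complex.I * s * x) * (Complex.I * s * H s)
      = ∫ s in Set.Ioi (0 : ℝ), Complex.exp (-(Complex.I * s * x)) * (-(Complex.I * s * H s)) := by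
    have := integral_comp_neg_Ioi (0 : ℝ)
      fun s : ℝ => Complex.exp (Complex.I * s * x) * (Complex.I * s * H s)
    rw [neg_zero] at this
    rw [← this]
    refine setIntegral_congr_fun measurableSet_Ioi fun s _ => ?_
    simp only [hH.map_neg]
    push_cast
    ring_nf
  have hint2 : Integrable fun s : ℝ =>
      Complex.exp (-(Complex.I * s * x)) * (-(Complex.I * s * H s)) := by
    refine hint.comp_neg.congr (Filter.Eventually.of_forall fun s => ?_)
    simp only [hH.map_neg]
    push_cast
    ring_nf
  rw [hH.deriv_eq, ← intervalIntegral.integral_Iic_add_Ioi hint.integrableOn hint.integrableOn (b := 0),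
    hneg, ← integral_add hint2.integrableOn hint.integrableOn,
    ← integral_const_mul, ← integral_const_mul]
  refine setIntegral_congr_fun measurableSet_Ioi fun s _ => ?_
  rw [show Complex.I * s * x = ((s * x : ℝ) : ℂ) * Complex.I by push_cast; ring, ← neg_mul,
    Complex.exp_mul_I, Complex.exp_mul_I, Complex.cos_neg, Complex.sin_neg]
  push_cast
  have hI := Complex.I_sq
  have hpi : (Real.pi : ℂ) ≠ 0 := by simp [Real.pi_ne_zero]
  field_simp
  linear_combination (2 * s * H s * Complex.sin (s * x)) * hI

/-- The inverse spherical transform of `H` at distance `r` is `-w'(r) / (2π sinh r)`. -/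
theorem invSph_mul_sinh (hH : IsEvenPW H w) (r : ℝ) (g : G) (hg : ch g = Real.cosh r) :
    invSphTransform H g * (Real.sinh r : ℂ) = -(1 / (2 * Real.pi)) * deriv w r := by
  have h1 : ∀ s : ℝ, sph s g * (Real.sinh r : ℂ) * s = (Real.sin (s * r) : ℝ) := by
    intro s
    rw [sph_mul_sinh s r g hg, ← Complex.ofReal_mul]
    have h := intervalIntegral.mul_integral_comp_mul_left (a := 0) (b := r) (f := Real.cos) s
    rw [mul_zero, integral_cos, Real.sin_zero, sub_zero] at h
    rw [mul_comm, h]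
  unfold invSphTransform
  rw [hH.deriv_eq_sin, mul_assoc, ← integral_mul_const]
  have h2 : ∫ s in Set.Ioi (0 : ℝ), H s * sph s g * (s : ℂ) ^ 2 * (Real.sinh r : ℂ)
      = ∫ s in Set.Ioi (0 : ℝ), H s * (s * Real.sin (s * r) : ℝ) := by
    refine setIntegral_congr_fun measurableSet_Ioi fun s _ => ?_
    have h := h1 s
    push_cast at h ⊢
    linear_combination (H s * s) * h
  rw [h2]
  have hpi : (Real.pi : ℂ) ≠ 0 := by simp [Real.pi_ne_zero]
  generalize (∫ s in Set.Ioi (0 : ℝ), H s * (s * Real.sin (s * r) : ℝ)) = v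
  field_simp

theorem integrable_sq (hH : IsEvenPW H w) : Integrable fun s : ℝ => ‖H s‖ * s ^ 2 := by
  refine (hH.integrable_pow 2).norm.congr (Filter.Eventually.of_forall fun s => ?_)
  simp [mul_comm]

theorem continuous_invSph (hH : IsEvenPW H w) : Continuous (invSphTransform H) := by
  unfold invSphTransform
  have hc := hH.continuous
  have hs := continuous_sph
  refine continuous_const.mul (continuous_of_dominated (bound := fun s => ‖H s‖ * s ^ 2)
    (fun g => ?_) (fun g => Filter.Eventually.of_forall fun s => ?_) hH.integrable_sq.integrableOn
    (Filter.Eventually.of_forall fun s => ?_))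
  · have : Continuous fun s : ℝ => sph s g := hs.comp (continuous_id.prodMk continuous_const)
    exact Continuous.aestronglyMeasurable (by fun_prop)
  · rw [norm_mul, norm_mul, norm_pow, Complex.norm_real, Real.norm_eq_abs, sq_abs]
    nlinarith [norm_sph_le_one s g, mul_nonneg (norm_nonneg (H s)) (sq_nonneg s),
      norm_nonneg (sph s g)]
  · have : Continuous fun g => sph s g := hs.comp (continuous_const.prodMk continuous_id)
    fun_prop

end IsEvenPW

theorem norm_entry_sq_le (g : G) (i j : Fin 2) : ‖g i j‖ ^ 2 ≤ 2 * ch g := by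
  unfold ch
  fin_cases i <;> fin_cases j <;> simp <;>
    nlinarith [sq_nonneg ‖g 0 0‖, sq_nonneg ‖g 0 1‖, sq_nonneg ‖g 1 0‖, sq_nonneg ‖g 1 1‖]

theorem norm_entry_le (g : G) (i j : Fin 2) : ‖g i j‖ ≤ 2 * ch g := by
  nlinarith [norm_entry_sq_le g i j, one_le_ch g, norm_nonneg (g i j)]

theorem isCompact_ch_le (c : ℝ) : IsCompact {g : G | ch g ≤ c} := by
  have hK : IsCompact (Set.univ.pi fun _ : Fin 2 => Set.univ.pi fun _ : Fin 2 =>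
      Metric.closedBall (0 : ℂ) (2 * c)) :=
    isCompact_univ_pi fun _ => isCompact_univ_pi fun _ => isCompact_closedBall _ _
  have hpre := (Matrix.SpecialLinearGroup.isClosedEmbedding_val
    (n := Fin 2) (R := ℂ)).isCompact_preimage hK
  refine hpre.of_isClosed_subset (isClosed_le continuous_ch continuous_const) ?_
  intro g hg i _ j _
  have hg : ch g ≤ c := hg
  rw [mem_closedBall_zero_iff]
  exact (norm_entry_le g i j).trans (by linarith)

namespace IsEvenPW

variable {H w : ℝ → ℂ}

theorem exists_invSph_eq_zero (hH : IsEvenPW H w) :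
    ∃ c : ℝ, ∀ g, c < ch g → invSphTransform H g = 0 := by
  obtain ⟨R, hR⟩ := hH.compact.isCompact.isBounded.subset_closedBall 0
  refine ⟨Real.cosh (max R 0), fun g hg => ?_⟩
  have hr := Real.cosh_arcosh (one_le_ch g)
  have hr0 := Real.arcosh_nonneg (one_le_ch g)
  set r := Real.arcosh (ch g)
  rw [← hr, Real.cosh_lt_cosh, abs_of_nonneg (le_max_right _ _), abs_of_nonneg hr0] at hg
  have h := hH.invSph_mul_sinh r g hr.symm
  have hw : deriv w r = 0 := by
    by_contra hne
    have hmem : r ∈ tsupport w := (support_deriv_subset (Function.mem_support.mpr hne))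
    have := hR hmem
    rw [mem_closedBall_zero_iff, Real.norm_of_nonneg hr0] at this
    exact absurd (this.trans (le_max_left _ _)) (not_le.mpr hg)
  rw [hw, mul_zero] at h
  have hs : (Real.sinh r : ℂ) ≠ 0 := by
    exact_mod_cast (Real.sinh_pos_iff.mpr ((le_max_right R 0).trans_lt hg)).ne'
  exact (mul_eq_zero.mp h).resolve_right hs

theorem hasCompactSupport_invSph (hH : IsEvenPW H w) : HasCompactSupport (invSphTransform H) := by
  obtain ⟨c, hc⟩ := hH.exists_invSph_eq_zero
  exact HasCompactSupport.intro (isCompact_ch_le c) fun g hg => hc g (not_le.mp hg)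

end IsEvenPW

theorem invSph_eq_of_ch_eq (F : ℝ → ℂ) {g g' : G} (h : ch g = ch g') :
    invSphTransform F g = invSphTransform F g' := by
  unfold invSphTransform
  simp only [sph_eq_of_ch_eq _ h]

/-! ### The Abel transform of the inverse spherical transform -/

theorem ch_toG (z : ℂ) (t : ℝ) :
    ch (n z * a t) = Real.cosh t + ‖z‖ ^ 2 * (Real.exp (-t) / 2) := by
  have h := AN.toG_val ((z, t) : ℂ × ℝ)
  unfold ch
  change (‖(AN.toG ((z, t) : ℂ × ℝ)).1 0 0‖ ^ 2 + ‖(AN.toG ((z, t) : ℂ × ℝ)).1 0 1‖ ^ 2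
    + ‖(AN.toG ((z, t) : ℂ × ℝ)).1 1 0‖ ^ 2 + ‖(AN.toG ((z, t) : ℂ × ℝ)).1 1 1‖ ^ 2) / 2 = _
  rw [h, Real.cosh_eq]
  have e1 : Real.exp (t / 2) ^ 2 = Real.exp t := by rw [← Real.exp_nat_mul]; push_cast; ring_nf
  have e2 : Real.exp (-t / 2) ^ 2 = Real.exp (-t) := by
    rw [← Real.exp_nat_mul]; push_cast; ring_nf
  simp only [Matrix.of_apply, Matrix.cons_val', Matrix.cons_val_zero, Matrix.cons_val_one,
    Matrix.cons_val_fin_one, norm_zero, norm_mul, Complex.norm_real, Real.norm_eq_abs, mul_pow,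
    sq_abs, e1, e2]
  ring

theorem continuous_na : Continuous fun p : ℂ × ℝ => n p.1 * a p.2 := AN.continuous_toG

theorem hasCompactSupport_comp_na {f : G → ℂ} {c : ℝ} (hf : ∀ g, c < ch g → f g = 0) :
    HasCompactSupport fun p : ℂ × ℝ => f (n p.1 * a p.2) := by
  refine HasCompactSupport.intro (K := AN.ofG '' {g | ch g ≤ c})
    ((isCompact_ch_le c).image AN.continuous_ofG) fun p hp => hf _ ?_
  by_contra! h
  refine hp ⟨_, h, ?_⟩
  have := AN.ofG_toG_mul p 1 SU2.one_mem
  rwa [mul_one] at this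

theorem height_na_mul (z : ℂ) (t : ℝ) (g : G) : height (n z * a t * g) = t + height g :=
  congrArg Prod.snd (AN.ofG_toG_mul_left ((z, t) : ℂ × ℝ) g)

theorem height_na (z : ℂ) (t : ℝ) : height (n z * a t) = t := by
  have := height_iwasawa z t 1 SU2.one_mem
  rwa [mul_one] at this

theorem height_mul_SU2 (g k : G) (hk : k ∈ SU2) : height (g * k) = height g := by
  obtain ⟨k', hk', hg⟩ := AN.exists_toG_mul g
  have h1 : height (AN.toG (AN.ofG g) * (k' * k)) = _ :=
    height_iwasawa _ _ _ (SU2.mul_mem hk' hk)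
  rw [← mul_assoc, ← hg] at h1
  exact h1

namespace IsEvenPW

variable {H w : ℝ → ℂ}

/-- The Abel transform of the inverse spherical transform of `H` is `w`. -/
theorem integral_invSph_horocycle (hH : IsEvenPW H w) (t : ℝ) :
    ∫ z : ℂ, invSphTransform H (n z * a t) = Real.exp t * w t := by
  set E : ℝ := Real.exp (-t) / 2 with hE
  have hE0 : 0 < E := by positivity
  -- the kernel along the horocycle, as a function of `y = |z|²`
  set k : ℝ → ℂ := fun y => invSphTransform H (n (Real.sqrt y : ℂ) * a t)
  have hk1 : ∀ z : ℂ, invSphTransform H (n z * a t) = k (‖z‖ ^ 2) := by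
    intro z
    refine invSph_eq_of_ch_eq H ?_
    rw [ch_toG, ch_toG, Complex.norm_real, Real.norm_eq_abs, sq_abs, Real.sq_sqrt (by positivity)]
  have hch : ∀ y : ℝ, 0 ≤ y → ch (n (Real.sqrt y : ℂ) * a t) = Real.cosh t + y * E := by
    intro y hy
    rw [ch_toG, Complex.norm_real, Real.norm_eq_abs, sq_abs, Real.sq_sqrt hy]
  have hkc : Continuous k := by
    have := hH.continuous_invSph
    have h2 : Continuous fun y : ℝ => n (Real.sqrt y : ℂ) * a t :=
      continuous_na.comp (f := fun y : ℝ => ((Real.sqrt y : ℂ), t)) (by fun_prop)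
    exact this.comp h2
  obtain ⟨c, hc⟩ := hH.exists_invSph_eq_zero
  have hk0 : ∀ y, c / E < y → 0 ≤ y → k y = 0 := by
    intro y hy hy0
    refine hc _ ?_
    rw [hch y hy0]
    rw [div_lt_iff₀ hE0] at hy
    linarith [Real.cosh_pos t]
  have hint : IntegrableOn k (Set.Ioi 0) := by
    have h1 : IntegrableOn k (Set.Icc 0 (max (c / E) 0)) :=
      hkc.continuousOn.integrableOn_compact isCompact_Icc
    refine h1.of_forall_sdiff_eq_zero measurableSet_Ioi fun y hy => ?_
    have hy0 : 0 < y := hy.1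
    refine hk0 y ?_ hy0.le
    by_contra! hcon
    exact hy.2 ⟨hy0.le, hcon.trans (le_max_left _ _)⟩
  -- up to a constant, `w` of the distance is a primitive of the kernel
  set V : ℝ → ℂ := fun y => w (Real.arcosh (Real.cosh t + y * E)) with hV
  have h1c : ∀ y, 0 < y → 1 < Real.cosh t + y * E := fun y hy => by
    have := Real.one_le_cosh t
    nlinarith [mul_pos hy hE0]
  have hderiv : ∀ y ∈ Set.Ioi (0 : ℝ), HasDerivAt V (-(Real.pi * Real.exp (-t)) * k y) y := by
    intro y hy
    have hy : 0 < y := hy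
    set r := Real.arcosh (Real.cosh t + y * E)
    have hcr : Real.cosh r = Real.cosh t + y * E := Real.cosh_arcosh (h1c y hy).le
    have hr0 : 0 < r := Real.arcosh_pos (h1c y hy)
    have hs : 0 < Real.sinh r := Real.sinh_pos_iff.mpr hr0
    have h1 := hH.invSph_mul_sinh r (n (Real.sqrt y : ℂ) * a t) (by rw [hch y hy.le, hcr])
    have hd1 : HasDerivAt (fun y => Real.cosh t + y * E) E y := by
      simpa using ((hasDerivAt_id y).mul_const E).const_add (Real.cosh t)
    have hd2 := (Real.hasDerivAt_arcosh (h1c y hy)).comp y hd1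
    have hd3 : HasDerivAt w (deriv w r) r :=
      (hH.smooth.differentiable (by simp) r).hasDerivAt
    have hd4 := hd3.scomp y hd2
    refine hd4.congr_deriv ?_
    have hsq : Real.sqrt ((Real.cosh t + y * E) ^ 2 - 1) = Real.sinh r := by
      rw [← hcr, Real.cosh_sq, add_sub_cancel_right, Real.sqrt_sq hs.le]
    rw [hsq]
    change _ = -(Real.pi * Real.exp (-t)) * invSphTransform H (n (Real.sqrt y : ℂ) * a t)
    have hsC : (Real.sinh r : ℂ) ≠ 0 := by exact_mod_cast hs.ne'
    have hpi : (Real.pi : ℂ) ≠ 0 := by simp [Real.pi_ne_zero]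
    have h2 : deriv w r = -(2 * Real.pi) *
        (invSphTransform H (n (Real.sqrt y : ℂ) * a t) * (Real.sinh r : ℂ)) := by
      rw [h1]; field_simp
    rw [h2, hE, Complex.real_smul]
    push_cast at hsC ⊢
    field_simp
  have hVc : ContinuousWithinAt V (Set.Ici 0) 0 := by
    have h1 : ContinuousOn V (Set.Ici 0) := by
      refine hH.smooth.continuous.comp_continuousOn
        (Real.continuousOn_arcosh.comp (by fun_prop) fun y hy => ?_)
      have hy : 0 ≤ y := hy
      have := Real.one_le_cosh t
      have h2 := mul_nonneg hy hE0.le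
      exact this.trans (by linarith)
    exact h1 0 Set.self_mem_Ici
  have hlim : Filter.Tendsto V Filter.atTop (nhds 0) := by
    obtain ⟨R, hR⟩ := hH.compact.isCompact.isBounded.subset_closedBall 0
    refine tendsto_const_nhds.congr' ?_
    filter_upwards [Filter.eventually_gt_atTop 0,
      Filter.eventually_gt_atTop (Real.cosh (max R 0) / E)] with y hy hy2
    have hr0 := Real.arcosh_nonneg (h1c y hy).le
    have hcr := Real.cosh_arcosh (h1c y hy).le
    symm
    by_contra hne
    have hmem := hR (subset_tsupport w (Function.mem_support.mpr hne))
    rw [mem_closedBall_zero_iff, Real.norm_of_nonneg hr0] at hmem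
    rw [div_lt_iff₀ hE0] at hy2
    have h3 : Real.cosh (max R 0) < Real.cosh (Real.arcosh (Real.cosh t + y * E)) := by
      rw [hcr]; linarith [Real.cosh_pos t]
    rw [Real.cosh_lt_cosh, abs_of_nonneg (le_max_right _ _), abs_of_nonneg hr0] at h3
    exact absurd (hmem.trans (le_max_left _ _)) (not_le.mpr h3)
  have hFTC := integral_Ioi_of_hasDerivAt_of_tendsto hVc hderiv (hint.const_mul _) hlim
  -- the distance is `|t|` at `y = 0`, and `w` is even
  have hV0 : V 0 = w t := by
    rw [hV]
    simp only [zero_mul, add_zero]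
    rcases le_total 0 t with ht | ht
    · rw [Real.arcosh_cosh ht]
    · rw [← Real.cosh_neg, Real.arcosh_cosh (by linarith), hH.even]
  rw [hV0, integral_const_mul] at hFTC
  simp only [hk1]
  rw [integral_norm_sq k]
  have hee : (Real.exp t : ℂ) * Real.exp (-t) = 1 := by
    rw [← Complex.ofReal_mul, ← Real.exp_add]; simp
  linear_combination (-(Real.exp t : ℂ)) * hFTC
    - Real.pi * (∫ y in Set.Ioi (0 : ℝ), k y) * hee

end IsEvenPW

/-! ### The spherical transform of the inverse transform -/

/-- For right `K`-invariant functions the integral over `G` reduces to one over `AN`. -/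
theorem intG_of_right_invariant (f : G → ℂ) (hK : ∀ g, ∀ k ∈ SU2, f (g * k) = f g) :
    intG f = ∫ p : ℂ × ℝ, (Real.exp (-2 * p.2) : ℂ) * f (n p.1 * a p.2) := by
  unfold intG
  refine integral_congr_ae (Filter.Eventually.of_forall fun p => ?_)
  simp only
  congr 1
  rw [integral_congr_ae (Filter.Eventually.of_forall fun k : SU2 => hK _ k.1 k.2)]
  simp

namespace IsEvenPW

variable {H w : ℝ → ℂ}

theorem integrable_na (hH : IsEvenPW H w) {f : G → ℂ} (hf : Continuous f) :
    Integrable fun p : ℂ × ℝ => (Real.exp (-2 * p.2) : ℂ) *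
      (invSphTransform H (n p.1 * a p.2) * f (n p.1 * a p.2)) := by
  obtain ⟨c, hc⟩ := hH.exists_invSph_eq_zero
  have h1 := hasCompactSupport_comp_na (f := fun g => invSphTransform H g * f g) (c := c)
    fun g hg => by rw [hc g hg, zero_mul]
  have h2 : Continuous fun g => invSphTransform H g * f g := hH.continuous_invSph.mul hf
  have h3 : Continuous fun p : ℂ × ℝ =>
      invSphTransform H (n p.1 * a p.2) * f (n p.1 * a p.2) := h2.comp continuous_na
  exact (Continuous.mul (by fun_prop) h3).integrable_of_hasCompactSupport h1.mul_left

theorem continuous_horo (s : ℝ) : Continuous fun g : G =>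
    Complex.exp ((1 + Complex.I * s) * height g) := by
  have := continuous_height
  fun_prop

/-- The horospherical waves `e^{(1 + i s) A}` are eigenfunctions of convolution with the inverse
transform of `H`, with eigenvalue `H(s)`. -/
theorem integral_invSph_horo (hH : IsEvenPW H w) (s : ℝ) (y : G) :
    ∫ p : ℂ × ℝ, (Real.exp (-2 * p.2) : ℂ) * (invSphTransform H (n p.1 * a p.2) *
      Complex.exp ((1 + Complex.I * s) * height (y * (n p.1 * a p.2))))
      = H s * Complex.exp ((1 + Complex.I * s) * height y) := by
  -- the `AN` part of `y` only adds to the height; the `K` part is removed by a change of variables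
  obtain ⟨k, hk, hy⟩ := AN.exists_toG_mul y
  have hA : ∀ x, height (y * x) = height y + height (k * x) := by
    intro x
    conv_lhs => rw [hy, mul_assoc]
    exact height_na_mul _ _ _
  set f : G → ℂ := fun x => invSphTransform H x *
    Complex.exp ((1 + Complex.I * s) * height x) with hf
  have hfc : Continuous f := hH.continuous_invSph.mul (continuous_horo s)
  have h1 := integral_iwasawa_mul_left f hfc (fun g k hk => by
    simp only [hf, height_mul_SU2 g k hk]
    rw [invSph_eq_of_ch_eq H (ch_mul_SU2 g k hk)]) k
  -- integrating over horocycles first turns the Abel transform into the Fourier transform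
  have h2 : ∫ p : ℂ × ℝ, (Real.exp (-2 * p.2) : ℂ) * f (n p.1 * a p.2) = H s := by
    rw [Measure.volume_eq_prod, integral_prod_symm _ (hH.integrable_na (continuous_horo s)),
      ← hH.map_neg, hH.eq]
    refine integral_congr_ae (Filter.Eventually.of_forall fun t => ?_)
    simp only [height_na]
    rw [integral_const_mul, integral_mul_const, hH.integral_invSph_horocycle]
    push_cast
    rw [show ∀ A B C D : ℂ, A * (B * C * D) = C * (A * B * D) from fun A B C D => by ring,
      ← Complex.exp_add, ← Complex.exp_add]
    congr 2
    ring
  rw [← h2, ← h1, ← integral_mul_const]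
  refine integral_congr_ae (Filter.Eventually.of_forall fun p => ?_)
  simp only [hf]
  rw [invSph_eq_of_ch_eq H (ch_SU2_mul _ k hk), hA]
  push_cast
  rw [mul_add, Complex.exp_add]
  ring

/-- The spherical functions are eigenfunctions of convolution with the inverse transform of `H`,
with eigenvalue `H(s)`. -/
theorem integral_invSph_sph (hH : IsEvenPW H w) (s : ℝ) (y : G) :
    ∫ p : ℂ × ℝ, (Real.exp (-2 * p.2) : ℂ) * (invSphTransform H (n p.1 * a p.2) *
      sph s (y * (n p.1 * a p.2))) = H s * sph s y := by
  have hcont : Continuous fun q : (ℂ × ℝ) × SU2 =>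
      Complex.exp ((1 + Complex.I * s) * height (q.2.1 * (y * (n q.1.1 * a q.1.2)))) := by
    refine (continuous_horo s).comp ?_
    exact (continuous_subtype_val.comp continuous_snd).mul
      (continuous_const.mul (continuous_na.comp continuous_fst))
  have hk : Continuous fun q : (ℂ × ℝ) × SU2 => (Real.exp (-2 * q.1.2) : ℂ) *
      (invSphTransform H (n q.1.1 * a q.1.2)) := by
    refine Continuous.mul (by fun_prop) ?_
    exact hH.continuous_invSph.comp (continuous_na.comp continuous_fst)
  obtain ⟨c, hc⟩ := hH.exists_invSph_eq_zero
  have hcs : HasCompactSupport fun q : (ℂ × ℝ) × SU2 => (Real.exp (-2 * q.1.2) : ℂ) *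
      (invSphTransform H (n q.1.1 * a q.1.2)) := by
    have h1 := hasCompactSupport_comp_na hc
    refine HasCompactSupport.intro (h1.isCompact.prod isCompact_univ) fun q hq => ?_
    have : q.1 ∉ tsupport fun p : ℂ × ℝ => invSphTransform H (n p.1 * a p.2) :=
      fun h => hq ⟨h, Set.mem_univ _⟩
    have h2 := image_eq_zero_of_notMem_tsupport this
    rw [h2, mul_zero]
  have hint : Integrable (fun q : (ℂ × ℝ) × SU2 => ((Real.exp (-2 * q.1.2) : ℂ) *
      (invSphTransform H (n q.1.1 * a q.1.2))) *
      Complex.exp ((1 + Complex.I * s) * height (q.2.1 * (y * (n q.1.1 * a q.1.2)))))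
      ((volume : Measure (ℂ × ℝ)).prod haarK) :=
    (hk.mul hcont).integrable_of_hasCompactSupport hcs.mul_right
  calc ∫ p : ℂ × ℝ, (Real.exp (-2 * p.2) : ℂ) * (invSphTransform H (n p.1 * a p.2) *
      sph s (y * (n p.1 * a p.2)))
      = ∫ p : ℂ × ℝ, (∫ u : SU2, ((Real.exp (-2 * p.2) : ℂ) *
      (invSphTransform H (n p.1 * a p.2))) *
      Complex.exp ((1 + Complex.I * s) * height (u.1 * (y * (n p.1 * a p.2)))) ∂haarK) := by
        refine integral_congr_ae (Filter.Eventually.of_forall fun p => ?_)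
        simp only
        rw [integral_const_mul, ← mul_assoc, sph]
    _ = ∫ u : SU2, (∫ p : ℂ × ℝ, ((Real.exp (-2 * p.2) : ℂ) *
      (invSphTransform H (n p.1 * a p.2))) *
      Complex.exp ((1 + Complex.I * s) * height (u.1 * (y * (n p.1 * a p.2))))) ∂haarK :=
        integral_integral_swap hint
    _ = ∫ u : SU2, H s * Complex.exp ((1 + Complex.I * s) * height (u.1 * y)) ∂haarK := by
        refine integral_congr_ae (Filter.Eventually.of_forall fun u => ?_)
        simp only
        rw [← hH.integral_invSph_horo s (u.1 * y)]
        simp only [mul_assoc]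
    _ = H s * sph s y := by rw [integral_const_mul, sph]

theorem sphTransform_invSph (hH : IsEvenPW H w) (s : ℝ) :
    sphTransform (invSphTransform H) s = H s := by
  unfold sphTransform
  rw [intG_of_right_invariant _ fun g k hk => by
    rw [invSph_eq_of_ch_eq H (ch_mul_SU2 g k hk), sph_eq_of_ch_eq _ (ch_mul_SU2 g k hk)]]
  have h := hH.integral_invSph_sph (-s) 1
  simp only [one_mul] at h
  rw [h, hH.map_neg, sph_eq_one, mul_one]
  unfold ch
  norm_num

/-- The inverse transform turns products into convolutions. -/
theorem conv_invSph (hH : IsEvenPW H w) (g : G) :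
    conv (invSphTransform H) (invSphTransform H) g = invSphTransform (fun s => H s ^ 2) g := by
  -- invariance under inversion, which makes `integral_invSph_sph` applicable
  have hinv : ∀ x : G, invSphTransform H (x⁻¹ * g) = invSphTransform H (g⁻¹ * x) := by
    intro x
    refine invSph_eq_of_ch_eq H ?_
    rw [← ch_inv, mul_inv_rev, inv_inv]
  unfold conv
  simp only [hinv]
  rw [intG_of_right_invariant _ fun x k hk => by
    rw [invSph_eq_of_ch_eq H (ch_mul_SU2 x k hk), ← mul_assoc,
      invSph_eq_of_ch_eq H (ch_mul_SU2 (g⁻¹ * x) k hk)]]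
  have hsph : Continuous fun q : (ℂ × ℝ) × ℝ => sph q.2 (g⁻¹ * (n q.1.1 * a q.1.2)) :=
    continuous_sph.comp (continuous_snd.prodMk
      (continuous_const.mul (continuous_na.comp continuous_fst)))
  have hint : Integrable (fun q : (ℂ × ℝ) × ℝ => ((Real.exp (-2 * q.1.2) : ℂ) *
      (invSphTransform H (n q.1.1 * a q.1.2) * 1)) * (H q.2 * (q.2 : ℂ) ^ 2) *
      sph q.2 (g⁻¹ * (n q.1.1 * a q.1.2)))
      ((volume : Measure (ℂ × ℝ)).prod (volume.restrict (Set.Ioi 0))) := by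
    have h1 := hH.integrable_na (f := fun _ => 1) continuous_const
    have h2 : Integrable (fun s : ℝ => H s * (s : ℂ) ^ 2) (volume.restrict (Set.Ioi 0)) := by
      refine Integrable.integrableOn ((hH.integrable_pow 2).congr
        (Filter.Eventually.of_forall fun s => mul_comm _ _))
    refine (h1.mul_prod h2).mul_bdd hsph.aestronglyMeasurable
      (Filter.Eventually.of_forall fun q => norm_sph_le_one _ _)
  calc ∫ p : ℂ × ℝ, (Real.exp (-2 * p.2) : ℂ) * (invSphTransform H (n p.1 * a p.2) *
      invSphTransform H (g⁻¹ * (n p.1 * a p.2)))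
      = ∫ p : ℂ × ℝ, (1 / (2 * (Real.pi : ℂ) ^ 2)) * ∫ s in Set.Ioi (0 : ℝ),
      ((Real.exp (-2 * p.2) : ℂ) *
      (invSphTransform H (n p.1 * a p.2) * 1)) * (H s * (s : ℂ) ^ 2) *
      sph s (g⁻¹ * (n p.1 * a p.2)) := by
        refine integral_congr_ae (Filter.Eventually.of_forall fun p => ?_)
        simp only
        have : ∀ s : ℝ, ((Real.exp (-2 * p.2) : ℂ) *
          (invSphTransform H (n p.1 * a p.2) * 1)) * (H s * (s : ℂ) ^ 2) *
          sph s (g⁻¹ * (n p.1 * a p.2)) = ((Real.exp (-2 * p.2) : ℂ) *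
          (invSphTransform H (n p.1 * a p.2))) *
          (H s * sph s (g⁻¹ * (n p.1 * a p.2)) * (s : ℂ) ^ 2) := fun s => by ring
        simp only [this]
        rw [integral_const_mul]
        conv_lhs => rw [invSphTransform.eq_def H (g⁻¹ * _)]
        ring
    _ = (1 / (2 * (Real.pi : ℂ) ^ 2)) * ∫ s in Set.Ioi (0 : ℝ), ∫ p : ℂ × ℝ,
      ((Real.exp (-2 * p.2) : ℂ) *
      (invSphTransform H (n p.1 * a p.2) * 1)) * (H s * (s : ℂ) ^ 2) *
      sph s (g⁻¹ * (n p.1 * a p.2)) := by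
        rw [integral_const_mul, integral_integral_swap hint]
    _ = invSphTransform (fun s => H s ^ 2) g := by
        change _ = 1 / (2 * (Real.pi : ℂ) ^ 2) * ∫ s in Set.Ioi (0 : ℝ),
          H s ^ 2 * sph s g * (s : ℂ) ^ 2
        congr 1
        refine setIntegral_congr_fun measurableSet_Ioi fun s _ => ?_
        have h1 := hH.integral_invSph_sph s g⁻¹
        rw [sph_eq_of_ch_eq s (ch_inv g)] at h1
        rw [show H s ^ 2 * sph s g * (s : ℂ) ^ 2 = (H s * (s : ℂ) ^ 2) * (H s * sph s g) by ring,
          ← h1, ← integral_const_mul]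
        refine integral_congr_ae (Filter.Eventually.of_forall fun p => ?_)
        simp only
        ring

end IsEvenPW

/-! ### Estimates for the left-invariant distance -/

/-- A curve in `G` whose matrix entries are `C¹`. -/
def IsC1 (γ : ℝ → G) : Prop := ∀ i j, ContDiff ℝ 1 fun t => γ t i j

theorem IsC1.mul {γ δ : ℝ → G} (hγ : IsC1 γ) (hδ : IsC1 δ) : IsC1 fun t => γ t * δ t := by
  intro i j
  simp only [mul_entry]
  exact ((hγ i 0).mul (hδ 0 j)).add ((hγ i 1).mul (hδ 1 j))

/-- The lower triangular unipotent matrix with lower left entry `z`. -/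
def lowerUnip (z : ℂ) : G := ⟨!![1, 0; z, 1], by simp [Matrix.det_fin_two]⟩

/-- Any matrix can be joined to the identity by a `C¹` curve: this holds for elementary matrices,
and they generate `G`. -/
theorem exists_path_to_one (g : G) : ∃ γ : ℝ → G, IsC1 γ ∧ γ 0 = g ∧ γ 1 = 1 := by
  have hmul : ∀ g h : G, (∃ γ : ℝ → G, IsC1 γ ∧ γ 0 = g ∧ γ 1 = 1) →
      (∃ γ : ℝ → G, IsC1 γ ∧ γ 0 = h ∧ γ 1 = 1) →
      ∃ γ : ℝ → G, IsC1 γ ∧ γ 0 = g * h ∧ γ 1 = 1 := by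
    rintro g h ⟨γ, h1, h2, h3⟩ ⟨δ, h1', h2', h3'⟩
    exact ⟨fun t => γ t * δ t, h1.mul h1', by simp only [h2, h2'], by simp only [h3, h3', one_mul]⟩
  have hlin : ∀ z : ℂ, ContDiff ℝ 1 fun t : ℝ => ((1 - t : ℝ) : ℂ) * z := fun z =>
    (Complex.ofRealCLM.contDiff.comp (contDiff_const.sub contDiff_id)).mul contDiff_const
  have hup : ∀ z : ℂ, ∃ γ : ℝ → G, IsC1 γ ∧ γ 0 = n z ∧ γ 1 = 1 := by
    intro z
    refine ⟨fun t => n (((1 - t : ℝ) : ℂ) * z), fun i j => ?_, by simp, ?_⟩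
    · fin_cases i <;> fin_cases j <;> simp only [n] <;> first | exact contDiff_const | exact hlin z
    · apply Subtype.ext
      ext i j
      fin_cases i <;> fin_cases j <;> simp [n]
  have hlow : ∀ z : ℂ, ∃ γ : ℝ → G, IsC1 γ ∧ γ 0 = lowerUnip z ∧ γ 1 = 1 := by
    intro z
    refine ⟨fun t => lowerUnip (((1 - t : ℝ) : ℂ) * z), fun i j => ?_, by simp, ?_⟩
    · fin_cases i <;> fin_cases j <;> simp only [lowerUnip] <;>
        first | exact contDiff_const | exact hlin z
    · apply Subtype.ext
      ext i j
      fin_cases i <;> fin_cases j <;> simp [lowerUnip]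
  -- a matrix whose lower left entry is not zero is a product of three elementary matrices
  have hne : ∀ g : G, g 1 0 ≠ 0 → ∃ γ : ℝ → G, IsC1 γ ∧ γ 0 = g ∧ γ 1 = 1 := by
    intro g hg
    have hdet := det_entries g
    have he : g = n ((g 0 0 - 1) / g 1 0) * (lowerUnip (g 1 0) * n ((g 1 1 - 1) / g 1 0)) := by
      apply Subtype.ext
      change g.1 = (n _).1 * ((lowerUnip _).1 * (n _).1)
      ext i j
      fin_cases i <;> fin_cases j <;> simp [n, lowerUnip, Matrix.mul_apply, Fin.sum_univ_two] <;>
        field_simp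
      · ring
      · linear_combination -hdet
      · ring
    rw [he]
    exact hmul _ _ (hup _) (hmul _ _ (hlow _) (hup _))
  by_cases h0 : g 1 0 = 0
  · have h1 : (lowerUnip 1 * g) 1 0 ≠ 0 := by
      have hdet := det_entries g
      rw [mul_entry, h0]
      intro h
      simp [lowerUnip] at h
      simp [h, h0] at hdet
    have he : g = lowerUnip (-1) * (lowerUnip 1 * g) := by
      rw [← mul_assoc]
      have : lowerUnip (-1) * lowerUnip 1 = 1 := by
        apply Subtype.ext
        change (lowerUnip _).1 * (lowerUnip _).1 = 1
        ext i j
        fin_cases i <;> fin_cases j <;> simp [lowerUnip, Matrix.mul_apply, Fin.sum_univ_two]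
      rw [this, one_mul]
    rw [he]
    exact hmul _ _ (hlow _) (hne _ h1)
  · exact hne g h0

/-- The matrix of the derivatives of the entries of a curve. -/
def velocity (γ : ℝ → G) (t : ℝ) : Matrix (Fin 2) (Fin 2) ℂ :=
  Matrix.of fun i j => deriv (fun τ => γ τ i j) t

theorem slNorm_nonneg (Z : Matrix (Fin 2) (Fin 2) ℂ) : 0 ≤ slNorm Z := Real.sqrt_nonneg _

theorem pathLength_nonneg (γ : ℝ → G) : 0 ≤ pathLength γ :=
  intervalIntegral.integral_nonneg zero_le_one fun _ _ => slNorm_nonneg _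

theorem dG_le_pathLength {γ : ℝ → G} (hγ : IsC1 γ) : dG (γ 0) (γ 1) ≤ pathLength γ := by
  refine csInf_le ⟨0, ?_⟩ ⟨γ, hγ, rfl, rfl, rfl⟩
  rintro L ⟨δ, -, -, -, rfl⟩
  exact pathLength_nonneg δ

theorem dG_nonneg (g h : G) : 0 ≤ dG g h := by
  refine Real.sInf_nonneg ?_
  rintro L ⟨δ, -, -, -, rfl⟩
  exact pathLength_nonneg δ

theorem dHprime_le_dG {g h : G} (hh : h ∈ Hprime) : dHprime g ≤ dG g h :=
  ciInf_le (f := fun h : Hprime => dG g h) ⟨0, by rintro _ ⟨x, rfl⟩; exact dG_nonneg _ _⟩ ⟨h, hh⟩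

theorem dHprime_nonneg (g : G) : 0 ≤ dHprime g := Real.iInf_nonneg fun _ => dG_nonneg _ _

theorem dHprime_le_one {g : G} (hg : dG g 1 ≤ 1) : dHprime g ≤ 1 :=
  (dHprime_le_dG (Subgroup.one_mem _)).trans hg

theorem IsC1.hasDerivAt {γ : ℝ → G} (hγ : IsC1 γ) (t : ℝ) (i j : Fin 2) :
    HasDerivAt (fun τ => γ τ i j) (velocity γ t i j) t :=
  ((hγ i j).differentiable one_ne_zero t).hasDerivAt

theorem IsC1.continuous_velocity {γ : ℝ → G} (hγ : IsC1 γ) (i j : Fin 2) :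
    Continuous fun t => velocity γ t i j :=
  (hγ i j).continuous_deriv le_rfl

/-- The logarithmic derivative `γ⁻¹ γ'`. -/
def logDeriv (γ : ℝ → G) (t : ℝ) : Matrix (Fin 2) (Fin 2) ℂ := ((γ t)⁻¹ : G).1 * velocity γ t

theorem logDeriv_apply (γ : ℝ → G) (t : ℝ) : logDeriv γ t =
    !![γ t 1 1 * velocity γ t 0 0 - γ t 0 1 * velocity γ t 1 0,
      γ t 1 1 * velocity γ t 0 1 - γ t 0 1 * velocity γ t 1 1;
      γ t 0 0 * velocity γ t 1 0 - γ t 1 0 * velocity γ t 0 0,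
      γ t 0 0 * velocity γ t 1 1 - γ t 1 0 * velocity γ t 0 1] := by
  unfold logDeriv
  rw [inv_val]
  ext i j
  fin_cases i <;> fin_cases j <;> simp [Matrix.mul_apply, Fin.sum_univ_two] <;> ring

theorem velocity_eq (γ : ℝ → G) (t : ℝ) (i j : Fin 2) :
    velocity γ t i j = γ t i 0 * logDeriv γ t 0 j + γ t i 1 * logDeriv γ t 1 j := by
  have h : (γ t).1 * logDeriv γ t = velocity γ t := by
    unfold logDeriv
    rw [← mul_assoc]
    have : (γ t).1 * ((γ t)⁻¹ : G).1 = 1 := by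
      rw [← Matrix.SpecialLinearGroup.coe_mul, mul_inv_cancel, Matrix.SpecialLinearGroup.coe_one]
    rw [this, one_mul]
  rw [← h, Matrix.mul_apply, Fin.sum_univ_two]

theorem IsC1.logDeriv_trace {γ : ℝ → G} (hγ : IsC1 γ) (t : ℝ) :
    logDeriv γ t 1 1 = -logDeriv γ t 0 0 := by
  have h1 := ((hγ.hasDerivAt t 0 0).mul (hγ.hasDerivAt t 1 1)).sub
    ((hγ.hasDerivAt t 0 1).mul (hγ.hasDerivAt t 1 0))
  have h2 : HasDerivAt (fun _ : ℝ => (1 : ℂ)) 0 t := hasDerivAt_const _ _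
  have h3 : (fun τ => γ τ 0 0 * γ τ 1 1 - γ τ 0 1 * γ τ 1 0) = fun _ => (1 : ℂ) :=
    funext fun τ => det_entries _
  have h4 := h1.unique (h3 ▸ h2)
  rw [logDeriv_apply]
  simp
  linear_combination h4

theorem norm_le_slNorm (Z : Matrix (Fin 2) (Fin 2) ℂ) :
    ‖Z 0 0‖ ≤ slNorm Z ∧ ‖Z 0 1‖ ≤ slNorm Z ∧ ‖Z 1 0‖ ≤ slNorm Z := by
  refine ⟨?_, ?_, ?_⟩ <;> refine Real.le_sqrt_of_sq_le ?_ <;>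
    nlinarith [sq_nonneg ‖Z 0 0‖, sq_nonneg ‖Z 0 1‖, sq_nonneg ‖Z 1 0‖]

theorem IsC1.norm_logDeriv_le {γ : ℝ → G} (hγ : IsC1 γ) (t : ℝ) (i j : Fin 2) :
    ‖logDeriv γ t i j‖ ≤ slNorm (logDeriv γ t) := by
  obtain ⟨h1, h2, h3⟩ := norm_le_slNorm (logDeriv γ t)
  fin_cases i <;> fin_cases j
  · exact h1
  · exact h2
  · exact h3
  · change ‖logDeriv γ t 1 1‖ ≤ _
    rw [hγ.logDeriv_trace, norm_neg]
    exact h1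

theorem IsC1.continuous_slNorm {γ : ℝ → G} (hγ : IsC1 γ) :
    Continuous fun t => slNorm (logDeriv γ t) := by
  have h1 := hγ.continuous_velocity
  have h2 : ∀ i j, Continuous fun t => γ t i j := fun i j => (hγ i j).continuous
  unfold slNorm
  simp only [logDeriv_apply]
  simp
  fun_prop

/-- The logarithm of the norm of `γ` grows at most at a rate proportional to the speed. -/
theorem ch_le_of_path {γ : ℝ → G} (hγ : IsC1 γ) (h1 : γ 1 = 1) :
    ch (γ 0) ≤ Real.exp (4 * pathLength γ) := by
  set N : ℝ → ℝ := fun t => ch (γ t) with hN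
  set N' : ℝ → ℝ := fun t => (inner ℝ (γ t 0 0) (velocity γ t 0 0)
    + inner ℝ (γ t 0 1) (velocity γ t 0 1) + inner ℝ (γ t 1 0) (velocity γ t 1 0)
    + inner ℝ (γ t 1 1) (velocity γ t 1 1)) with hN'
  have hd : ∀ t, HasDerivAt N (N' t) t := by
    intro t
    have h := ((((hγ.hasDerivAt t 0 0).norm_sq.add (hγ.hasDerivAt t 0 1).norm_sq).add
      (hγ.hasDerivAt t 1 0).norm_sq).add (hγ.hasDerivAt t 1 1).norm_sq).div_const 2
    refine h.congr_deriv ?_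
    simp only [hN']
    ring
  have hN1 : ∀ t, 1 ≤ N t := fun t => one_le_ch _
  have hbound : ∀ t, |N' t| ≤ 4 * slNorm (logDeriv γ t) * N t := by
    intro t
    set S := slNorm (logDeriv γ t)
    have hS0 : 0 ≤ S := slNorm_nonneg _
    have hv : ∀ i j, ‖velocity γ t i j‖ ≤ (‖γ t i 0‖ + ‖γ t i 1‖) * S := by
      intro i j
      rw [velocity_eq]
      refine (norm_add_le _ _).trans ?_
      rw [norm_mul, norm_mul, add_mul]
      exact add_le_add (mul_le_mul_of_nonneg_left (hγ.norm_logDeriv_le t 0 j) (norm_nonneg _))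
        (mul_le_mul_of_nonneg_left (hγ.norm_logDeriv_le t 1 j) (norm_nonneg _))
    have hi : ∀ i j, |inner ℝ (γ t i j) (velocity γ t i j)|
        ≤ ‖γ t i j‖ * ((‖γ t i 0‖ + ‖γ t i 1‖) * S) := fun i j =>
      (abs_real_inner_le_norm _ _).trans (mul_le_mul_of_nonneg_left (hv i j) (norm_nonneg _))
    have h4 : |N' t| ≤ S * ((‖γ t 0 0‖ + ‖γ t 0 1‖) ^ 2 + (‖γ t 1 0‖ + ‖γ t 1 1‖) ^ 2) := by
      refine (abs_add_le _ _).trans ?_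
      refine (add_le_add_left ((abs_add_le _ _).trans
        (add_le_add_left (abs_add_le _ _) _)) _).trans ?_
      nlinarith [hi 0 0, hi 0 1, hi 1 0, hi 1 1]
    refine h4.trans ?_
    have h5 : (‖γ t 0 0‖ + ‖γ t 0 1‖) ^ 2 + (‖γ t 1 0‖ + ‖γ t 1 1‖) ^ 2 ≤ 4 * N t := by
      simp only [hN, ch]
      nlinarith [sq_nonneg (‖γ t 0 0‖ - ‖γ t 0 1‖), sq_nonneg (‖γ t 1 0‖ - ‖γ t 1 1‖)]
    nlinarith
  have hlog : ∀ t, HasDerivAt (fun t => Real.log (N t)) (N' t / N t) t := fun t =>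
    (hd t).log (zero_lt_one.trans_le (hN1 t)).ne'
  have hcN' : Continuous N' := by
    have h1 := hγ.continuous_velocity
    have h2 : ∀ i j, Continuous fun t => γ t i j := fun i j => (hγ i j).continuous
    simp only [hN']
    fun_prop
  have hcN : Continuous N := continuous_iff_continuousAt.mpr fun t => (hd t).continuousAt
  have hcq : Continuous fun t => N' t / N t :=
    hcN'.div hcN fun t => (zero_lt_one.trans_le (hN1 t)).ne'
  have hFTC := intervalIntegral.integral_eq_sub_of_hasDerivAt (a := 0) (b := 1)
    (fun t _ => hlog t) (hcq.intervalIntegrable _ _)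
  have hle : -∫ t in (0 : ℝ)..1, N' t / N t ≤ ∫ t in (0 : ℝ)..1, 4 * slNorm (logDeriv γ t) := by
    rw [← intervalIntegral.integral_neg]
    refine intervalIntegral.integral_mono_on zero_le_one (hcq.neg.intervalIntegrable _ _)
      ((continuous_const.mul hγ.continuous_slNorm).intervalIntegrable _ _) fun t _ => ?_
    rw [← neg_div, div_le_iff₀ (zero_lt_one.trans_le (hN1 t))]
    exact (neg_le_abs _).trans (hbound t)
  have hlast : N 1 = 1 := by
    simp only [hN, h1, ch]
    norm_num
  rw [hFTC, hlast, Real.log_one, intervalIntegral.integral_const_mul] at hle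
  have : Real.log (N 0) ≤ 4 * pathLength γ := by
    have e : pathLength γ = ∫ t in (0 : ℝ)..1, slNorm (logDeriv γ t) := rfl
    rw [e]; linarith
  exact (Real.log_le_iff_le_exp (zero_lt_one.trans_le (hN1 0))).mp this

/-- The unit ball of the metric is bounded. -/
theorem ch_le_of_dG_le_one {g : G} (hg : dG g 1 ≤ 1) : ch g ≤ Real.exp 8 := by
  have hne : {L : ℝ | ∃ γ : ℝ → G, (∀ i j, ContDiff ℝ 1 fun t => γ t i j) ∧ γ 0 = g ∧ γ 1 = 1 ∧
      L = pathLength γ}.Nonempty := by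
    obtain ⟨γ, h1, h2, h3⟩ := exists_path_to_one g
    exact ⟨_, γ, h1, h2, h3, rfl⟩
  -- the infimum need not be attained, so a curve of length less than `2` is used
  obtain ⟨L, ⟨γ, h1, h2, h3, rfl⟩, hL⟩ := exists_lt_of_csInf_lt hne
    (show sInf _ < (2 : ℝ) from lt_of_le_of_lt hg one_lt_two)
  have h := ch_le_of_path h1 h3
  rw [h2] at h
  exact h.trans (Real.exp_le_exp.mpr (by linarith))

/-! ### The distance to `H'` in terms of the matrix entries -/

/-- The leading one of three coefficients that measure the position of the plane `g ℍ²` relative to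
`ℍ²`. They are the coefficients of the function `sinh δ` on `ℍ²`, where `δ` is the signed distance
to `g ℍ²`, and they vanish simultaneously exactly when `g` lies in `H'`. -/
def qA (g : G) : ℝ := (g 1 0 * conj (g 1 1)).im

/-- The middle coefficient, see `qA`. -/
def qB (g : G) : ℝ := -(g 0 0 * conj (g 1 1) + g 1 0 * conj (g 0 1)).im

/-- The last coefficient, see `qA`. -/
def qC (g : G) : ℝ := (g 0 0 * conj (g 0 1)).im

/-- Half the trace of `g ḡ⁻¹`, which is real. -/
def qW (g : G) : ℝ := (g 0 0 * conj (g 1 1) - g 0 1 * conj (g 1 0)).re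

/-- The size of the coefficients `qA`, `qB`, `qC`. -/
def qD (g : G) : ℝ := |qA g| + |qB g| + |qC g|

theorem qD_nonneg (g : G) : 0 ≤ qD g := by unfold qD; positivity

theorem det_re (g : G) : (g 0 0).re * (g 1 1).re - (g 0 0).im * (g 1 1).im
    - ((g 0 1).re * (g 1 0).re - (g 0 1).im * (g 1 0).im) = 1 := by
  have h := congrArg Complex.re (det_entries g)
  simpa using h

theorem det_im (g : G) : (g 0 0).re * (g 1 1).im + (g 0 0).im * (g 1 1).re
    - ((g 0 1).re * (g 1 0).im + (g 0 1).im * (g 1 0).re) = 0 := by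
  have h := congrArg Complex.im (det_entries g)
  simpa using h

/-- The determinant of `g ḡ⁻¹` is one. -/
theorem qW_sq (g : G) : qW g ^ 2 = 1 - (qB g ^ 2 - 4 * qA g * qC g) := by
  have h1 := det_re g
  have h2 := det_im g
  unfold qW qA qB qC
  simp
  generalize (g 0 0).re = a1 at *
  generalize (g 0 0).im = a2 at *
  generalize (g 0 1).re = b1 at *
  generalize (g 0 1).im = b2 at *
  generalize (g 1 0).re = c1 at *
  generalize (g 1 0).im = c2 at *
  generalize (g 1 1).re = d1 at *
  generalize (g 1 1).im = d2 at *
  linear_combination (a1 * d1 - a2 * d2 - (b1 * c1 - b2 * c2) + 1) * h1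
    + (a1 * d2 + a2 * d1 - (b1 * c2 + b2 * c1)) * h2

/-- The rows of the identity `ḡ = (g ḡ⁻¹)⁻¹ g`. -/
theorem conj_entry_zero (g : G) (j : Fin 2) :
    conj (g 0 j) = (qW g + Complex.I * qB g) * g 0 j + 2 * Complex.I * qC g * g 1 j := by
  have h1 := det_re g
  have h2 := det_im g
  unfold qW qB qC
  apply Complex.ext
  · fin_cases j <;> simp <;>
    generalize (g 0 0).re = a1 at * <;>
    generalize (g 0 0).im = a2 at * <;>
    generalize (g 0 1).re = b1 at * <;>
    generalize (g 0 1).im = b2 at * <;>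
    generalize (g 1 0).re = c1 at * <;>
    generalize (g 1 0).im = c2 at * <;>
    generalize (g 1 1).re = d1 at * <;>
    generalize (g 1 1).im = d2 at *
    · linear_combination -a1 * h1 - a2 * h2
    · linear_combination -b1 * h1 - b2 * h2
  · fin_cases j <;> simp <;>
    generalize (g 0 0).re = a1 at * <;>
    generalize (g 0 0).im = a2 at * <;>
    generalize (g 0 1).re = b1 at * <;>
    generalize (g 0 1).im = b2 at * <;>
    generalize (g 1 0).re = c1 at * <;>
    generalize (g 1 0).im = c2 at * <;>
    generalize (g 1 1).re = d1 at * <;>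
    generalize (g 1 1).im = d2 at *
    · linear_combination a2 * h1 - a1 * h2
    · linear_combination b2 * h1 - b1 * h2

theorem conj_entry_one (g : G) (j : Fin 2) :
    conj (g 1 j) = (qW g - Complex.I * qB g) * g 1 j - 2 * Complex.I * qA g * g 0 j := by
  have h1 := det_re g
  have h2 := det_im g
  unfold qW qB qA
  apply Complex.ext
  · fin_cases j <;> simp <;>
    generalize (g 0 0).re = a1 at * <;>
    generalize (g 0 0).im = a2 at * <;>
    generalize (g 0 1).re = b1 at * <;>
    generalize (g 0 1).im = b2 at * <;>
    generalize (g 1 0).re = c1 at * <;>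
    generalize (g 1 0).im = c2 at * <;>
    generalize (g 1 1).re = d1 at * <;>
    generalize (g 1 1).im = d2 at *
    · linear_combination -c1 * h1 - c2 * h2
    · linear_combination -d1 * h1 - d2 * h2
  · fin_cases j <;> simp <;>
    generalize (g 0 0).re = a1 at * <;>
    generalize (g 0 0).im = a2 at * <;>
    generalize (g 0 1).re = b1 at * <;>
    generalize (g 0 1).im = b2 at * <;>
    generalize (g 1 0).re = c1 at * <;>
    generalize (g 1 0).im = c2 at * <;>
    generalize (g 1 1).re = d1 at * <;>
    generalize (g 1 1).im = d2 at *
    · linear_combination c2 * h1 - c1 * h2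
    · linear_combination d2 * h1 - d1 * h2

theorem qD_le {g : G} {L : ℝ} (hL : ∀ i j, ‖g i j‖ ≤ L) : qD g ≤ 4 * L ^ 2 := by
  have hL0 : 0 ≤ L := (norm_nonneg _).trans (hL 0 0)
  have hm : ∀ i j i' j', ‖g i j * conj (g i' j')‖ ≤ L ^ 2 := by
    intro i j i' j'
    rw [norm_mul, RCLike.norm_conj, sq]
    exact mul_le_mul (hL _ _) (hL _ _) (norm_nonneg _) hL0
  have h1 : |qA g| ≤ L ^ 2 := (Complex.abs_im_le_norm _).trans (hm _ _ _ _)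
  have h3 : |qC g| ≤ L ^ 2 := (Complex.abs_im_le_norm _).trans (hm _ _ _ _)
  have h2 : |qB g| ≤ L ^ 2 + L ^ 2 := by
    unfold qB
    rw [abs_neg]
    exact (Complex.abs_im_le_norm _).trans ((norm_add_le _ _).trans
      (add_le_add (hm _ _ _ _) (hm _ _ _ _)))
  unfold qD
  linarith

theorem abs_one_sub_qW_le {g : G} (hw : 0 ≤ qW g) : |1 - qW g| ≤ qD g ^ 2 := by
  have h := qW_sq g
  have h1 : |1 - qW g| ≤ |1 - qW g| * (1 + qW g) := by
    nlinarith [abs_nonneg (1 - qW g)]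
  have h2 : |1 - qW g| * (1 + qW g) = |qB g ^ 2 - 4 * qA g * qC g| := by
    rw [← abs_of_nonneg (show 0 ≤ 1 + qW g by linarith), ← abs_mul]
    congr 1
    linarith
  rw [h2] at h1
  refine h1.trans ((abs_sub _ _).trans ?_)
  rw [abs_mul, abs_mul, abs_of_nonneg (sq_nonneg (qB g))]
  unfold qD
  norm_num
  have hs := sq_abs (qB g)
  nlinarith [abs_nonneg (qA g), abs_nonneg (qB g), abs_nonneg (qC g),
    sq_nonneg (|qA g| - |qC g|), mul_nonneg (abs_nonneg (qA g)) (abs_nonneg (qB g)),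
    mul_nonneg (abs_nonneg (qC g)) (abs_nonneg (qB g))]

theorem abs_im_entry_le {g : G} {L : ℝ} (hL1 : 1 ≤ L) (hL : ∀ i j, ‖g i j‖ ≤ L) (hw : 0 ≤ qW g)
    (i j : Fin 2) : |(g i j).im| ≤ 4 * L ^ 3 * qD g := by
  have hD := qD_nonneg g
  have h1 : |1 - qW g| ≤ 4 * L ^ 2 * qD g :=
    (abs_one_sub_qW_le hw).trans (by nlinarith [qD_le hL])
  have hA : |qA g| ≤ qD g := by unfold qD; linarith [abs_nonneg (qB g), abs_nonneg (qC g)]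
  have hB : |qB g| ≤ qD g := by unfold qD; linarith [abs_nonneg (qA g), abs_nonneg (qC g)]
  have hC : |qC g| ≤ qD g := by unfold qD; linarith [abs_nonneg (qA g), abs_nonneg (qB g)]
  have key : ∀ (x y z : ℂ) (b c : ℝ), x = (1 - qW g : ℝ) * y + Complex.I * b * y
      + 2 * Complex.I * c * z → ‖y‖ ≤ L → ‖z‖ ≤ L → |b| ≤ qD g → |c| ≤ qD g →
      ‖x‖ ≤ 8 * L ^ 3 * qD g := by
    intro x y z b c hx hy hz hb hc
    rw [hx]
    refine (norm_add₃_le).trans ?_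
    simp only [norm_mul, Complex.norm_real, Complex.norm_I, one_mul, Real.norm_eq_abs,
      Complex.norm_two, mul_one]
    have e1 : |1 - qW g| * ‖y‖ ≤ 4 * L ^ 2 * qD g * L :=
      mul_le_mul h1 hy (norm_nonneg _) (by positivity)
    have e2 : |b| * ‖y‖ ≤ qD g * L := mul_le_mul hb hy (norm_nonneg _) hD
    have e3 : |c| * ‖z‖ ≤ qD g * L := mul_le_mul hc hz (norm_nonneg _) hD
    have e4 : qD g * L ≤ qD g * L ^ 3 := by
      refine mul_le_mul_of_nonneg_left ?_ hD
      exact le_self_pow₀ hL1 (by norm_num)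
    nlinarith
  -- `g ḡ⁻¹` is close to the identity, so `ḡ` is close to `g`
  have hsub : ‖g i j - conj (g i j)‖ ≤ 8 * L ^ 3 * qD g := by
    fin_cases i
    · change ‖g 0 j - conj (g 0 j)‖ ≤ _
      refine key _ (g 0 j) (g 1 j) (-qB g) (-qC g) ?_ (hL _ _) (hL _ _) (by rwa [abs_neg])
        (by rwa [abs_neg])
      rw [conj_entry_zero g j]
      push_cast
      ring
    · change ‖g 1 j - conj (g 1 j)‖ ≤ _
      refine key _ (g 1 j) (g 0 j) (qB g) (qA g) ?_ (hL _ _) (hL _ _) hB hA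
      rw [conj_entry_one g j]
      push_cast
      ring
  rw [Complex.sub_conj, norm_mul, Complex.norm_I, mul_one, Complex.norm_real, Real.norm_eq_abs,
    abs_mul, abs_two] at hsub
  linarith

/-- `Re g + i d Im g`. -/
def shrinkIm (g : G) (d : ℝ) : Matrix (Fin 2) (Fin 2) ℂ :=
  Matrix.of fun i j => ((g i j).re : ℂ) + d * ((g i j).im : ℂ) * Complex.I

theorem shrinkIm_one (g : G) : shrinkIm g 1 = g.1 := by
  ext i j
  simp only [shrinkIm, Matrix.of_apply, Complex.ofReal_one, one_mul]
  exact Complex.re_add_im _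

/-- `det (Re g + i d Im g)`, see `det_shrinkIm`. -/
def kappa (g : G) (d : ℝ) : ℝ := (1 + qW g) / 2 + d * d * ((1 - qW g) / 2)

theorem det_shrinkIm (g : G) (d : ℝ) : (shrinkIm g d).det = (kappa g d : ℂ) := by
  have h1 := det_re g
  have h2 := det_im g
  rw [Matrix.det_fin_two]
  unfold kappa qW shrinkIm
  apply Complex.ext <;> simp <;>
    generalize (g 0 0).re = a1 at * <;>
    generalize (g 0 0).im = a2 at * <;>
    generalize (g 0 1).re = b1 at * <;>
    generalize (g 0 1).im = b2 at * <;>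
    generalize (g 1 0).re = c1 at * <;>
    generalize (g 1 0).im = c2 at * <;>
    generalize (g 1 1).re = d1 at * <;>
    generalize (g 1 1).im = d2 at *
  · linear_combination (1 / 2 + d * d / 2) * h1
  · linear_combination d * h2

theorem half_le_kappa {g : G} (hw : 0 ≤ qW g) {d : ℝ} (hd : d * d ≤ 1) : 1 / 2 ≤ kappa g d := by
  unfold kappa
  nlinarith [mul_self_nonneg d]

theorem sqrt_kappa_sq {g : G} (hw : 0 ≤ qW g) {d : ℝ} (hd : d * d ≤ 1) :
    Real.sqrt (kappa g d) * Real.sqrt (kappa g d) = kappa g d :=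
  Real.mul_self_sqrt (by linarith [half_le_kappa hw hd])

theorem cos_mul_self_le_one (x : ℝ) : Real.cos x * Real.cos x ≤ 1 := by
  nlinarith [Real.sin_sq_add_cos_sq x, sq_nonneg (Real.sin x)]

/-- The curve `(Re g + i cos(π t / 2) Im g) / √det`, which joins `g` to a real matrix. -/
def realPath (g : G) (hw : 0 ≤ qW g) (t : ℝ) : G :=
  ⟨((Real.sqrt (kappa g (Real.cos (Real.pi / 2 * t))) : ℂ)⁻¹) •
    shrinkIm g (Real.cos (Real.pi / 2 * t)), by
    have h := sqrt_kappa_sq hw (cos_mul_self_le_one (Real.pi / 2 * t))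
    have h1 := half_le_kappa hw (cos_mul_self_le_one (Real.pi / 2 * t))
    have h2 : (kappa g (Real.cos (Real.pi / 2 * t)) : ℂ) ≠ 0 := by
      exact_mod_cast (by linarith : (0 : ℝ) < _).ne'
    rw [Matrix.det_smul, det_shrinkIm, Fintype.card_fin, inv_pow, sq, ← Complex.ofReal_mul, h,
      inv_mul_cancel₀ h2]⟩

theorem realPath_entry (g : G) (hw : 0 ≤ qW g) (t : ℝ) (i j : Fin 2) : realPath g hw t i j =
    ((Real.sqrt (kappa g (Real.cos (Real.pi / 2 * t))) : ℂ)⁻¹) *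
      (((g i j).re : ℂ) + (Real.cos (Real.pi / 2 * t) : ℝ) * ((g i j).im : ℂ) * Complex.I) := rfl

theorem realPath_zero (g : G) (hw : 0 ≤ qW g) : realPath g hw 0 = g := by
  apply Subtype.ext
  change _ • shrinkIm g _ = g.1
  rw [mul_zero, Real.cos_zero, shrinkIm_one]
  have : kappa g 1 = 1 := by unfold kappa; ring
  rw [this]
  simp

theorem realPath_one_mem (g : G) (hw : 0 ≤ qW g) : realPath g hw 1 ∈ H0 := by
  rw [mem_H0_iff]
  intro i j
  rw [realPath_entry]
  rw [mul_one, Real.cos_pi_div_two, Complex.ofReal_zero, zero_mul, zero_mul, add_zero,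
    ← Complex.ofReal_inv, ← Complex.ofReal_mul, Complex.ofReal_im]

/-- The derivative of the entries of `realPath`, with the reciprocal square root of the determinant
differentiated separately. -/
theorem hasDerivAt_realPath (g : G) (hw : 0 ≤ qW g) (t : ℝ) (i j : Fin 2) :
    HasDerivAt (fun t => realPath g hw t i j)
      (-(((Real.cos (Real.pi / 2 * t)) * (-Real.sin (Real.pi / 2 * t) * (Real.pi / 2)) *
        (1 - qW g) / (2 * Real.sqrt (kappa g (Real.cos (Real.pi / 2 * t)))) /
          Real.sqrt (kappa g (Real.cos (Real.pi / 2 * t))) ^ 2 : ℝ) : ℂ) *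
      (((g i j).re : ℂ) + (Real.cos (Real.pi / 2 * t) : ℝ) * ((g i j).im : ℂ) * Complex.I)
      + ((Real.sqrt (kappa g (Real.cos (Real.pi / 2 * t))) : ℂ)⁻¹) *
        ((-Real.sin (Real.pi / 2 * t) * (Real.pi / 2) : ℝ) * ((g i j).im : ℂ) * Complex.I)) t := by
  set d := fun t : ℝ => Real.cos (Real.pi / 2 * t) with hd
  have h1 : HasDerivAt d (-Real.sin (Real.pi / 2 * t) * (Real.pi / 2)) t := by
    simpa using ((hasDerivAt_id t).const_mul (Real.pi / 2)).cos
  have hpos : 0 < kappa g (d t) := by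
    have := half_le_kappa hw (cos_mul_self_le_one (Real.pi / 2 * t))
    exact lt_of_lt_of_le (by norm_num) this
  have h2 : HasDerivAt (fun t => kappa g (d t))
      (d t * (-Real.sin (Real.pi / 2 * t) * (Real.pi / 2)) * (1 - qW g)) t := by
    have := ((h1.mul h1).mul_const ((1 - qW g) / 2)).const_add ((1 + qW g) / 2)
    refine this.congr_deriv ?_
    ring
  have h3 := (h2.sqrt hpos.ne').inv (Real.sqrt_pos.mpr hpos).ne'
  have h4 := h3.ofReal_comp
  have h5 := ((h1.ofReal_comp.mul_const ((g i j).im : ℂ)).mul_const Complex.I).const_add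
    ((g i j).re : ℂ)
  refine ((h4.mul h5).congr_deriv ?_).congr_of_eventuallyEq
    (Filter.Eventually.of_forall fun t => ?_)
  · simp only [Pi.inv_apply, hd]
    push_cast
    ring
  · change (realPath g hw t) i j = _
    rw [realPath_entry]
    simp [hd]

theorem isC1_realPath (g : G) (hw : 0 ≤ qW g) : IsC1 (realPath g hw) := by
  intro i j
  simp only [realPath_entry]
  have h1 : ContDiff ℝ 1 fun t : ℝ => Real.cos (Real.pi / 2 * t) :=
    Real.contDiff_cos.comp (contDiff_const.mul contDiff_id)
  have hpos : ∀ t : ℝ, kappa g (Real.cos (Real.pi / 2 * t)) ≠ 0 := fun t => by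
    have := half_le_kappa hw (cos_mul_self_le_one (Real.pi / 2 * t))
    exact (lt_of_lt_of_le (by norm_num) this).ne'
  have h2 : ContDiff ℝ 1 fun t : ℝ => Real.sqrt (kappa g (Real.cos (Real.pi / 2 * t))) := by
    refine ContDiff.sqrt ?_ hpos
    unfold kappa
    fun_prop
  have h3 : ContDiff ℝ 1 fun t : ℝ =>
      ((Real.sqrt (kappa g (Real.cos (Real.pi / 2 * t))) : ℂ)⁻¹) := by
    refine ContDiff.inv (Complex.ofRealCLM.contDiff.comp h2) fun t => ?_
    have := half_le_kappa hw (cos_mul_self_le_one (Real.pi / 2 * t))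
    exact_mod_cast (Real.sqrt_pos.mpr (lt_of_lt_of_le (by norm_num) this)).ne'
  refine h3.mul (contDiff_const.add ?_)
  exact ((Complex.ofRealCLM.contDiff.comp h1).mul contDiff_const).mul contDiff_const

theorem slNorm_le {Z : Matrix (Fin 2) (Fin 2) ℂ} {M : ℝ} (hM : ∀ i j, ‖Z i j‖ ≤ M) :
    slNorm Z ≤ 2 * M := by
  have h0 : 0 ≤ M := (norm_nonneg _).trans (hM 0 0)
  refine Real.sqrt_le_iff.mpr ⟨by linarith, ?_⟩
  nlinarith [hM 0 0, hM 0 1, hM 1 0, norm_nonneg (Z 0 0), norm_nonneg (Z 0 1), norm_nonneg (Z 1 0)]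

/-- If the trace of `g ḡ⁻¹` is not negative, the distance from `g` to the real matrices is
controlled by the coefficients `qA`, `qB`, `qC`: the path `realPath` is short. -/
theorem exists_real_dG_le {g : G} {L : ℝ} (hL1 : 1 ≤ L) (hL : ∀ i j, ‖g i j‖ ≤ L)
    (hw : 0 ≤ qW g) : ∃ h ∈ H0, dG g h ≤ 400 * L ^ 5 * qD g := by
  refine ⟨realPath g hw 1, realPath_one_mem g hw, ?_⟩
  have hle := dG_le_pathLength (isC1_realPath g hw)
  rw [realPath_zero] at hle
  refine hle.trans ?_
  have hD := qD_nonneg g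
  set e : ℝ := 4 * L ^ 3 * qD g with he
  have he0 : 0 ≤ e := by positivity
  have h1w : |1 - qW g| ≤ e := by
    refine (abs_one_sub_qW_le hw).trans ?_
    have := qD_le hL
    have h3 : L ^ 2 ≤ L ^ 3 := pow_le_pow_right₀ hL1 (by norm_num)
    nlinarith
  -- the determinant along the path is at least `1 / 2`, and `7 / 10 < √(1 / 2)`
  have hsq : ∀ t, 7 / 10 ≤ Real.sqrt (kappa g (Real.cos (Real.pi / 2 * t))) := fun t => by
    refine Real.le_sqrt_of_sq_le ?_
    have := half_le_kappa hw (cos_mul_self_le_one (Real.pi / 2 * t))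
    linarith
  have hsqi : ∀ t, (Real.sqrt (kappa g (Real.cos (Real.pi / 2 * t))))⁻¹ ≤ 10 / 7 := fun t => by
    have := inv_anti₀ (by norm_num) (hsq t)
    norm_num at this ⊢
    exact this
  have hm : ∀ t i j, ‖((g i j).re : ℂ) + (Real.cos (Real.pi / 2 * t) : ℝ) * ((g i j).im : ℂ)
      * Complex.I‖ ≤ L := by
    intro t i j
    refine le_trans ?_ (hL i j)
    rw [← Complex.ofReal_mul, Complex.norm_add_mul_I, Complex.norm_def, Complex.normSq_apply]
    refine Real.sqrt_le_sqrt ?_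
    nlinarith [mul_self_nonneg (g i j).im, cos_mul_self_le_one (Real.pi / 2 * t)]
  have hent : ∀ t i j, ‖realPath g hw t i j‖ ≤ 10 / 7 * L := by
    intro t i j
    rw [realPath_entry, norm_mul, norm_inv, Complex.norm_real,
      Real.norm_of_nonneg (Real.sqrt_nonneg _)]
    exact mul_le_mul (hsqi t) (hm t i j) (norm_nonneg _) (by norm_num)
  -- both terms of the velocity are controlled by `e`: the first through `1 - qW g`, the second
  -- through the imaginary part of the entry
  have hvel : ∀ t i j, ‖velocity (realPath g hw) t i j‖ ≤ 6 * L * e := by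
    intro t i j
    have hv : velocity (realPath g hw) t i j = _ := (hasDerivAt_realPath g hw t i j).deriv
    rw [hv]
    set q := Real.sqrt (kappa g (Real.cos (Real.pi / 2 * t)))
    have hq0 : 7 / 10 ≤ q := hsq t
    have hqi : q⁻¹ ≤ 10 / 7 := hsqi t
    have hs : |-Real.sin (Real.pi / 2 * t) * (Real.pi / 2)| ≤ 8 / 5 := by
      rw [abs_mul, abs_neg, abs_of_pos (show 0 < Real.pi / 2 by positivity)]
      have := Real.abs_sin_le_one (Real.pi / 2 * t)
      have := Real.pi_lt_d2
      nlinarith [Real.pi_pos, abs_nonneg (Real.sin (Real.pi / 2 * t))]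
    refine (norm_add_le _ _).trans ?_
    have e1 : |Real.cos (Real.pi / 2 * t) * (-Real.sin (Real.pi / 2 * t) * (Real.pi / 2)) *
        (1 - qW g) / (2 * q) / q ^ 2| ≤ 3 * e := by
      have hc := Real.abs_cos_le_one (Real.pi / 2 * t)
      have e2 : |Real.cos (Real.pi / 2 * t) * (-Real.sin (Real.pi / 2 * t) * (Real.pi / 2)) *
        (1 - qW g)| ≤ 1 * (8 / 5) * e := by
        rw [abs_mul, abs_mul]
        exact mul_le_mul (mul_le_mul hc hs (abs_nonneg _) (by norm_num)) h1w (abs_nonneg _)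
          (by norm_num)
      rw [div_div, abs_div, abs_of_pos (show 0 < 2 * q * q ^ 2 by positivity)]
      rw [div_le_iff₀ (by positivity)]
      have hq3 : 8 / 15 ≤ 2 * q * q ^ 2 := by nlinarith [mul_self_nonneg (q - 7 / 10)]
      nlinarith
    have e3 : |(g i j).im| ≤ e := abs_im_entry_le hL1 hL hw i j
    have hL3 : e ≤ L * e := by nlinarith
    simp only [norm_mul, norm_neg, Complex.norm_real, norm_inv, Complex.norm_I, mul_one,
      Real.norm_eq_abs] at hm ⊢
    have f1 := mul_le_mul e1 (hm t i j) (norm_nonneg _) (by positivity)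
    have f2 : |q|⁻¹ * (|-Real.sin (Real.pi / 2 * t) * (Real.pi / 2)| * |(g i j).im|)
        ≤ 10 / 7 * (8 / 5 * e) := by
      rw [abs_of_pos (by linarith)]
      exact mul_le_mul hqi (mul_le_mul hs e3 (abs_nonneg _) (by norm_num)) (by positivity)
        (by norm_num)
    rw [abs_mul (-Real.sin _), abs_neg] at f2
    nlinarith
  have hlog : ∀ t, slNorm (logDeriv (realPath g hw) t) ≤ 2 * (2 * (10 / 7 * L * (6 * L * e))) := by
    intro t
    refine slNorm_le fun i j => ?_
    have hp : ∀ i j i' j', ‖realPath g hw t i j * velocity (realPath g hw) t i' j'‖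
        ≤ 10 / 7 * L * (6 * L * e) := by
      intro i j i' j'
      rw [norm_mul]
      exact mul_le_mul (hent t i j) (hvel t i' j') (norm_nonneg _) (by positivity)
    rw [logDeriv_apply, two_mul]
    fin_cases i <;> fin_cases j <;>
      exact (norm_sub_le _ _).trans (add_le_add (hp _ _ _ _) (hp _ _ _ _))
  have hfin : pathLength (realPath g hw) ≤ 2 * (2 * (10 / 7 * L * (6 * L * e))) * |1 - 0| := by
    refine (le_abs_self _).trans ?_
    change ‖∫ t in (0 : ℝ)..1, slNorm (logDeriv (realPath g hw) t)‖ ≤ _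
    refine intervalIntegral.norm_integral_le_of_norm_le_const fun t _ => ?_
    rw [Real.norm_of_nonneg (slNorm_nonneg _)]
    exact hlog t
  refine hfin.trans ?_
  rw [he]
  have : 0 ≤ L ^ 5 * qD g := by positivity
  norm_num
  nlinarith

/-- Left translations do not increase lengths. -/
theorem dG_mul_left_le (m g h : G) : dG (m * g) (m * h) ≤ dG g h := by
  refine le_csInf ?_ ?_
  · obtain ⟨γ, h1, h2, h3⟩ := exists_path_to_one (h⁻¹ * g)
    have hc : IsC1 fun _ : ℝ => h := fun i j => contDiff_const
    exact ⟨_, fun t => h * γ t, hc.mul h1, by simp [h2], by simp [h3], rfl⟩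
  · rintro L ⟨γ, h1, rfl, rfl, rfl⟩
    have hc : IsC1 fun _ : ℝ => m := fun i j => contDiff_const
    have hm : IsC1 fun t => m * γ t := hc.mul h1
    refine (dG_le_pathLength hm).trans (le_of_eq ?_)
    change ∫ t in (0 : ℝ)..1, slNorm (logDeriv (fun t => m * γ t) t)
      = ∫ t in (0 : ℝ)..1, slNorm (logDeriv γ t)
    refine intervalIntegral.integral_congr fun t _ => ?_
    have hv : velocity (fun t => m * γ t) t = m.1 * velocity γ t := by
      ext i j
      have h3 : HasDerivAt (fun τ => (m * γ τ) i j)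
          (m i 0 * velocity γ t 0 j + m i 1 * velocity γ t 1 j) t := by
        simp only [mul_entry]
        exact ((IsC1.hasDerivAt h1 t 0 j).const_mul _).add ((IsC1.hasDerivAt h1 t 1 j).const_mul _)
      rw [Matrix.mul_apply, Fin.sum_univ_two]
      exact h3.deriv
    simp only [logDeriv]
    rw [hv, mul_inv_rev, Matrix.SpecialLinearGroup.coe_mul, mul_assoc, ← mul_assoc (m⁻¹ : G).1,
      ← Matrix.SpecialLinearGroup.coe_mul, inv_mul_cancel, Matrix.SpecialLinearGroup.coe_one,
      one_mul]

/-- `diag(i, -i)`, a representative of the nontrivial component of `H'`. -/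
def diagI : G := ⟨!![Complex.I, 0; 0, -Complex.I], by simp [Matrix.det_fin_two]⟩

theorem diagI_mem : diagI ∈ Hprime := by
  rw [mem_Hprime_iff]
  right
  intro i j
  fin_cases i <;> fin_cases j <;> simp [diagI]

theorem diagI_mul_zero (g : G) (j : Fin 2) : (diagI * g) 0 j = Complex.I * g 0 j := by
  rw [mul_entry]; simp [diagI]

theorem diagI_mul_one (g : G) (j : Fin 2) : (diagI * g) 1 j = -(Complex.I * g 1 j) := by
  rw [mul_entry]; simp [diagI]

theorem qW_diagI_mul (g : G) : qW (diagI * g) = -qW g := by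
  unfold qW
  simp only [diagI_mul_zero, diagI_mul_one]
  simp
  ring

theorem qD_diagI_mul (g : G) : qD (diagI * g) = qD g := by
  have hA : qA (diagI * g) = qA g := by
    unfold qA
    simp only [diagI_mul_one]
    simp
  have hC : qC (diagI * g) = qC g := by
    unfold qC
    simp only [diagI_mul_zero]
    simp
  have hB : qB (diagI * g) = -qB g := by
    unfold qB
    simp only [diagI_mul_zero, diagI_mul_one]
    simp
    ring
  unfold qD
  rw [hA, hB, hC, abs_neg]

/-- The distance to `H'` is controlled by the coefficients `qA`, `qB`, `qC` on bounded sets. -/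
theorem dHprime_le {g : G} {L : ℝ} (hL1 : 1 ≤ L) (hL : ∀ i j, ‖g i j‖ ≤ L) :
    dHprime g ≤ 400 * L ^ 5 * qD g := by
  have hsub : H0 ≤ Hprime := Subgroup.le_normalizer
  rcases le_total 0 (qW g) with hw | hw
  · obtain ⟨h, hh, hd⟩ := exists_real_dG_le hL1 hL hw
    exact (dHprime_le_dG (hsub hh)).trans hd
  -- multiplication by `diagI` changes the sign of `qW` and keeps `qD`
  · obtain ⟨h, hh, hd⟩ := exists_real_dG_le (g := diagI * g) hL1 (fun i j => by
      fin_cases i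
      · change ‖(diagI * g) 0 j‖ ≤ L
        rw [diagI_mul_zero]; simpa using hL 0 j
      · change ‖(diagI * g) 1 j‖ ≤ L
        rw [diagI_mul_one]; simpa using hL 1 j) (by rw [qW_diagI_mul]; linarith)
    rw [qD_diagI_mul] at hd
    refine (dHprime_le_dG (Hprime.mul_mem (Hprime.inv_mem diagI_mem) (hsub hh))).trans
      (le_trans ?_ hd)
    have := dG_mul_left_le diagI⁻¹ (diagI * g) h
    rwa [inv_mul_cancel_left] at this

/-! ### A one-dimensional oscillatory integral -/

/-- The hyperbolic radius `r` with `cosh r = κ (1 + R² / 2)`. -/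
def radius (κ R : ℝ) : ℝ := Real.arcosh (κ * (1 + R ^ 2 / 2))

theorem one_le_radius_arg {κ : ℝ} (hκ : 1 ≤ κ) (R : ℝ) : 1 ≤ κ * (1 + R ^ 2 / 2) := by
  nlinarith [sq_nonneg R, mul_nonneg (by linarith : 0 ≤ κ) (sq_nonneg R)]

theorem cosh_radius {κ : ℝ} (hκ : 1 ≤ κ) (R : ℝ) :
    Real.cosh (radius κ R) = κ * (1 + R ^ 2 / 2) :=
  Real.cosh_arcosh (one_le_radius_arg hκ R)

theorem radius_nonneg {κ : ℝ} (hκ : 1 ≤ κ) (R : ℝ) : 0 ≤ radius κ R :=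
  Real.arcosh_nonneg (one_le_radius_arg hκ R)

theorem sinh_radius_nonneg {κ : ℝ} (hκ : 1 ≤ κ) (R : ℝ) : 0 ≤ Real.sinh (radius κ R) :=
  Real.sinh_nonneg_iff.mpr (radius_nonneg hκ R)

theorem mul_le_sinh_radius {κ : ℝ} (hκ : 1 ≤ κ) (R : ℝ) :
    κ * R ≤ Real.sinh (radius κ R) := by
  have h1 := Real.sinh_sq (radius κ R)
  rw [cosh_radius hκ] at h1
  apply abs_le_of_sq_le_sq' _ (sinh_radius_nonneg hκ R) |>.2
  rw [h1]
  nlinarith [sq_nonneg (κ * R ^ 2), sq_nonneg κ]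

theorem sinh_radius_le {κ : ℝ} (hκ : 1 ≤ κ) (R : ℝ) :
    Real.sinh (radius κ R) ≤ κ * (1 + R ^ 2 / 2) := by
  rw [← cosh_radius hκ]; exact (Real.sinh_lt_cosh _).le

theorem sinh_radius_pos {κ : ℝ} (hκ : 1 ≤ κ) {R : ℝ} (hR : 0 < R) :
    0 < Real.sinh (radius κ R) :=
  lt_of_lt_of_le (by positivity) (mul_le_sinh_radius hκ R)

theorem continuous_radius {κ : ℝ} (hκ : 1 ≤ κ) : Continuous (radius κ) := by
  refine Real.continuousOn_arcosh.comp_continuous (by fun_prop) fun R => ?_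
  exact one_le_radius_arg hκ R

theorem hasDerivAt_radius {κ : ℝ} (hκ : 1 ≤ κ) {R : ℝ} (hR : 0 < R) :
    HasDerivAt (radius κ) (κ * R / Real.sinh (radius κ R)) R := by
  have hlt : 1 < κ * (1 + R ^ 2 / 2) := by
    have : 0 < R ^ 2 := by positivity
    nlinarith
  have h1 : HasDerivAt (fun R : ℝ => κ * (1 + R ^ 2 / 2)) (κ * R) R := by
    have := (((hasDerivAt_id R).pow 2).div_const 2).const_add 1 |>.const_mul κ
    refine this.congr_deriv ?_
    simp
  have h2 := (Real.hasDerivAt_arcosh hlt).comp R h1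
  have h3 : Real.sinh (radius κ R) = √((κ * (1 + R ^ 2 / 2)) ^ 2 - 1) := by
    rw [radius, Real.sinh_arcosh hlt.le]
  refine h2.congr_deriv ?_
  rw [h3]; ring

theorem norm_deriv_le_mul {f1 f2 : ℝ → ℂ} {M T : ℝ} (h1 : ∀ R, HasDerivAt f1 (f2 R) R)
    (hf0 : f1 0 = 0) (b2 : ∀ R ∈ Set.Icc 0 T, ‖f2 R‖ ≤ M) {R : ℝ} (hR : R ∈ Set.Icc 0 T) :
    ‖f1 R‖ ≤ M * R := by
  have := (convex_Icc (0:ℝ) T).norm_image_sub_le_of_norm_hasDerivWithin_le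
    (fun x _ => (h1 x).hasDerivWithinAt) b2
    (show (0:ℝ) ∈ Set.Icc 0 T from ⟨le_rfl, hR.1.trans hR.2⟩) hR
  simpa [hf0, abs_of_nonneg hR.1] using this

/-- The kernel `sin (s r) / (s sinh r)`. -/
def sinKer (s κ R : ℝ) : ℝ :=
  Real.sin (s * radius κ R) / (s * Real.sinh (radius κ R))

theorem abs_sinKer_le {s κ : ℝ} (hκ : 1 ≤ κ) (R : ℝ) : |sinKer s κ R| ≤ 1 := by
  have h0 := radius_nonneg hκ R
  rw [sinKer, abs_div]
  apply div_le_one_of_le₀ _ (abs_nonneg _)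
  calc |Real.sin (s * radius κ R)| ≤ |s * radius κ R| := Real.abs_sin_le_abs
    _ = |s| * radius κ R := by rw [abs_mul, abs_of_nonneg h0]
    _ ≤ |s| * Real.sinh (radius κ R) := by
        gcongr
        exact Real.self_le_sinh_iff.mpr h0
    _ = |s * Real.sinh (radius κ R)| := by
        rw [abs_mul, abs_of_nonneg (sinh_radius_nonneg hκ R)]

theorem measurable_sinKer {s κ : ℝ} (hκ : 1 ≤ κ) : Measurable (sinKer s κ) := by
  have := (continuous_radius hκ).measurable
  unfold sinKer
  fun_prop

/-- The gain of one power of `s` in the remainder term. The weight `f' / r'` is differentiable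
with bounded derivative because `f'` vanishes at the only critical point `0` of `r`. -/
theorem norm_integral_deriv_mul_cos_le {s κ M T : ℝ} (hκ : 1 ≤ κ) (hs : 1 ≤ |s|) (hT : 0 < T)
    {f1 f2 f3 : ℝ → ℂ} (h1 : ∀ R, HasDerivAt f1 (f2 R) R) (h2 : ∀ R, HasDerivAt f2 (f3 R) R)
    (hf0 : f1 0 = 0) (b2 : ∀ R ∈ Set.Icc 0 T, ‖f2 R‖ ≤ M) (b3 : ∀ R ∈ Set.Icc 0 T, ‖f3 R‖ ≤ M) :
    ‖∫ R in (0:ℝ)..T, f1 R * (Real.cos (s * radius κ R) : ℂ)‖ ≤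
      (T ^ 2 + (2 + 2 * T) * (1 + T ^ 2 / 2)) * M / |s| := by
  have hκ0 : 0 < κ := by linarith
  have hs0 : 0 < |s| := by linarith
  have hsne : s ≠ 0 := abs_pos.mp hs0
  have hκC : (κ:ℂ) ≠ 0 := by exact_mod_cast hκ0.ne'
  have hM : 0 ≤ M := (norm_nonneg _).trans (b2 0 ⟨le_rfl, hT.le⟩)
  have c1 : Continuous f1 := continuous_iff_continuousAt.mpr fun R => (h1 R).continuousAt
  have c2 : Continuous f2 := continuous_iff_continuousAt.mpr fun R => (h2 R).continuousAt
  have cr := continuous_radius hκ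
  -- on `[0, ε]` the integral is estimated trivially; on `[ε, T]` it is integrated by parts
  set ε := T / |s| with hε
  have hε0 : 0 < ε := by positivity
  have hεT : ε ≤ T := div_le_self hT.le hs
  have bf1 : ∀ R ∈ Set.Icc 0 T, ‖f1 R‖ ≤ M * R := fun R hR => norm_deriv_le_mul h1 hf0 b2 hR
  -- the numerator of the derivative of `f1 R / R`, whose own derivative is `R * f3 R`
  have bg : ∀ R ∈ Set.Icc 0 T, ‖R * f2 R - f1 R‖ ≤ M * R ^ 2 := by
    intro R hR
    have hd : ∀ x : ℝ, HasDerivAt (fun R : ℝ => (R:ℂ) * f2 R - f1 R) (x * f3 x) x := by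
      intro x
      have := ((hasDerivAt_id x).ofReal_comp.mul (h2 x)).sub (h1 x)
      refine this.congr_deriv ?_
      simp
    have := norm_deriv_le_mul (f1 := fun R : ℝ => (R:ℂ) * f2 R - f1 R) (T := R) (M := M * R)
      (R := R) hd (by simp [hf0]) ?_ ⟨hR.1, le_rfl⟩
    · calc _ ≤ _ := this
        _ = _ := by ring
    · intro x hx
      rw [norm_mul, Complex.norm_real, Real.norm_eq_abs, abs_of_nonneg hx.1, mul_comm]
      exact mul_le_mul (b3 x ⟨hx.1, hx.2.trans hR.2⟩) hx.2 hx.1 hM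
  have hint : ∀ u v : ℝ, IntervalIntegrable
      (fun R => f1 R * (Real.cos (s * radius κ R) : ℂ)) volume u v := fun u v =>
    Continuous.intervalIntegrable (by fun_prop) u v
  rw [← intervalIntegral.integral_add_adjacent_intervals (hint 0 ε) (hint ε T)]
  have e1 : ‖∫ R in (0:ℝ)..ε, f1 R * (Real.cos (s * radius κ R) : ℂ)‖ ≤ T ^ 2 * M / |s| := by
    have := intervalIntegral.norm_integral_le_of_norm_le_const (a := 0) (b := ε) (C := M * T)
      (f := fun R => f1 R * (Real.cos (s * radius κ R) : ℂ)) ?_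
    · rw [sub_zero, abs_of_pos hε0] at this
      calc _ ≤ _ := this
        _ = _ := by rw [hε]; ring
    · intro x hx
      rw [Set.uIoc_of_le hε0.le] at hx
      rw [norm_mul, Complex.norm_real, Real.norm_eq_abs]
      calc _ ≤ M * x * 1 := mul_le_mul (bf1 x ⟨hx.1.le, hx.2.trans hεT⟩)
              (Real.abs_cos_le_one _) (abs_nonneg _) (mul_nonneg hM hx.1.le)
        _ ≤ M * T := by rw [mul_one]; gcongr; exact hx.2.trans hεT
  -- `w = f1 / r'` and `v = sin (s r) / s`, so that `w v'` is the integrand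
  set w : ℝ → ℂ := fun R => f1 R / R * (Real.sinh (radius κ R) : ℂ) / κ with hw
  set w' : ℝ → ℂ := fun R => (R * f2 R - f1 R) / R ^ 2 * (Real.sinh (radius κ R) : ℂ) / κ
    + f1 R / R * ((Real.cosh (radius κ R) * (κ * R / Real.sinh (radius κ R)) : ℝ) : ℂ) / κ with hw'
  set v : ℝ → ℂ := fun R => ((Real.sin (s * radius κ R) / s : ℝ) : ℂ) with hv
  set v' : ℝ → ℂ := fun R =>
    ((Real.cos (s * radius κ R) * (κ * R / Real.sinh (radius κ R)) : ℝ) : ℂ) with hv'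
  have hsub : ∀ R ∈ Set.uIcc ε T, 0 < R ∧ R ∈ Set.Icc 0 T := by
    intro R hR
    rw [Set.uIcc_of_le hεT] at hR
    exact ⟨hε0.trans_le hR.1, hε0.le.trans hR.1, hR.2⟩
  have dw : ∀ R ∈ Set.uIcc ε T, HasDerivAt w (w' R) R := by
    intro R hR
    have hR0 := (hsub R hR).1
    have hRC : (R:ℂ) ≠ 0 := by exact_mod_cast hR0.ne'
    have := (((h1 R).div (hasDerivAt_id R).ofReal_comp (by simpa using hRC)).mul
      ((hasDerivAt_radius hκ hR0).sinh.ofReal_comp)).div_const (κ:ℂ)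
    refine this.congr_deriv ?_
    simp only [hw', id, Complex.ofReal_one, Pi.div_apply]
    ring
  have dv : ∀ R ∈ Set.uIcc ε T, HasDerivAt v (v' R) R := by
    intro R hR
    have hR0 := (hsub R hR).1
    have := ((((hasDerivAt_radius hκ hR0).const_mul s).sin).div_const s).ofReal_comp
    convert this using 1
    simp only [hv']
    congr 1
    field_simp
  have cw' : ContinuousOn w' (Set.uIcc ε T) := by
    have n1 : ∀ R ∈ Set.uIcc ε T, (R:ℂ) ≠ 0 := fun R hR => by exact_mod_cast (hsub R hR).1.ne'
    have n2 : ∀ R ∈ Set.uIcc ε T, Real.sinh (radius κ R) ≠ 0 := fun R hR =>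
      (sinh_radius_pos hκ (hsub R hR).1).ne'
    have n3 : ∀ R ∈ Set.uIcc ε T, (R:ℂ) ^ 2 ≠ 0 := fun R hR => pow_ne_zero 2 (n1 R hR)
    have q1 : ContinuousOn (fun R : ℝ => κ * R / Real.sinh (radius κ R)) (Set.uIcc ε T) :=
      ContinuousOn.div (by fun_prop) (by fun_prop) n2
    have q2 : ContinuousOn (fun R : ℝ =>
        ((Real.cosh (radius κ R) * (κ * R / Real.sinh (radius κ R)) : ℝ) : ℂ)) (Set.uIcc ε T) :=
      Complex.continuous_ofReal.comp_continuousOn (ContinuousOn.mul (by fun_prop) q1)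
    have q3 : ContinuousOn (fun R : ℝ => f1 R / (R:ℂ)) (Set.uIcc ε T) :=
      ContinuousOn.div (by fun_prop) (by fun_prop) n1
    have q4 : ContinuousOn (fun R : ℝ => (R * f2 R - f1 R) / (R:ℂ) ^ 2) (Set.uIcc ε T) :=
      ContinuousOn.div (by fun_prop) (by fun_prop) n3
    have q5 : ContinuousOn (fun R : ℝ => (Real.sinh (radius κ R) : ℂ)) (Set.uIcc ε T) := by
      fun_prop
    exact ((q4.mul q5).div_const _).add ((q3.mul q2).div_const _)
  have cv' : ContinuousOn v' (Set.uIcc ε T) := by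
    have n2 : ∀ R ∈ Set.uIcc ε T, Real.sinh (radius κ R) ≠ 0 := fun R hR =>
      (sinh_radius_pos hκ (hsub R hR).1).ne'
    exact Complex.continuous_ofReal.comp_continuousOn (ContinuousOn.mul (by fun_prop)
      (ContinuousOn.div (by fun_prop) (by fun_prop) n2))
  have ibp := intervalIntegral.integral_mul_deriv_eq_deriv_mul dw dv
    cw'.intervalIntegrable cv'.intervalIntegrable
  have e2 : ∫ R in ε..T, f1 R * (Real.cos (s * radius κ R) : ℂ) = ∫ R in ε..T, w R * v' R := by
    refine intervalIntegral.integral_congr fun R hR => ?_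
    have hR0 := (hsub R hR).1
    have hRC : (R:ℂ) ≠ 0 := by exact_mod_cast hR0.ne'
    have hSC : (Real.sinh (radius κ R) : ℂ) ≠ 0 := by
      exact_mod_cast (sinh_radius_pos hκ hR0).ne'
    simp only [hw, hv', Complex.ofReal_mul, Complex.ofReal_div]
    field_simp
  set Q := 1 + T ^ 2 / 2 with hQ
  have bsh : ∀ R ∈ Set.Icc 0 T, Real.sinh (radius κ R) / κ ≤ Q := by
    intro R hR
    rw [div_le_iff₀ hκ0]
    have hRT : R ^ 2 ≤ T ^ 2 := pow_le_pow_left₀ hR.1 hR.2 2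
    calc _ ≤ _ := sinh_radius_le hκ R
      _ ≤ _ := by rw [mul_comm, hQ]; gcongr
  have bch : ∀ R ∈ Set.Icc 0 T, Real.cosh (radius κ R) / κ ≤ Q := by
    intro R hR
    rw [div_le_iff₀ hκ0, cosh_radius hκ]
    have hRT : R ^ 2 ≤ T ^ 2 := pow_le_pow_left₀ hR.1 hR.2 2
    rw [mul_comm, hQ]; gcongr
  have bdiv : ∀ R ∈ Set.uIcc ε T, ‖f1 R / (R:ℂ)‖ ≤ M := by
    intro R hR
    have := hsub R hR
    rw [norm_div, Complex.norm_real, Real.norm_eq_abs, abs_of_pos this.1, div_le_iff₀ this.1]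
    exact bf1 R this.2
  have bw : ∀ R ∈ Set.uIcc ε T, ‖w R‖ ≤ M * Q := by
    intro R hR
    have := hsub R hR
    simp only [hw]
    rw [mul_div_assoc, ← Complex.ofReal_div, norm_mul, Complex.norm_real, Real.norm_eq_abs,
      abs_of_nonneg (div_nonneg (sinh_radius_nonneg hκ R) hκ0.le)]
    exact mul_le_mul (bdiv R hR) (bsh R this.2)
      (div_nonneg (sinh_radius_nonneg hκ R) hκ0.le) hM
  have bw' : ∀ R ∈ Set.uIcc ε T, ‖w' R‖ ≤ 2 * (M * Q) := by
    intro R hR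
    have := hsub R hR
    have hsp := sinh_radius_pos hκ this.1
    simp only [hw']
    refine (norm_add_le _ _).trans ?_
    have t1 : ‖(R * f2 R - f1 R) / (R:ℂ) ^ 2 * (Real.sinh (radius κ R) : ℂ) / κ‖ ≤ M * Q := by
      rw [mul_div_assoc, ← Complex.ofReal_div, norm_mul, Complex.norm_real, Real.norm_eq_abs,
        abs_of_nonneg (div_nonneg (sinh_radius_nonneg hκ R) hκ0.le)]
      refine mul_le_mul ?_ (bsh R this.2) (div_nonneg (sinh_radius_nonneg hκ R) hκ0.le) hM
      rw [norm_div, norm_pow, Complex.norm_real, Real.norm_eq_abs, abs_of_pos this.1,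
        div_le_iff₀ (by have := this.1; positivity)]
      exact bg R this.2
    have t2 : ‖f1 R / R * ((Real.cosh (radius κ R) * (κ * R / Real.sinh (radius κ R)) : ℝ) : ℂ)
        / κ‖ ≤ M * Q := by
      rw [mul_div_assoc, ← Complex.ofReal_div, norm_mul, Complex.norm_real, Real.norm_eq_abs]
      refine mul_le_mul (bdiv R hR) ?_ (abs_nonneg _) hM
      have hle1 : κ * R / Real.sinh (radius κ R) ≤ 1 :=
        div_le_one_of_le₀ (mul_le_sinh_radius hκ R) hsp.le
      have hge0 : 0 ≤ κ * R / Real.sinh (radius κ R) :=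
        div_nonneg (mul_nonneg hκ0.le this.1.le) hsp.le
      have hc0 := (Real.cosh_pos (radius κ R)).le
      rw [abs_of_nonneg (div_nonneg (mul_nonneg hc0 hge0) hκ0.le)]
      calc _ ≤ Real.cosh (radius κ R) * 1 / κ := by gcongr
        _ ≤ Q := by rw [mul_one]; exact bch R this.2
    linarith
  have bv : ∀ R, ‖v R‖ ≤ 1 / |s| := by
    intro R
    simp only [hv]
    rw [Complex.norm_real, Real.norm_eq_abs, abs_div]
    gcongr
    exact Real.abs_sin_le_one _
  have hεm : ε ∈ Set.uIcc ε T := Set.left_mem_uIcc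
  have hTm : T ∈ Set.uIcc ε T := Set.right_mem_uIcc
  have e3 : ‖∫ R in ε..T, w' R * v R‖ ≤ 2 * (M * Q) * (1 / |s|) * T := by
    have := intervalIntegral.norm_integral_le_of_norm_le_const (a := ε) (b := T)
      (C := 2 * (M * Q) * (1 / |s|)) (f := fun R => w' R * v R) ?_
    · refine this.trans ?_
      rw [abs_of_nonneg (sub_nonneg.mpr hεT)]
      have : T - ε ≤ T := sub_le_self _ hε0.le
      gcongr
    · intro x hx
      rw [norm_mul]
      exact mul_le_mul (bw' x (Set.uIoc_subset_uIcc hx)) (bv x) (norm_nonneg _) (by positivity)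
  have e4 : ‖∫ R in ε..T, f1 R * (Real.cos (s * radius κ R) : ℂ)‖
      ≤ M * Q * (1 / |s|) + M * Q * (1 / |s|) + 2 * (M * Q) * (1 / |s|) * T := by
    rw [e2, ibp]
    refine (norm_sub_le _ _).trans (add_le_add ((norm_sub_le _ _).trans (add_le_add ?_ ?_)) e3)
    · rw [norm_mul]
      exact mul_le_mul (bw T hTm) (bv T) (norm_nonneg _) (by positivity)
    · rw [norm_mul]
      exact mul_le_mul (bw ε hεm) (bv ε) (norm_nonneg _) (by positivity)
  refine (norm_add_le _ _).trans ((add_le_add e1 e4).trans (le_of_eq ?_))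
  ring

/-- The endpoint `R = 0` carries the leading term of `∫ f(R) sin (s r) / (s sinh r) R dR`. -/
theorem norm_integral_mul_sinKer_sub_le {s κ M T : ℝ} (hκ : 1 ≤ κ) (hs : 1 ≤ |s|) (hT : 0 < T)
    {f f1 f2 f3 : ℝ → ℂ} (h0 : ∀ R, HasDerivAt f (f1 R) R)
    (h1 : ∀ R, HasDerivAt f1 (f2 R) R) (h2 : ∀ R, HasDerivAt f2 (f3 R) R)
    (hf0 : f1 0 = 0) (b2 : ∀ R ∈ Set.Icc 0 T, ‖f2 R‖ ≤ M) (b3 : ∀ R ∈ Set.Icc 0 T, ‖f3 R‖ ≤ M)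
    (hfT : ∀ R, T ≤ R → f R = 0) :
    ‖(∫ R in Set.Ioi (0:ℝ), (R:ℂ) * (f R * (sinKer s κ R : ℂ)))
        - f 0 * ((Real.cos (s * Real.arcosh κ) / (s ^ 2 * κ) : ℝ) : ℂ)‖ ≤
      (T ^ 2 + (2 + 2 * T) * (1 + T ^ 2 / 2)) * M / |s| ^ 3 := by
  have hκ0 : 0 < κ := by linarith
  have hs0 : 0 < |s| := by linarith
  have hsne : s ≠ 0 := abs_pos.mp hs0
  have hsC : (s:ℂ) ≠ 0 := by exact_mod_cast hsne
  have hκC : (κ:ℂ) ≠ 0 := by exact_mod_cast hκ0.ne'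
  have cf : Continuous f := continuous_iff_continuousAt.mpr fun R => (h0 R).continuousAt
  have c1 : Continuous f1 := continuous_iff_continuousAt.mpr fun R => (h1 R).continuousAt
  have cr := continuous_radius hκ
  have e0 : ∫ R in Set.Ioi (0:ℝ), (R:ℂ) * (f R * (sinKer s κ R : ℂ))
      = ∫ R in (0:ℝ)..T, (R:ℂ) * (f R * (sinKer s κ R : ℂ)) := by
    rw [intervalIntegral.integral_of_le hT.le]
    refine setIntegral_eq_of_subset_of_forall_sdiff_eq_zero measurableSet_Ioi
      Set.Ioc_subset_Ioi_self ?_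
    intro x hxx
    have hx1 : 0 < x := hxx.1
    have hx2 := hxx.2
    have hx : T ≤ x := by
      by_contra hlt
      exact hx2 (Set.mem_Ioc.mpr ⟨hx1, (not_le.mp hlt).le⟩)
    simp [hfT x hx]
  -- `R sin (s r) / (s sinh r)` is the derivative of `-cos (s r) / (s² κ)`, also at the end point
  -- `r = 0`, where the kernel is bounded
  set H : ℝ → ℂ := fun R => (Real.cos (s * radius κ R) : ℂ) with hH
  set H' : ℝ → ℂ := fun R => ((-(s ^ 2 * κ) * (R * sinKer s κ R) : ℝ) : ℂ) with hH'
  have dH : ∀ R ∈ Set.Ioo (min 0 T) (max 0 T), HasDerivAt H (H' R) R := by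
    intro R hR
    rw [min_eq_left hT.le, max_eq_right hT.le] at hR
    have hsp := sinh_radius_pos hκ hR.1
    have := (((hasDerivAt_radius hκ hR.1).const_mul s).cos).ofReal_comp
    convert this using 1
    simp only [hH', sinKer]
    congr 1
    field_simp
  have iH' : IntervalIntegrable H' volume 0 T := by
    have hm := measurable_sinKer (s := s) hκ
    have hb : IntervalIntegrable (fun R : ℝ => R * sinKer s κ R) volume 0 T := by
      have hR : IntervalIntegrable (fun R : ℝ => R) volume 0 T :=
        continuous_id.intervalIntegrable 0 T
      rw [intervalIntegrable_iff] at hR ⊢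
      refine Integrable.mul_bdd (c := 1) hR hm.aestronglyMeasurable ?_
      exact Filter.Eventually.of_forall fun x => by
        rw [Real.norm_eq_abs]; exact abs_sinKer_le hκ x
    have hc := hb.const_mul (-(s ^ 2 * κ))
    exact ⟨hc.1.ofReal, hc.2.ofReal⟩
  have ibp := intervalIntegral.integral_mul_deriv_eq_deriv_mul_of_hasDerivAt (a := 0) (b := T)
    (u := f) (v := H) (u' := f1) (v' := H') cf.continuousOn
    (Continuous.continuousOn (by fun_prop)) (fun x _ => h0 x) dH (c1.intervalIntegrable 0 T) iH'
  have e1 : ∫ R in (0:ℝ)..T, (R:ℂ) * (f R * (sinKer s κ R : ℂ))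
      = -(1 / ((s:ℂ) ^ 2 * κ)) * ∫ R in (0:ℝ)..T, f R * H' R := by
    rw [← intervalIntegral.integral_const_mul]
    refine intervalIntegral.integral_congr fun R _ => ?_
    simp only [hH', Complex.ofReal_mul, Complex.ofReal_neg, Complex.ofReal_pow]
    field_simp
  have hr0 : radius κ 0 = Real.arcosh κ := by simp [radius]
  have hbd := norm_integral_deriv_mul_cos_le hκ hs hT h1 h2 hf0 b2 b3
  rw [e0, e1, ibp, hfT T le_rfl]
  have e2 : -(1 / ((s:ℂ) ^ 2 * κ)) * (0 * H T - f 0 * H 0 - ∫ R in (0:ℝ)..T, f1 R * H R)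
      - f 0 * ((Real.cos (s * Real.arcosh κ) / (s ^ 2 * κ) : ℝ) : ℂ)
      = (1 / ((s:ℂ) ^ 2 * κ)) * ∫ R in (0:ℝ)..T, f1 R * H R := by
    simp only [hH, hr0]
    push_cast
    field_simp
    ring
  rw [e2, norm_mul]
  have e3 : ‖(1 / ((s:ℂ) ^ 2 * κ))‖ ≤ 1 / |s| ^ 2 := by
    rw [norm_div, norm_one, norm_mul, norm_pow, Complex.norm_real, Complex.norm_real,
      Real.norm_eq_abs, Real.norm_eq_abs, abs_of_pos hκ0]
    apply one_div_le_one_div_of_le (by positivity)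
    nlinarith [sq_nonneg |s|]
  calc _ ≤ 1 / |s| ^ 2 * ((T ^ 2 + (2 + 2 * T) * (1 + T ^ 2 / 2)) * M / |s|) :=
        mul_le_mul e3 hbd (norm_nonneg _) (by positivity)
    _ = _ := by field_simp

/-! ### A two-dimensional oscillatory integral -/

/-- The line `R ↦ R (c, d)` through the origin of the plane. -/
def ray (c d : ℝ) : ℝ →L[ℝ] ℝ × ℝ :=
  (ContinuousLinearMap.toSpanSingleton ℝ c).prod (ContinuousLinearMap.toSpanSingleton ℝ d)

theorem ray_apply (c d R : ℝ) : ray c d R = (R * c, R * d) := by simp [ray]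

theorem norm_ray_le {c d : ℝ} (hc : |c| ≤ 1) (hd : |d| ≤ 1) : ‖ray c d‖ ≤ 1 := by
  refine ContinuousLinearMap.opNorm_le_bound _ zero_le_one fun R => ?_
  rw [ray_apply, Prod.norm_def, one_mul]
  refine max_le ?_ ?_ <;> simp only [Real.norm_eq_abs, abs_mul]
  · exact mul_le_of_le_one_right (abs_nonneg _) hc
  · exact mul_le_of_le_one_right (abs_nonneg _) hd

theorem norm_iteratedFDeriv_comp_clm_le {E F V : Type*} [NormedAddCommGroup E] [NormedSpace ℝ E]
    [NormedAddCommGroup F] [NormedSpace ℝ F] [NormedAddCommGroup V] [NormedSpace ℝ V]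
    {Ψ : F → V} {N : ℕ∞ω} (hΨ : ContDiff ℝ N Ψ) (L : E →L[ℝ] F) {j : ℕ} (hj : j ≤ N) (x : E) :
    ‖iteratedFDeriv ℝ j (Ψ ∘ L) x‖ ≤ ‖iteratedFDeriv ℝ j Ψ (L x)‖ * ‖L‖ ^ j := by
  rw [L.iteratedFDeriv_comp_right hΨ x hj]
  refine (ContinuousMultilinearMap.norm_compContinuousLinearMap_le _ _).trans ?_
  simp

theorem hasDerivAt_iteratedDeriv {f : ℝ → ℂ} {N : ℕ∞ω} (hf : ContDiff ℝ N f) {j : ℕ} (hj : j < N)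
    (x : ℝ) : HasDerivAt (iteratedDeriv j f) (iteratedDeriv (j + 1) f x) x := by
  rw [iteratedDeriv_succ]
  exact (hf.differentiable_iteratedDeriv j hj x).hasDerivAt

/-- The even part of `Ψ` along a line through the origin: its value at `0` carries the leading
term, and there is no linear term. -/
theorem norm_integral_ray_sub_le {s κ M T : ℝ} (hκ : 1 ≤ κ) (hs : 1 ≤ |s|) (hT : 0 < T)
    {Ψ : ℝ × ℝ → ℂ} (hΨ : ContDiff ℝ 3 Ψ)
    (hM : ∀ j ≤ 3, ∀ v : ℝ × ℝ, ‖v‖ ≤ T → ‖iteratedFDeriv ℝ j Ψ v‖ ≤ M)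
    (hv : ∀ v : ℝ × ℝ, T ^ 2 ≤ v.1 ^ 2 + v.2 ^ 2 → Ψ v = 0) (θ : ℝ) :
    ‖(∫ R in Set.Ioi (0:ℝ), (R:ℂ) * ((Ψ (R * Real.cos θ, R * Real.sin θ)
          + Ψ (-(R * Real.cos θ), -(R * Real.sin θ))) / 2 * (sinKer s κ R : ℂ)))
        - Ψ 0 * ((Real.cos (s * Real.arcosh κ) / (s ^ 2 * κ) : ℝ) : ℂ)‖ ≤
      (T ^ 2 + (2 + 2 * T) * (1 + T ^ 2 / 2)) * M / |s| ^ 3 := by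
  set L := ray (Real.cos θ) (Real.sin θ) with hL
  set L' := ray (-Real.cos θ) (-Real.sin θ) with hL'
  have nL : ‖L‖ ≤ 1 := norm_ray_le (Real.abs_cos_le_one θ) (Real.abs_sin_le_one θ)
  have nL' : ‖L'‖ ≤ 1 := norm_ray_le (by rw [abs_neg]; exact Real.abs_cos_le_one θ)
    (by rw [abs_neg]; exact Real.abs_sin_le_one θ)
  have hLL' : ∀ R : ℝ, L' R = L (-R) := fun R => by
    rw [hL, hL', ray_apply, ray_apply]; ext <;> simp
  have cp : ContDiff ℝ 3 (Ψ ∘ L) := hΨ.comp L.contDiff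
  have cm : ContDiff ℝ 3 (Ψ ∘ L') := hΨ.comp L'.contDiff
  -- the derivatives of the even part of `Ψ` along the line
  set f : ℕ → ℝ → ℂ := fun j R =>
    (iteratedDeriv j (Ψ ∘ L) R + iteratedDeriv j (Ψ ∘ L') R) / 2 with hf
  have hd : ∀ j : ℕ, j < 3 → ∀ R, HasDerivAt (f j) (f (j + 1) R) R := by
    intro j hj R
    have hj' : ((j : ℕ) : ℕ∞ω) < 3 := by exact_mod_cast hj
    exact ((hasDerivAt_iteratedDeriv cp hj' R).add
      (hasDerivAt_iteratedDeriv cm hj' R)).div_const 2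
  have hb : ∀ j ≤ 3, ∀ R ∈ Set.Icc 0 T, ‖f j R‖ ≤ M := by
    intro j hj R hR
    have hj' : ((j : ℕ) : ℕ∞ω) ≤ 3 := by exact_mod_cast hj
    have key : ∀ A : ℝ →L[ℝ] ℝ × ℝ, ‖A‖ ≤ 1 → ‖iteratedDeriv j (Ψ ∘ A) R‖ ≤ M := by
      intro A hA
      rw [← norm_iteratedFDeriv_eq_norm_iteratedDeriv]
      refine (norm_iteratedFDeriv_comp_clm_le hΨ A hj' R).trans ?_
      have hAR : ‖A R‖ ≤ T := by
        refine (A.le_opNorm R).trans ?_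
        rw [Real.norm_eq_abs, abs_of_nonneg hR.1]
        exact (mul_le_of_le_one_left hR.1 hA).trans hR.2
      calc _ ≤ ‖iteratedFDeriv ℝ j Ψ (A R)‖ * 1 := by
            gcongr; exact pow_le_one₀ (norm_nonneg _) hA
        _ ≤ M := by rw [mul_one]; exact hM j hj _ hAR
    have k1 := key L nL
    have k2 := key L' nL'
    simp only [hf]
    rw [norm_div, Complex.norm_ofNat, div_le_iff₀ two_pos]
    linarith [norm_add_le (iteratedDeriv j (Ψ ∘ L) R) (iteratedDeriv j (Ψ ∘ L') R)]
  have hf10 : f 1 0 = 0 := by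
    simp only [hf, iteratedDeriv_one]
    have e : (Ψ ∘ L') = fun R => (Ψ ∘ L) (-R) := by
      funext R; simp only [Function.comp_apply, hLL']
    rw [e, deriv_comp_neg]
    simp
  have hfT : ∀ R, T ≤ R → f 0 R = 0 := by
    intro R hR
    have hRR : T ^ 2 ≤ R ^ 2 := pow_le_pow_left₀ hT.le hR 2
    have hcs := Real.cos_sq_add_sin_sq θ
    have key : R ^ 2 * (Real.cos θ ^ 2 + Real.sin θ ^ 2) = R ^ 2 := by rw [hcs, mul_one]
    simp only [hf, iteratedDeriv_zero, Function.comp_apply, hL, hL', ray_apply]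
    rw [hv _ (by simp only; nlinarith), hv _ (by simp only; nlinarith)]
    simp
  have main := norm_integral_mul_sinKer_sub_le (M := M) hκ hs hT (hd 0 (by norm_num))
    (hd 1 (by norm_num)) (hd 2 (by norm_num)) hf10 (hb 2 (by norm_num)) (hb 3 le_rfl) hfT
  have e0 : f 0 0 = Ψ 0 := by
    simp [hf, iteratedDeriv_zero]
  have e1 : ∀ R : ℝ, f 0 R = (Ψ (R * Real.cos θ, R * Real.sin θ)
          + Ψ (-(R * Real.cos θ), -(R * Real.sin θ))) / 2 := by
    intro R
    simp only [hf, iteratedDeriv_zero, Function.comp_apply, hL, hL', ray_apply, mul_neg]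
  rw [e0] at main
  simp only [e1] at main
  exact main

theorem norm_le_of_sq_add_sq_lt {v : ℝ × ℝ} {T : ℝ} (hT : 0 < T)
    (h : v.1 ^ 2 + v.2 ^ 2 < T ^ 2) : ‖v‖ ≤ T := by
  rw [Prod.norm_def]
  refine max_le ?_ ?_ <;> rw [Real.norm_eq_abs] <;> apply abs_le_of_sq_le_sq _ hT.le <;>
    nlinarith [sq_nonneg v.1, sq_nonneg v.2]

/-- Stationary phase for `∫ Ψ(v) sin (s r) / (s sinh r) dv` with `cosh r = κ (1 + |v|² / 2)`:
only the critical point `v = 0` contributes to order `s⁻²`. -/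
theorem norm_integral_plane_sub_le {s κ M T : ℝ} (hκ : 1 ≤ κ) (hs : 1 ≤ |s|) (hT : 0 < T)
    {Ψ : ℝ × ℝ → ℂ} (hΨ : ContDiff ℝ 3 Ψ)
    (hM : ∀ j ≤ 3, ∀ v : ℝ × ℝ, ‖v‖ ≤ T → ‖iteratedFDeriv ℝ j Ψ v‖ ≤ M)
    (hv : ∀ v : ℝ × ℝ, T ^ 2 ≤ v.1 ^ 2 + v.2 ^ 2 → Ψ v = 0) :
    ‖(∫ v : ℝ × ℝ, Ψ v * (sinKer s κ √(v.1 ^ 2 + v.2 ^ 2) : ℂ))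
        - 2 * Real.pi * (Ψ 0 * ((Real.cos (s * Real.arcosh κ) / (s ^ 2 * κ) : ℝ) : ℂ))‖ ≤
      (T ^ 2 + (2 + 2 * T) * (1 + T ^ 2 / 2)) * M / |s| ^ 3 * (2 * Real.pi) := by
  have hcs : HasCompactSupport Ψ := by
    refine HasCompactSupport.of_support_subset_isCompact (isCompact_closedBall 0 T) ?_
    intro v hvs
    rw [mem_closedBall_zero_iff]
    apply norm_le_of_sq_add_sq_lt hT
    by_contra hn
    exact hvs (hv v (not_lt.mp hn))
  have hΨi : Integrable Ψ := hΨ.continuous.integrable_of_hasCompactSupport hcs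
  have hmk : Measurable fun v : ℝ × ℝ => (sinKer s κ √(v.1 ^ 2 + v.2 ^ 2) : ℂ) :=
    Complex.measurable_ofReal.comp ((measurable_sinKer hκ).comp (by fun_prop))
  have hbk : ∀ v : ℝ × ℝ, ‖(sinKer s κ √(v.1 ^ 2 + v.2 ^ 2) : ℂ)‖ ≤ 1 := fun v => by
    rw [Complex.norm_real, Real.norm_eq_abs]; exact abs_sinKer_le hκ _
  set g : ℝ × ℝ → ℂ := fun v => Ψ v * (sinKer s κ √(v.1 ^ 2 + v.2 ^ 2) : ℂ) with hg
  have hgi : Integrable g := hΨi.mul_bdd hmk.aestronglyMeasurable (Filter.Eventually.of_forall hbk)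
  -- the kernel is even, so only the even part of `Ψ` matters
  set Φ : ℝ × ℝ → ℂ := fun v => (Ψ v + Ψ (-v)) / 2 with hΦ
  set G : ℝ × ℝ → ℂ := fun v => Φ v * (sinKer s κ √(v.1 ^ 2 + v.2 ^ 2) : ℂ) with hG
  have e1 : ∫ v, g v = ∫ v, G v := by
    have h2 : G = fun v => (g v + g (-v)) / 2 := by
      funext v
      simp only [hG, hg, hΦ, Prod.fst_neg, Prod.snd_neg, neg_sq]
      ring
    rw [h2, integral_div, integral_add hgi hgi.comp_neg, integral_neg_eq_self]
    ring
  have e2 : ∫ v, G v = ∫ p in polarCoord.target, p.1 • G (polarCoord.symm p) :=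
    (integral_comp_polarCoord_symm G).symm
  have e3 : ∀ p ∈ polarCoord.target, p.1 • G (polarCoord.symm p)
      = (p.1:ℂ) * ((Ψ (p.1 * Real.cos p.2, p.1 * Real.sin p.2)
          + Ψ (-(p.1 * Real.cos p.2), -(p.1 * Real.sin p.2))) / 2 * (sinKer s κ p.1 : ℂ)) := by
    intro p hp
    have hp1 : 0 < p.1 := by
      have := hp.1
      simpa using this
    have hsq : √((p.1 * Real.cos p.2) ^ 2 + (p.1 * Real.sin p.2) ^ 2) = p.1 := by
      rw [show (p.1 * Real.cos p.2) ^ 2 + (p.1 * Real.sin p.2) ^ 2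
        = p.1 ^ 2 * (Real.cos p.2 ^ 2 + Real.sin p.2 ^ 2) by ring, Real.cos_sq_add_sin_sq, mul_one,
        Real.sqrt_sq hp1.le]
    simp only [hG, hΦ, polarCoord_symm_apply, hsq, Complex.real_smul, Prod.neg_mk]
  set P : ℝ × ℝ → ℂ := fun p => (p.1:ℂ) * ((Ψ (p.1 * Real.cos p.2, p.1 * Real.sin p.2)
          + Ψ (-(p.1 * Real.cos p.2), -(p.1 * Real.sin p.2))) / 2 * (sinKer s κ p.1 : ℂ)) with hP
  have hPi : IntegrableOn P (Set.Ioi 0 ×ˢ Set.Ioo (-Real.pi) Real.pi) := by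
    have hsub : IntegrableOn P (Set.Ioc 0 T ×ˢ Set.Ioo (-Real.pi) Real.pi) := by
      have hc := hΨ.continuous
      have h1 : IntegrableOn (fun p : ℝ × ℝ => (p.1:ℂ) * ((Ψ (p.1 * Real.cos p.2, p.1 * Real.sin p.2)
          + Ψ (-(p.1 * Real.cos p.2), -(p.1 * Real.sin p.2))) / 2))
          (Set.Ioc 0 T ×ˢ Set.Ioo (-Real.pi) Real.pi) := by
        refine IntegrableOn.mono_set (t := Set.Icc 0 T ×ˢ Set.Icc (-Real.pi) Real.pi) ?_
          (Set.prod_mono Set.Ioc_subset_Icc_self Set.Ioo_subset_Icc_self)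
        exact ContinuousOn.integrableOn_compact (isCompact_Icc.prod isCompact_Icc)
          (Continuous.continuousOn (by fun_prop))
      have h2 : Measurable fun p : ℝ × ℝ => (sinKer s κ p.1 : ℂ) :=
        Complex.measurable_ofReal.comp ((measurable_sinKer hκ).comp measurable_fst)
      have := Integrable.mul_bdd (c := 1) h1 h2.aestronglyMeasurable
        (Filter.Eventually.of_forall fun p => by
          rw [Complex.norm_real, Real.norm_eq_abs]; exact abs_sinKer_le hκ _)
      refine this.congr (Filter.Eventually.of_forall fun p => ?_)
      simp only [hP]; ring
    refine hsub.of_forall_sdiff_eq_zero (measurableSet_Ioi.prod measurableSet_Ioo) ?_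
    intro p hp
    have hp1 : 0 < p.1 := hp.1.1
    have hpT : T ≤ p.1 := by
      by_contra hlt
      exact hp.2 ⟨⟨hp1, (not_le.mp hlt).le⟩, hp.1.2⟩
    have hRR : T ^ 2 ≤ p.1 ^ 2 := pow_le_pow_left₀ hT.le hpT 2
    have key : p.1 ^ 2 * (Real.cos p.2 ^ 2 + Real.sin p.2 ^ 2) = p.1 ^ 2 := by
      rw [Real.cos_sq_add_sin_sq, mul_one]
    simp only [hP]
    rw [hv _ (by simp only; nlinarith), hv _ (by simp only; nlinarith)]
    simp
  have e4 : ∫ v, g v = ∫ θ in Set.Ioo (-Real.pi) Real.pi, ∫ R in Set.Ioi (0:ℝ), P (R, θ) := by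
    rw [e1, e2, setIntegral_congr_fun (polarCoord.open_target.measurableSet) e3]
    have ht : polarCoord.target = Set.Ioi (0:ℝ) ×ˢ Set.Ioo (-Real.pi) Real.pi := rfl
    rw [ht]
    rw [Measure.volume_eq_prod] at hPi ⊢
    rw [← Measure.prod_restrict]
    refine integral_prod_symm _ ?_
    rw [Measure.prod_restrict]
    exact hPi
  set B := Ψ 0 * ((Real.cos (s * Real.arcosh κ) / (s ^ 2 * κ) : ℝ) : ℂ)
  have hvol : (volume : Measure ℝ).real (Set.Ioo (-Real.pi) Real.pi) = 2 * Real.pi := by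
    rw [Measure.real, Real.volume_Ioo, ENNReal.toReal_ofReal (by linarith [Real.pi_pos])]
    ring
  have e5 : ∫ θ in Set.Ioo (-Real.pi) Real.pi, B = 2 * Real.pi * B := by
    rw [setIntegral_const, hvol, Complex.real_smul]
    push_cast
    rfl
  have hPi2 : IntegrableOn (fun θ => ∫ R in Set.Ioi (0:ℝ), P (R, θ))
      (Set.Ioo (-Real.pi) Real.pi) := by
    rw [Measure.volume_eq_prod, IntegrableOn, ← Measure.prod_restrict] at hPi
    exact hPi.integral_prod_right
  have hBi : IntegrableOn (fun _ : ℝ => B) (Set.Ioo (-Real.pi) Real.pi) :=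
    integrableOn_const (by rw [Real.volume_Ioo]; exact ENNReal.ofReal_ne_top)
  rw [e4, ← e5, ← integral_sub hPi2 hBi, ← hvol]
  refine norm_setIntegral_le_of_norm_le_const (by rw [Real.volume_Ioo]; exact ENNReal.ofReal_lt_top)
    fun θ _ => ?_
  exact norm_integral_ray_sub_le hκ hs hT hΨ hM hv θ

/-! ### Coordinates on the plane adapted to the distance from a point -/

/-- The coordinates `v` on `ℍ²` centred at `(0, 1)`, in which `cosh dist(v, (0,1)) = 1 + |v|²/2`
and which are written as `(x, t)`. -/
def planeCoord (v : ℝ × ℝ) : ℝ × ℝ :=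
  (v.2 * Real.exp (Real.arsinh (v.1 / 2)), 2 * Real.arsinh (v.1 / 2))

/-- The isometry of `ℍ²` that takes `(0, 1)` to the point with coordinates `c`. -/
def affineMove (c w : ℝ × ℝ) : ℝ × ℝ := (c.1 + Real.exp c.2 * w.1, c.2 + w.2)

/-- The density of the hyperbolic area in the coordinates `planeCoord`. -/
def planeDensity (v : ℝ × ℝ) : ℝ :=
  Real.exp (-Real.arsinh (v.1 / 2)) / Real.cosh (Real.arsinh (v.1 / 2))

theorem contDiff_planeCoord : ContDiff ℝ ∞ planeCoord := by
  have : ContDiff ℝ ∞ fun v : ℝ × ℝ => Real.arsinh (v.1 / 2) :=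
    Real.contDiff_arsinh.comp (contDiff_fst.div_const 2)
  exact (contDiff_snd.mul this.exp).prodMk (contDiff_const.mul this)

theorem contDiff_planeDensity : ContDiff ℝ ∞ planeDensity := by
  have : ContDiff ℝ ∞ fun v : ℝ × ℝ => Real.arsinh (v.1 / 2) :=
    Real.contDiff_arsinh.comp (contDiff_fst.div_const 2)
  exact this.neg.exp.div this.cosh fun v => (Real.cosh_pos _).ne'

/-- The coordinates `planeCoord`, centred at the point with coordinates `c`. -/
def moved (c v : ℝ × ℝ) : ℝ × ℝ := affineMove c (planeCoord v)

theorem moved_injective (c : ℝ × ℝ) : Function.Injective (moved c) := by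
  intro v w h
  have h1 := congrArg Prod.fst h
  have h2 := congrArg Prod.snd h
  simp only [moved, affineMove, planeCoord] at h1 h2
  have h3 : v.1 = w.1 := by
    have := Real.arsinh_injective (by linarith : Real.arsinh (v.1 / 2) = Real.arsinh (w.1 / 2))
    linarith
  rw [h3] at h1
  have h4 : v.2 = w.2 := by
    have h5 := mul_left_cancel₀ (Real.exp_pos c.2).ne' (add_left_cancel h1)
    exact mul_right_cancel₀ (Real.exp_pos _).ne' h5
  exact Prod.ext h3 h4

theorem moved_surjective (c : ℝ × ℝ) : Function.Surjective (moved c) := by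
  intro w
  refine ⟨(2 * Real.sinh ((w.2 - c.2) / 2),
    (w.1 - c.1) * Real.exp (-c.2) * Real.exp (-((w.2 - c.2) / 2))), ?_⟩
  have : 2 * Real.sinh ((w.2 - c.2) / 2) / 2 = Real.sinh ((w.2 - c.2) / 2) := by ring
  simp only [moved, affineMove, planeCoord, this, Real.arsinh_sinh]
  ext
  · simp only [Real.exp_neg]
    field_simp
    ring
  · simp only; ring

theorem hasFDerivAt_moved (c v : ℝ × ℝ) :
    HasFDerivAt (moved c) ((Matrix.toLin (.finTwoProd ℝ) (.finTwoProd ℝ)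
      !![Real.exp c.2 * (v.2 * (Real.exp (Real.arsinh (v.1 / 2)) *
          ((√(1 + (v.1 / 2) ^ 2))⁻¹ * (1 / 2)))),
        Real.exp c.2 * Real.exp (Real.arsinh (v.1 / 2));
        2 * ((√(1 + (v.1 / 2) ^ 2))⁻¹ * (1 / 2)), 0]).toContinuousLinearMap) v := by
  rw [Matrix.toLin_finTwoProd_toContinuousLinearMap]
  have h1 : HasFDerivAt (fun v : ℝ × ℝ => v.1) (ContinuousLinearMap.fst ℝ ℝ ℝ) v := hasFDerivAt_fst
  have h2 : HasFDerivAt (fun v : ℝ × ℝ => v.2) (ContinuousLinearMap.snd ℝ ℝ ℝ) v := hasFDerivAt_snd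
  have h3 : HasFDerivAt (fun v : ℝ × ℝ => Real.arsinh (v.1 / 2))
      (((√(1 + (v.1 / 2) ^ 2))⁻¹ * (1 / 2)) • ContinuousLinearMap.fst ℝ ℝ ℝ) v := by
    have := (Real.hasDerivAt_arsinh (v.1 / 2)).comp v.1 ((hasDerivAt_id v.1).div_const 2)
    exact this.comp_hasFDerivAt v h1
  have h4 := ((h2.mul h3.exp).const_mul (Real.exp c.2)).const_add c.1
  have h5 := (h3.const_mul 2).const_add c.2
  refine (h4.prodMk h5).congr_fderiv ?_
  ext <;> simp

theorem det_moved (c v : ℝ × ℝ) :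
    |((Matrix.toLin (.finTwoProd ℝ) (.finTwoProd ℝ)
      !![Real.exp c.2 * (v.2 * (Real.exp (Real.arsinh (v.1 / 2)) *
          ((√(1 + (v.1 / 2) ^ 2))⁻¹ * (1 / 2)))),
        Real.exp c.2 * Real.exp (Real.arsinh (v.1 / 2));
        2 * ((√(1 + (v.1 / 2) ^ 2))⁻¹ * (1 / 2)), 0]).toContinuousLinearMap).det|
      = planeDensity v * Real.exp (moved c v).2 := by
  conv_lhs =>
    rw [LinearMap.det_toContinuousLinearMap, LinearMap.det_toLin, Matrix.det_fin_two_of, mul_zero,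
      zero_sub, abs_neg]
  rw [abs_of_nonneg (by positivity)]
  simp only [planeDensity, moved, affineMove, planeCoord, Real.cosh_arsinh]
  rw [Real.exp_add, two_mul (Real.arsinh _), Real.exp_add, Real.exp_neg]
  field_simp

/-- The change of variables `q = moved c v` for the hyperbolic area `e^{-t} dx dt`. -/
theorem integral_eq_integral_moved (c : ℝ × ℝ) (F : ℝ × ℝ → ℂ) :
    ∫ q : ℝ × ℝ, F q * (Real.exp (-q.2) : ℂ)
      = ∫ v : ℝ × ℝ, F (moved c v) * (planeDensity v : ℂ) := by
  have h := integral_image_eq_integral_abs_det_fderiv_smul volume MeasurableSet.univ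
    (fun v _ => (hasFDerivAt_moved c v).hasFDerivWithinAt) (moved_injective c).injOn
    (fun q : ℝ × ℝ => F q * (Real.exp (-q.2) : ℂ))
  rw [Set.image_univ, (moved_surjective c).range_eq, setIntegral_univ, setIntegral_univ] at h
  rw [h]
  refine integral_congr_ae (Filter.Eventually.of_forall fun v => ?_)
  simp only []
  rw [det_moved, Complex.real_smul, Real.exp_neg]
  push_cast
  have : Complex.exp ((moved c v).2 : ℂ) ≠ 0 := Complex.exp_ne_zero _
  field_simp

/-- Uniform bounds for the derivatives of a pull-back under the coordinates `moved c`, as `c`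
stays bounded. -/
theorem exists_bound_iteratedFDeriv_moved (R₁ T : ℝ) : ∃ C : ℝ, 0 ≤ C ∧
    ∀ b : ℝ × ℝ → ℂ, ContDiff ℝ ∞ b → ∀ M : ℝ,
      (∀ j ≤ 3, ∀ x, ‖iteratedFDeriv ℝ j b x‖ ≤ M) → ∀ c : ℝ × ℝ, c.2 ≤ R₁ →
      ∀ j ≤ 3, ∀ v : ℝ × ℝ, ‖v‖ ≤ T →
        ‖iteratedFDeriv ℝ j (fun v => b (moved c v) * (planeDensity v : ℂ)) v‖ ≤ C * M := by
  have hcomp : IsCompact (Metric.closedBall (0 : ℝ × ℝ) T) := isCompact_closedBall 0 T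
  have hω : ContDiff ℝ ∞ fun v : ℝ × ℝ => (planeDensity v : ℂ) :=
    Complex.ofRealCLM.contDiff.comp contDiff_planeDensity
  have hbd : ∀ {V : Type} [NormedAddCommGroup V] [NormedSpace ℝ V] (f : ℝ × ℝ → V),
      ContDiff ℝ ∞ f → ∃ D : ℝ, 1 ≤ D ∧ ∀ j ≤ 3, ∀ v : ℝ × ℝ, ‖v‖ ≤ T →
        ‖iteratedFDeriv ℝ j f v‖ ≤ D := by
    intro V _ _ f hf
    have h1 : ∀ j : ℕ, ∃ D : ℝ, ∀ v : ℝ × ℝ, ‖v‖ ≤ T → ‖iteratedFDeriv ℝ j f v‖ ≤ D := by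
      intro j
      obtain ⟨D, hD⟩ := hcomp.exists_bound_of_continuousOn
        (hf.continuous_iteratedFDeriv (m := j) (by exact_mod_cast le_top)).continuousOn
      exact ⟨D, fun v hv => hD v (mem_closedBall_zero_iff.mpr hv)⟩
    choose D hD using h1
    refine ⟨1 + ∑ j ∈ Finset.range 4, |D j|, ?_, fun j hj v hv => ?_⟩
    · exact le_add_of_nonneg_right (Finset.sum_nonneg fun j _ => abs_nonneg _)
    · have := Finset.single_le_sum (f := fun j => |D j|) (fun j _ => abs_nonneg _)
        (Finset.mem_range.mpr (by omega : j < 4))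
      linarith [hD j v hv, le_abs_self (D j)]
  obtain ⟨D, hD1, hD⟩ := hbd _ contDiff_planeCoord
  obtain ⟨W, hW1, hW⟩ := hbd _ hω
  set E := Real.exp |R₁|
  have hE1 : 1 ≤ E := Real.one_le_exp (abs_nonneg _)
  refine ⟨8 * (6 * (E ^ 3) * D ^ 3) * W, by positivity, ?_⟩
  intro b hb M hM c hc j hj v hv
  have hM0 : 0 ≤ M := (norm_nonneg _).trans (hM 0 (by norm_num) 0)
  -- the affine map `affineMove c` only rescales the derivatives
  set L : ℝ × ℝ →L[ℝ] ℝ × ℝ :=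
    (Real.exp c.2 • ContinuousLinearMap.fst ℝ ℝ ℝ).prod (ContinuousLinearMap.snd ℝ ℝ ℝ) with hL
  have hLn : ‖L‖ ≤ E := by
    refine ContinuousLinearMap.opNorm_le_bound _ (by positivity) fun w => ?_
    have hw1 : |w.1| ≤ ‖w‖ := norm_fst_le w
    have hw2 : |w.2| ≤ ‖w‖ := norm_snd_le w
    have hcE : Real.exp c.2 ≤ E := Real.exp_le_exp.mpr (hc.trans (le_abs_self _))
    rw [show L w = (Real.exp c.2 * w.1, w.2) by simp [hL], Prod.norm_def]
    refine max_le ?_ ?_ <;> simp only [Real.norm_eq_abs, abs_mul, abs_of_pos (Real.exp_pos _)]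
    · gcongr
    · exact hw2.trans (le_mul_of_one_le_left (norm_nonneg _) hE1)
  set bc : ℝ × ℝ → ℂ := fun w => b (c + w) with hbc
  have hbcs : ContDiff ℝ ∞ bc := hb.comp (contDiff_const.add contDiff_id)
  have e1 : (fun v => b (moved c v)) = (bc ∘ L) ∘ planeCoord := by
    funext w
    simp only [hbc, hL, Function.comp_apply, moved, affineMove]
    congr 1
  have h2 : ∀ i ≤ 3, ∀ w, ‖iteratedFDeriv ℝ i (bc ∘ L) w‖ ≤ E ^ 3 * M := by
    intro i hi w
    have hi' : ((i : ℕ) : ℕ∞ω) ≤ ∞ := by exact_mod_cast le_top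
    refine (norm_iteratedFDeriv_comp_clm_le hbcs L hi' w).trans ?_
    rw [hbc, iteratedFDeriv_comp_add_left, mul_comm]
    have h3 : ‖L‖ ^ i ≤ E ^ 3 :=
      (pow_le_pow_left₀ (norm_nonneg _) hLn i).trans (pow_le_pow_right₀ hE1 hi)
    exact mul_le_mul h3 (hM i hi _) (norm_nonneg _) (by positivity)
  have hcb : ContDiff ℝ ∞ (bc ∘ L) := hbcs.comp L.contDiff
  have h3 : ∀ i ≤ 3, ‖iteratedFDeriv ℝ i (fun v => b (moved c v)) v‖ ≤ 6 * (E ^ 3 * M) * D ^ 3 := by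
    intro i hi
    rw [e1]
    have hi' : ((i : ℕ) : ℕ∞ω) ≤ ∞ := by exact_mod_cast le_top
    have := norm_iteratedFDeriv_comp_le hcb contDiff_planeCoord hi' v (C := E ^ 3 * M) (D := D)
      (fun k hk => h2 k (hk.trans hi) _) (fun k hk1 hk => (hD k (hk.trans hi) v hv).trans
        (le_self_pow₀ hD1 (by omega)))
    refine this.trans ?_
    have hf : ((Nat.factorial i : ℕ) : ℝ) ≤ 6 := by
      have : Nat.factorial i ≤ Nat.factorial 3 := Nat.factorial_le hi
      exact_mod_cast this
    have hp : D ^ i ≤ D ^ 3 := pow_le_pow_right₀ hD1 hi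
    gcongr
  have hj' : ((j : ℕ) : ℕ∞ω) ≤ ∞ := by exact_mod_cast le_top
  have hcc : ContDiff ℝ ∞ (fun v => b (moved c v)) := by
    rw [e1]; exact hcb.comp contDiff_planeCoord
  refine (norm_iteratedFDeriv_mul_le hcc hω v hj').trans ?_
  calc _ ≤ ∑ i ∈ Finset.range (j + 1), (j.choose i : ℝ) * ((6 * (E ^ 3 * M) * D ^ 3) * W) := by
        refine Finset.sum_le_sum fun i hi => ?_
        have hi' : i ≤ j := Nat.lt_succ_iff.mp (Finset.mem_range.mp hi)
        rw [mul_assoc]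
        refine mul_le_mul_of_nonneg_left ?_ (Nat.cast_nonneg _)
        exact mul_le_mul (h3 i (hi'.trans hj)) (hW (j - i) (by omega) v hv) (norm_nonneg _)
          (by positivity)
    _ = (2:ℝ) ^ j * ((6 * (E ^ 3 * M) * D ^ 3) * W) := by
        rw [← Finset.sum_mul]
        congr 1
        exact_mod_cast Nat.sum_range_choose j
    _ ≤ 8 * ((6 * (E ^ 3 * M) * D ^ 3) * W) := by
        have : (2:ℝ) ^ j ≤ 8 := by
          calc (2:ℝ) ^ j ≤ 2 ^ 3 := pow_le_pow_right₀ (by norm_num) hj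
            _ = 8 := by norm_num
        gcongr
    _ = _ := by ring

/-- The asymptotics of the integral over one copy of `ℍ²`, uniformly in the nearest point `c`. -/
theorem exists_bound_integral_sinKer (R R₁ : ℝ) : ∃ C : ℝ, 0 ≤ C ∧
    ∀ b : ℝ × ℝ → ℂ, ContDiff ℝ ∞ b → (∀ q, b q ≠ 0 → |q.1| ≤ R ∧ |q.2| ≤ R) → ∀ M : ℝ,
      (∀ j ≤ 3, ∀ x, ‖iteratedFDeriv ℝ j b x‖ ≤ M) → ∀ c : ℝ × ℝ, |c.1| ≤ R₁ → |c.2| ≤ R₁ →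
      ∀ κ : ℝ, 1 ≤ κ → ∀ s : ℝ, 1 ≤ |s| →
      ‖(∫ v : ℝ × ℝ, b (moved c v) * (planeDensity v : ℂ) *
          (sinKer s κ √(v.1 ^ 2 + v.2 ^ 2) : ℂ))
        - 2 * Real.pi * (b c * ((Real.cos (s * Real.arcosh κ) / (s ^ 2 * κ) : ℝ) : ℂ))‖
        ≤ C * M / |s| ^ 3 := by
  set A := 2 * Real.sinh (|R| + |R₁|) with hA
  set B := (|R| + |R₁|) * Real.exp |R₁| * Real.exp (|R| + |R₁|) with hB
  have hA0 : 0 ≤ A := by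
    have := Real.sinh_nonneg_iff.mpr (add_nonneg (abs_nonneg R) (abs_nonneg R₁))
    positivity
  have hB0 : 0 ≤ B := by positivity
  set T := A + B + 1
  have hT0 : 0 < T := by positivity
  obtain ⟨C, hC0, hC⟩ := exists_bound_iteratedFDeriv_moved R₁ T
  refine ⟨(T ^ 2 + (2 + 2 * T) * (1 + T ^ 2 / 2)) * C * (2 * Real.pi), by positivity, ?_⟩
  intro b hb hsupp M hM c hc1 hc2 κ hκ s hs
  have hmov : ContDiff ℝ ∞ (moved c) := by
    have := contDiff_planeCoord
    exact (contDiff_const.add (contDiff_const.mul this.fst)).prodMk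
      (contDiff_const.add this.snd)
  have hΨ : ContDiff ℝ ∞ fun v => b (moved c v) * (planeDensity v : ℂ) :=
    (hb.comp hmov).mul (Complex.ofRealCLM.contDiff.comp contDiff_planeDensity)
  have hR0 : 0 ≤ |R| := abs_nonneg _
  have hR10 : 0 ≤ |R₁| := abs_nonneg _
  -- `T` is chosen such that `moved c v` leaves the support of `b` for `|v| ≥ T`
  have hvan : ∀ v : ℝ × ℝ, T ^ 2 ≤ v.1 ^ 2 + v.2 ^ 2 →
      b (moved c v) * (planeDensity v : ℂ) = 0 := by
    intro v hv
    by_contra hne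
    obtain ⟨h1, h2⟩ := hsupp _ (left_ne_zero_of_mul hne)
    simp only [moved, affineMove, planeCoord] at h1 h2
    set τ := Real.arsinh (v.1 / 2) with hτ
    have hv1 : v.1 = 2 * Real.sinh τ := by rw [hτ, Real.sinh_arsinh]; ring
    have hRR := le_abs_self R
    have hRR1 := le_abs_self R₁
    have hτb : |τ| ≤ |R| + |R₁| := by
      have e : 2 * τ = (c.2 + 2 * τ) - c.2 := by ring
      have h3 : |2 * τ| ≤ |R| + |R₁| := by
        rw [e]; exact (abs_sub _ _).trans (by linarith)
      rw [abs_mul, abs_two] at h3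
      linarith [abs_nonneg τ]
    have k1 : |v.1| ≤ A := by
      rw [hv1, abs_mul, abs_two, Real.abs_sinh, hA]
      have := Real.sinh_le_sinh.mpr hτb
      linarith
    have k2 : |v.2| ≤ B := by
      have e : v.2 = ((c.1 + Real.exp c.2 * (v.2 * Real.exp τ)) - c.1) * Real.exp (-c.2)
          * Real.exp (-τ) := by
        rw [Real.exp_neg, Real.exp_neg]; field_simp; ring
      rw [e, abs_mul, abs_mul, abs_of_pos (Real.exp_pos _), abs_of_pos (Real.exp_pos _), hB]
      have l1 : |(c.1 + Real.exp c.2 * (v.2 * Real.exp τ)) - c.1| ≤ |R| + |R₁| :=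
        (abs_sub _ _).trans (by linarith)
      have l2 : Real.exp (-c.2) ≤ Real.exp |R₁| :=
        Real.exp_le_exp.mpr (by linarith [neg_abs_le c.2])
      have l3 : Real.exp (-τ) ≤ Real.exp (|R| + |R₁|) :=
        Real.exp_le_exp.mpr (by linarith [neg_abs_le τ])
      gcongr
    have k3 : v.1 ^ 2 ≤ A ^ 2 := sq_le_sq' (by linarith [neg_abs_le v.1]) (by linarith [le_abs_self v.1])
    have k4 : v.2 ^ 2 ≤ B ^ 2 := sq_le_sq' (by linarith [neg_abs_le v.2]) (by linarith [le_abs_self v.2])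
    nlinarith [mul_nonneg hA0 hB0]
  have main := norm_integral_plane_sub_le (M := C * M) hκ hs hT0
    (hΨ.of_le (WithTop.coe_le_coe.mpr (le_top (a := ((3 : ℕ) : ℕ∞))))) (hC b hb M hM c ((le_abs_self _).trans hc2)) hvan
  have e0 : b (moved c 0) * (planeDensity 0 : ℂ) = b c := by
    simp [moved, affineMove, planeCoord, planeDensity]
  rw [e0] at main
  refine main.trans (le_of_eq ?_)
  ring

/-! ### The relative position of two points of the planes `ℍ²` and `g ℍ²` -/

/-- The functions `A e^t + (A x² + B x + C) e^{-t}` on `ℍ²`, for `v = (A, B, C)`: the restrictions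
of linear forms to the hyperboloid model. -/
def quad (v : ℝ × ℝ × ℝ) (p : ℝ × ℝ) : ℝ :=
  v.1 * Real.exp p.2 + (v.1 * p.1 ^ 2 + v.2.1 * p.1 + v.2.2) * Real.exp (-p.2)

/-- Coefficients of the squared norm of the first column of `a(-t) n(-x) g`. -/
def coefP (g : G) : ℝ × ℝ × ℝ :=
  (‖g 1 0‖ ^ 2, -2 * (g 0 0 * conj (g 1 0)).re, ‖g 0 0‖ ^ 2)

/-- Coefficients of the real part of the inner product of the columns of `a(-t) n(-x) g`. -/
def coefQ (g : G) : ℝ × ℝ × ℝ :=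
  ((g 1 0 * conj (g 1 1)).re, -(g 0 0 * conj (g 1 1) + g 1 0 * conj (g 0 1)).re,
    (g 0 0 * conj (g 0 1)).re)

/-- Coefficients of the imaginary part of the inner product of the columns of `a(-t) n(-x) g`. -/
def coefL (g : G) : ℝ × ℝ × ℝ := (qA g, qB g, qC g)

/-- Coefficients of the squared norm of the second column of `a(-t) n(-x) g`. -/
def coefS (g : G) : ℝ × ℝ × ℝ :=
  (‖g 1 1‖ ^ 2, -2 * (g 0 1 * conj (g 1 1)).re, ‖g 0 1‖ ^ 2)

theorem norm_sq_eq_re_im (z : ℂ) : ‖z‖ ^ 2 = z.re ^ 2 + z.im ^ 2 := by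
  rw [← Complex.normSq_eq_norm_sq, Complex.normSq_apply]; ring

/-- The Lagrange identity for the two columns of a matrix of determinant one. -/
theorem quad_mul_quad (g : G) (p : ℝ × ℝ) :
    quad (coefP g) p * quad (coefS g) p
      = quad (coefQ g) p ^ 2 + (1 + quad (coefL g) p ^ 2) := by
  have h1 := det_re g
  have h2 := det_im g
  have hE : Real.exp p.2 * Real.exp (-p.2) = 1 := by rw [← Real.exp_add]; simp
  simp only [quad, coefP, coefQ, coefS, coefL, qA, qB, qC, norm_sq_eq_re_im, Complex.add_re,
    Complex.add_im, Complex.mul_re, Complex.mul_im, Complex.conj_re, Complex.conj_im]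
  generalize (g 0 0).re = a1 at *
  generalize (g 0 0).im = a2 at *
  generalize (g 0 1).re = b1 at *
  generalize (g 0 1).im = b2 at *
  generalize (g 1 0).re = c1 at *
  generalize (g 1 0).im = c2 at *
  generalize (g 1 1).re = d1 at *
  generalize (g 1 1).im = d2 at *
  generalize Real.exp p.2 = E at *
  generalize Real.exp (-p.2) = F at *
  linear_combination ((a1 * d1 - a2 * d2 - (b1 * c1 - b2 * c2)) ^ 2
    + (a1 * d2 + a2 * d1 - (b1 * c2 + b2 * c1)) ^ 2) * hE
    + ((a1 * d1 - a2 * d2 - (b1 * c1 - b2 * c2)) + 1) * h1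
    + (a1 * d2 + a2 * d1 - (b1 * c2 + b2 * c1)) * h2

theorem quad_coefP_pos (g : G) (p : ℝ × ℝ) : 0 < quad (coefP g) p := by
  have h := quad_mul_quad g p
  have h0 : 0 ≤ quad (coefP g) p := by
    have e : quad (coefP g) p = ‖g 1 0‖ ^ 2 * Real.exp p.2
        + ‖g 0 0 - p.1 * g 1 0‖ ^ 2 * Real.exp (-p.2) := by
      simp only [quad, coefP, norm_sq_eq_re_im, Complex.sub_re, Complex.sub_im, Complex.mul_re,
        Complex.mul_im, Complex.conj_re, Complex.conj_im, Complex.ofReal_re, Complex.ofReal_im]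
      ring
    rw [e]; positivity
  refine h0.lt_of_ne fun h1 => ?_
  rw [← h1, zero_mul] at h
  nlinarith [sq_nonneg (quad (coefQ g) p), sq_nonneg (quad (coefL g) p)]

theorem ch_mid_eq (p q : ℝ × ℝ) (g : G) : 2 * ch (mid p q g) = quad (coefP g) p * Real.exp q.2
    + (quad (coefP g) p * q.1 ^ 2 + 2 * quad (coefQ g) p * q.1 + quad (coefS g) p)
      * Real.exp (-q.2) := by
  have e1 : ∀ j, mid p q g 0 j = (Real.exp (-p.2 / 2) : ℂ) *
      ((g 0 0 - p.1 * g 1 0) * (n (q.1 : ℂ) * a q.2) 0 j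
        + (g 0 1 - p.1 * g 1 1) * (n (q.1 : ℂ) * a q.2) 1 j) := by
    intro j
    simp only [mid, mul_assoc, mul_entry]
    simp [a, n]
    ring
  have e2 : ∀ j, mid p q g 1 j = (Real.exp (p.2 / 2) : ℂ) *
      (g 1 0 * (n (q.1 : ℂ) * a q.2) 0 j + g 1 1 * (n (q.1 : ℂ) * a q.2) 1 j) := by
    intro j
    simp only [mid, mul_assoc, mul_entry]
    simp [a, n]
  have n1 : (n (q.1 : ℂ) * a q.2) 0 0 = (Real.exp (q.2 / 2) : ℂ) := by
    rw [mul_entry]; simp [a, n]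
  have n2 : (n (q.1 : ℂ) * a q.2) 0 1 = q.1 * (Real.exp (-q.2 / 2) : ℂ) := by
    rw [mul_entry]; simp [a, n]
  have n3 : (n (q.1 : ℂ) * a q.2) 1 0 = 0 := by
    rw [mul_entry]; simp [a, n]
  have n4 : (n (q.1 : ℂ) * a q.2) 1 1 = (Real.exp (-q.2 / 2) : ℂ) := by
    rw [mul_entry]; simp [a, n]
  have hx : ∀ t : ℝ, Real.exp (t / 2) ^ 2 = Real.exp t := fun t => by
    rw [← Real.exp_nat_mul]; congr 1; push_cast; ring
  have x1 := hx p.2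
  have x2 := hx (-p.2)
  have x3 := hx q.2
  have x4 := hx (-q.2)
  simp only [ch, e1, e2, n1, n2, n3, n4]
  simp only [quad, coefP, coefQ, coefS, norm_sq_eq_re_im, Complex.add_re,
    Complex.add_im, Complex.mul_re, Complex.mul_im, Complex.conj_re, Complex.conj_im,
    Complex.sub_re, Complex.sub_im, Complex.ofReal_re, Complex.ofReal_im, Complex.zero_re,
    Complex.zero_im]
  rw [← x1, ← x2, ← x3, ← x4]
  ring

/-- The coordinates of the point of `ℍ²` whose image under `g` is nearest to the point with
coordinates `p`, as a function of the coefficients `coefP`, `coefQ`, `coefL`. -/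
def footOf (w : (ℝ × ℝ × ℝ) × (ℝ × ℝ × ℝ) × (ℝ × ℝ × ℝ)) (p : ℝ × ℝ) : ℝ × ℝ :=
  (-quad w.2.1 p / quad w.1 p, Real.log (√(1 + quad w.2.2 p ^ 2) / quad w.1 p))

/-- All coefficients of `g` together. -/
def coefs (g : G) : (ℝ × ℝ × ℝ) × (ℝ × ℝ × ℝ) × (ℝ × ℝ × ℝ) := (coefP g, coefQ g, coefL g)

/-- The coordinates of the foot of the perpendicular from `p` to `g ℍ²`, pulled back by `g`. -/
def foot (g : G) (p : ℝ × ℝ) : ℝ × ℝ := footOf (coefs g) p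

/-- The hyperbolic cosine of the distance from the point `p` of `ℍ²` to the plane `g ℍ²`. -/
def kap (g : G) (p : ℝ × ℝ) : ℝ := √(1 + quad (coefL g) p ^ 2)

theorem one_le_kap (g : G) (p : ℝ × ℝ) : 1 ≤ kap g p := by
  rw [kap, Real.one_le_sqrt]; nlinarith [sq_nonneg (quad (coefL g) p)]

/-- The hyperbolic Pythagorean theorem: the distance of `p` to a point of `g ℍ²` in terms of the
distance to the foot of the perpendicular. -/
theorem ch_mid_moved (g : G) (p v : ℝ × ℝ) :
    ch (mid p (moved (foot g p) v) g) = kap g p * (1 + √(v.1 ^ 2 + v.2 ^ 2) ^ 2 / 2) := by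
  have hP := quad_coefP_pos g p
  have hk0 : 0 < kap g p := by linarith [one_le_kap g p]
  have hk2 : kap g p ^ 2 = 1 + quad (coefL g) p ^ 2 := by
    rw [kap, Real.sq_sqrt (by positivity)]
  have h := ch_mid_eq p (moved (foot g p) v) g
  have hPS := quad_mul_quad g p
  rw [← hk2] at hPS
  have ht0 : Real.exp (foot g p).2 = kap g p / quad (coefP g) p := by
    change Real.exp (Real.log (kap g p / quad (coefP g) p)) = _
    exact Real.exp_log (div_pos hk0 hP)
  have hx0 : (foot g p).1 = -quad (coefQ g) p / quad (coefP g) p := rfl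
  set τ := Real.arsinh (v.1 / 2) with hτ
  have hv1 : v.1 = 2 * Real.sinh τ := by rw [hτ, Real.sinh_arsinh]; ring
  have hm1 : (moved (foot g p) v).1 = -quad (coefQ g) p / quad (coefP g) p
      + kap g p / quad (coefP g) p * (v.2 * Real.exp τ) := by
    simp only [moved, affineMove, planeCoord]
    rw [ht0, hx0]
  have hm2 : Real.exp (moved (foot g p) v).2
      = kap g p / quad (coefP g) p * Real.exp τ ^ 2 := by
    simp only [moved, affineMove, planeCoord]
    rw [Real.exp_add, ht0, ← hτ, ← Real.exp_nat_mul]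
    push_cast
    rfl
  -- the Lagrange identity eliminates the third coefficient
  have hS : quad (coefS g) p
      = (quad (coefQ g) p ^ 2 + kap g p ^ 2) / quad (coefP g) p := by
    rw [← hPS]; field_simp
  rw [Real.exp_neg, hm1, hm2, hS] at h
  rw [Real.sq_sqrt (by positivity), hv1, Real.sinh_eq, Real.exp_neg]
  have hE := Real.exp_pos τ
  have h2 : ch (mid p (moved (foot g p) v) g) = (2 * ch (mid p (moved (foot g p) v) g)) / 2 := by
    ring
  rw [h2, h]
  field_simp
  ring

theorem contDiffAt_footOf {w : (ℝ × ℝ × ℝ) × (ℝ × ℝ × ℝ) × (ℝ × ℝ × ℝ)} {p : ℝ × ℝ}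
    (h : 0 < quad w.1 p) : ContDiffAt ℝ ∞
      (fun z : ((ℝ × ℝ × ℝ) × (ℝ × ℝ × ℝ) × (ℝ × ℝ × ℝ)) × (ℝ × ℝ) => footOf z.1 z.2) (w, p) := by
  have q : ContDiff ℝ ∞ fun z : (ℝ × ℝ × ℝ) × (ℝ × ℝ) => quad z.1 z.2 := by
    unfold quad; fun_prop
  have q1 : ContDiffAt ℝ ∞ (fun z : ((ℝ × ℝ × ℝ) × (ℝ × ℝ × ℝ) × (ℝ × ℝ × ℝ)) × (ℝ × ℝ) =>
      quad z.1.1 z.2) (w, p) :=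
    (q.comp (contDiff_fst.fst.prodMk contDiff_snd)).contDiffAt
  have q2 : ContDiffAt ℝ ∞ (fun z : ((ℝ × ℝ × ℝ) × (ℝ × ℝ × ℝ) × (ℝ × ℝ × ℝ)) × (ℝ × ℝ) =>
      quad z.1.2.1 z.2) (w, p) :=
    (q.comp (contDiff_fst.snd.fst.prodMk contDiff_snd)).contDiffAt
  have q3 : ContDiffAt ℝ ∞ (fun z : ((ℝ × ℝ × ℝ) × (ℝ × ℝ × ℝ) × (ℝ × ℝ × ℝ)) × (ℝ × ℝ) =>
      quad z.1.2.2 z.2) (w, p) :=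
    (q.comp (contDiff_fst.snd.snd.prodMk contDiff_snd)).contDiffAt
  have h3 : 0 < 1 + quad w.2.2 p ^ 2 := by positivity
  have q4 := ((contDiffAt_const (c := (1:ℝ))).add (q3.pow 2)).sqrt h3.ne'
  exact (q2.neg.div q1 h.ne').prodMk
    ((q4.div q1 h.ne').log (div_pos (Real.sqrt_pos.mpr h3) h).ne')

theorem contDiff_foot (g : G) : ContDiff ℝ ∞ (foot g) := by
  rw [contDiff_iff_contDiffAt]
  intro p
  have h := contDiffAt_footOf (w := coefs g) (p := p) (quad_coefP_pos g p)
  exact h.comp p (contDiffAt_const.prodMk contDiffAt_id)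

theorem continuous_coefs : Continuous coefs := by
  have h := continuous_entry
  unfold coefs coefP coefQ coefL qA qB qC
  fun_prop

/-- The foot of the perpendicular and its derivative are bounded on compact sets. -/
theorem exists_bound_foot (c R : ℝ) : ∃ C : ℝ, 1 ≤ C ∧ ∀ g : G, ch g ≤ c → ∀ p : ℝ × ℝ, ‖p‖ ≤ R →
    ‖foot g p‖ ≤ C ∧ ‖fderiv ℝ (foot g) p‖ ≤ C := by
  set F := fun z : ((ℝ × ℝ × ℝ) × (ℝ × ℝ × ℝ) × (ℝ × ℝ × ℝ)) × (ℝ × ℝ) => footOf z.1 z.2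
  set K : Set (G × (ℝ × ℝ)) := {g | ch g ≤ c} ×ˢ Metric.closedBall 0 R
  have hKc : IsCompact K := (isCompact_ch_le c).prod (isCompact_closedBall 0 R)
  set φ : G × (ℝ × ℝ) → ((ℝ × ℝ × ℝ) × (ℝ × ℝ × ℝ) × (ℝ × ℝ × ℝ)) × (ℝ × ℝ) :=
    fun z => (coefs z.1, z.2)
  have hφc : Continuous φ := (continuous_coefs.comp continuous_fst).prodMk continuous_snd
  have hcd : ∀ z, ContDiffAt ℝ ∞ F (φ z) := fun z => contDiffAt_footOf (quad_coefP_pos z.1 z.2)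
  have c1 : Continuous fun z => F (φ z) := continuous_iff_continuousAt.mpr fun z =>
    (hcd z).continuousAt.comp hφc.continuousAt
  have c2 : Continuous fun z => fderiv ℝ F (φ z) := continuous_iff_continuousAt.mpr fun z =>
    ((hcd z).fderiv_right (m := 0) (by simp)).continuousAt.comp hφc.continuousAt
  obtain ⟨C1, hC1⟩ := hKc.exists_bound_of_continuousOn c1.continuousOn
  obtain ⟨C2, hC2⟩ := hKc.exists_bound_of_continuousOn c2.continuousOn
  refine ⟨1 + |C1| + |C2|, by linarith [abs_nonneg C1, abs_nonneg C2], fun g hg p hp => ?_⟩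
  have hz : ((g, p) : G × (ℝ × ℝ)) ∈ K := ⟨hg, mem_closedBall_zero_iff.mpr hp⟩
  refine ⟨(hC1 _ hz).trans (by linarith [le_abs_self C1, abs_nonneg C2]), ?_⟩
  have hd : HasFDerivAt (foot g) ((fderiv ℝ F (φ (g, p))).comp
      (ContinuousLinearMap.inr ℝ ((ℝ × ℝ × ℝ) × (ℝ × ℝ × ℝ) × (ℝ × ℝ × ℝ)) (ℝ × ℝ))) p := by
    have h1 : HasFDerivAt F (fderiv ℝ F (φ (g, p))) (φ (g, p)) :=
      ((hcd (g, p)).differentiableAt (by simp)).hasFDerivAt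
    exact h1.comp p (hasFDerivAt_prodMk_right (coefs g) p)
  rw [hd.fderiv]
  calc _ ≤ ‖fderiv ℝ F (φ (g, p))‖ *
        ‖ContinuousLinearMap.inr ℝ ((ℝ × ℝ × ℝ) × (ℝ × ℝ × ℝ) × (ℝ × ℝ × ℝ)) (ℝ × ℝ)‖ :=
        ContinuousLinearMap.opNorm_comp_le _ _
    _ ≤ ‖fderiv ℝ F (φ (g, p))‖ * 1 := by
        gcongr; exact ContinuousLinearMap.norm_inr_le_one ℝ _ _
    _ ≤ _ := by
        rw [mul_one]
        exact (hC2 _ hz).trans (by linarith [le_abs_self C2, abs_nonneg C1])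

/-! ### A lower bound for the gradient of a quadratic form on the hyperbolic plane -/

/-- `e^t ∂/∂x` of `quad v`. -/
def gradX (v : ℝ × ℝ × ℝ) (p : ℝ × ℝ) : ℝ := 2 * v.1 * p.1 + v.2.1

/-- `∂/∂t` of `quad v`. -/
def gradT (v : ℝ × ℝ × ℝ) (p : ℝ × ℝ) : ℝ :=
  v.1 * Real.exp p.2 - (v.1 * p.1 ^ 2 + v.2.1 * p.1 + v.2.2) * Real.exp (-p.2)

/-- The size of the coefficients of `quad v`. -/
def coefNorm (v : ℝ × ℝ × ℝ) : ℝ := |v.1| + |v.2.1| + |v.2.2|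

theorem exp_neg_mul_abs_sub_le {R a b : ℝ} (ha : -R ≤ a) (hb : -R ≤ b) :
    Real.exp (-R) * |a - b| ≤ |Real.exp a - Real.exp b| := by
  wlog hab : b ≤ a generalizing a b
  · rw [abs_sub_comm a b, abs_sub_comm (Real.exp a)]
    exact this hb ha (not_le.mp hab).le
  rw [abs_of_nonneg (sub_nonneg.mpr hab), abs_of_nonneg (sub_nonneg.mpr (Real.exp_le_exp.mpr hab))]
  have h1 : a - b + 1 ≤ Real.exp (a - b) := Real.add_one_le_exp _
  have h2 : Real.exp a = Real.exp b * Real.exp (a - b) := by rw [← Real.exp_add]; congr 1; ring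
  have h3 : Real.exp (-R) ≤ Real.exp b := Real.exp_le_exp.mpr hb
  have h4 : 0 ≤ a - b := sub_nonneg.mpr hab
  rw [h2]
  nlinarith [Real.exp_pos b, mul_le_mul_of_nonneg_right h3 h4]

/-- The case of a leading coefficient that is not small: the gradient has a single zero
`(x₀, t₀)`, possibly complex, and `t₀` is replaced by the nearest admissible value. -/
theorem grad_lower_bound_of_le {R δ : ℝ} (hR : 1 ≤ R) (hδ : 0 < δ) {v : ℝ × ℝ × ℝ}
    (hA : δ * coefNorm v ≤ |v.1|) (hD : 0 < coefNorm v) :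
    ∃ x₀ t₀ : ℝ, |x₀| ≤ R + 1 / δ ∧ |t₀| ≤ R + 1 / δ ∧ ∀ p : ℝ × ℝ, |p.1| ≤ R → |p.2| ≤ R →
      δ / (Real.exp R ^ 4 * (R + 1 / δ)) * coefNorm v * (|p.1 - x₀| + |p.2 - t₀|)
        ≤ |gradX v p| + |gradT v p| := by
  obtain ⟨A, B, C⟩ := v
  simp only at hA
  set D := coefNorm (A, B, C) with hDdef
  have hA0 : 0 < |A| := lt_of_lt_of_le (by positivity) hA
  have hAne : A ≠ 0 := abs_pos.mp hA0
  set E := Real.exp R with hE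
  have hE1 : 1 ≤ E := Real.one_le_exp (by linarith)
  set L := R + 1 / δ
  have hδi : 0 < 1 / δ := by positivity
  have hL1 : 1 ≤ L := by linarith
  -- the gradient vanishes where `x = xc` and `e^{2t} = κ'`; `τ₀` is `κ'` clamped to the range of
  -- `e^{2t}` on the square
  set xc := -B / (2 * A) with hxc
  set κ' := C / A - B ^ 2 / (4 * A ^ 2) with hκ'
  set τ₀ := max (Real.exp (-(2 * R))) (min κ' (Real.exp (2 * R))) with hτ
  have hτ1 : Real.exp (-(2 * R)) ≤ τ₀ := le_max_left _ _
  have hτ2 : τ₀ ≤ Real.exp (2 * R) := max_le (Real.exp_le_exp.mpr (by linarith)) (min_le_right _ _)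
  have hτ0 : 0 < τ₀ := lt_of_lt_of_le (Real.exp_pos _) hτ1
  set t₀ := Real.log τ₀ / 2 with ht₀
  have ht1 : -R ≤ t₀ := by
    have := Real.log_le_log (Real.exp_pos _) hτ1
    rw [Real.log_exp] at this
    linarith
  have ht2 : t₀ ≤ R := by
    have := Real.log_le_log hτ0 hτ2
    rw [Real.log_exp] at this
    linarith
  have het : Real.exp (2 * t₀) = τ₀ := by
    rw [ht₀, show 2 * (Real.log τ₀ / 2) = Real.log τ₀ by ring, Real.exp_log hτ0]
  have hxcb : |xc| ≤ 1 / δ := by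
    rw [hxc, abs_div, abs_neg, abs_mul, abs_two, div_le_div_iff₀ (by positivity) hδ]
    have hBD : |B| ≤ D := by
      have h2 := abs_nonneg C
      simp only [hDdef, coefNorm]; linarith
    nlinarith
  refine ⟨xc, t₀, by linarith, abs_le.mpr ⟨by linarith, by linarith⟩, ?_⟩
  rintro ⟨x, t⟩ hx ht
  simp only at hx ht
  have htl := neg_abs_le t
  have htu := le_abs_self t
  have hu : gradX (A, B, C) (x, t) = 2 * A * (x - xc) := by
    simp only [gradX, hxc]; field_simp; ring
  have hw : gradT (A, B, C) (x, t) = A * (Real.exp (-t) * (Real.exp (2 * t) - κ'))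
      - A * ((x - xc) * (x - xc)) * Real.exp (-t) := by
    have e : Real.exp (-t) * Real.exp (2 * t) = Real.exp t := by
      rw [← Real.exp_add]; congr 1; ring
    rw [mul_sub, e]
    simp only [gradT, hxc, hκ']
    field_simp
    ring
  have hclamp : |Real.exp (2 * t) - τ₀| ≤ |Real.exp (2 * t) - κ'| := by
    have h1 : Real.exp (-(2 * R)) ≤ Real.exp (2 * t) := Real.exp_le_exp.mpr (by linarith)
    have h2 : Real.exp (2 * t) ≤ Real.exp (2 * R) := Real.exp_le_exp.mpr (by linarith)
    rw [hτ]
    rcases le_total κ' (Real.exp (2 * R)) with h3 | h3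
    · rw [min_eq_left h3]
      rcases le_total (Real.exp (-(2 * R))) κ' with h4 | h4
      · rw [max_eq_right h4]
      · rw [max_eq_left h4, abs_of_nonneg (by linarith), abs_of_nonneg (by linarith)]
        linarith
    · rw [min_eq_right h3, max_eq_right (by linarith), abs_of_nonpos (by linarith),
        abs_of_nonpos (by linarith)]
      linarith
  have hexp : Real.exp (-(2 * R)) * |2 * t - 2 * t₀| ≤ |Real.exp (2 * t) - τ₀| := by
    rw [← het]
    exact exp_neg_mul_abs_sub_le (by linarith) (by linarith)
  have hE2 : Real.exp (-(2 * R)) = 1 / E ^ 2 := by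
    rw [Real.exp_neg, hE, ← Real.exp_nat_mul, one_div]
    norm_num
  have h2t : |2 * t - 2 * t₀| = 2 * |t - t₀| := by rw [← mul_sub, abs_mul, abs_two]
  have hm1 : 1 / E ≤ Real.exp (-t) := by
    rw [one_div, hE, ← Real.exp_neg]; exact Real.exp_le_exp.mpr (by linarith)
  have hm2 : Real.exp (-t) ≤ E := Real.exp_le_exp.mpr (by linarith)
  have hwl : |A| * (2 / E ^ 3 * |t - t₀|) - |A| * (L * |x - xc|) * E
      ≤ |gradT (A, B, C) (x, t)| := by
    rw [hw]
    have hxl : |x - xc| ≤ L := (abs_sub _ _).trans (by linarith)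
    have k1 : |A| * (2 / E ^ 3 * |t - t₀|) ≤ |A * (Real.exp (-t) * (Real.exp (2 * t) - κ'))| := by
      rw [abs_mul, abs_mul, abs_of_pos (Real.exp_pos _)]
      have : 2 / E ^ 3 * |t - t₀| = 1 / E * (1 / E ^ 2 * (2 * |t - t₀|)) := by field_simp
      rw [this]
      rw [hE2, h2t] at hexp
      have := hexp.trans hclamp
      gcongr
    have k2 : |A * ((x - xc) * (x - xc)) * Real.exp (-t)| ≤ |A| * (L * |x - xc|) * E := by
      rw [abs_mul, abs_mul, abs_mul, abs_of_pos (Real.exp_pos _)]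
      gcongr
    linarith [abs_sub_abs_le_abs_sub (A * (Real.exp (-t) * (Real.exp (2 * t) - κ')))
      (A * ((x - xc) * (x - xc)) * Real.exp (-t))]
  set ξ := |x - xc|
  set η := |t - t₀|
  have hu' : |gradX (A, B, C) (x, t)| = 2 * |A| * ξ := by
    rw [hu, abs_mul, abs_mul, abs_two]
  rw [hu']
  have hEL : 1 ≤ E * L := by nlinarith
  -- the weight `1 / (E L)` makes the error term in `hwl` smaller than the `x`-component
  have step : 1 / (E * L) * (|A| * (2 / E ^ 3 * η) - |A| * (L * ξ) * E)
      ≤ |gradT (A, B, C) (x, t)| := by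
    calc _ ≤ 1 / (E * L) * |gradT (A, B, C) (x, t)| := by gcongr
      _ ≤ 1 * |gradT (A, B, C) (x, t)| := by
          gcongr
          exact (div_le_one (by positivity)).mpr hEL
      _ = _ := one_mul _
  have step2 : 1 / (E * L) * (|A| * (2 / E ^ 3 * η) - |A| * (L * ξ) * E)
      = |A| * (2 / (E ^ 4 * L) * η) - |A| * ξ := by field_simp
  rw [step2] at step
  have hE4 : 1 ≤ E ^ 4 * L := one_le_mul_of_one_le_of_one_le (one_le_pow₀ hE1) hL1
  have hfin : |A| / (E ^ 4 * L) * (ξ + η) ≤ 2 * |A| * ξ + |gradT (A, B, C) (x, t)| := by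
    have h1 : |A| / (E ^ 4 * L) * ξ ≤ |A| * ξ := by
      gcongr; exact div_le_self hA0.le hE4
    have h2 : |A| / (E ^ 4 * L) * η ≤ |A| * (2 / (E ^ 4 * L) * η) := by
      have : |A| * (2 / (E ^ 4 * L) * η) = 2 * (|A| / (E ^ 4 * L) * η) := by ring
      rw [this]
      have : 0 ≤ |A| / (E ^ 4 * L) * η := by positivity
      linarith
    have : |A| / (E ^ 4 * L) * (ξ + η) = |A| / (E ^ 4 * L) * ξ + |A| / (E ^ 4 * L) * η := by ring
    rw [this]
    linarith
  refine le_trans ?_ hfin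
  have : δ / (E ^ 4 * L) * D = (δ * D) / (E ^ 4 * L) := by ring
  rw [this]
  gcongr

/-- The case of a small leading coefficient: the gradient does not vanish at all. -/
theorem grad_lower_bound_of_lt {R β δ : ℝ} (hR : 1 ≤ R)
    (hβ : β = 1 / (8 * Real.exp R ^ 2 * R)) (hδ : δ = β / (8 * Real.exp R ^ 2 * R ^ 2))
    {A B C : ℝ} (hA : |A| < δ * (|A| + |B| + |C|)) {x t : ℝ} (hx : |x| ≤ R) (ht : |t| ≤ R) :
    β / 2 * (|A| + |B| + |C|) ≤ |gradX (A, B, C) (x, t)| + |gradT (A, B, C) (x, t)| := by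
  obtain ⟨E, hE⟩ : ∃ E, E = Real.exp R := ⟨_, rfl⟩
  obtain ⟨D, hDe⟩ : ∃ D, D = |A| + |B| + |C| := ⟨_, rfl⟩
  rw [← hE] at hβ hδ
  rw [← hDe] at hA ⊢
  have hE1 : 1 ≤ E := hE ▸ Real.one_le_exp (by linarith)
  have hE0 : 0 < E := by linarith
  have hβ0 : 0 < β := by rw [hβ]; positivity
  have hδ0 : 0 < δ := by rw [hδ]; positivity
  have hD : 0 ≤ D := by rw [hDe]; positivity
  have hER : 1 ≤ E ^ 2 * R := one_le_mul_of_one_le_of_one_le (one_le_pow₀ hE1) hR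
  have hER2 : 1 ≤ E ^ 2 * R ^ 2 :=
    one_le_mul_of_one_le_of_one_le (one_le_pow₀ hE1) (one_le_pow₀ hR)
  have hβ8 : β ≤ 1 / 8 := by
    rw [hβ]; apply one_div_le_one_div_of_le (by norm_num); linarith
  have hδβ : δ ≤ β / 8 := by
    rw [hδ]; apply div_le_div_of_nonneg_left hβ0.le (by norm_num); linarith
  have hw0 := abs_nonneg (gradT (A, B, C) (x, t))
  have hu0 := abs_nonneg (gradX (A, B, C) (x, t))
  -- if `B` is not small, then `B` dominates the `x`-component; otherwise `C` dominates the
  -- `t`-component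
  by_cases hB : β * D ≤ |B|
  · have h1 : |B| - |2 * A * x| ≤ |gradX (A, B, C) (x, t)| := by
      have := abs_sub_abs_le_abs_sub B (-(2 * A * x))
      rw [abs_neg] at this
      refine this.trans (le_of_eq ?_)
      simp only [gradX]; congr 1; ring
    have h2 : |2 * A * x| ≤ β / 4 * D := by
      rw [abs_mul, abs_mul, abs_two]
      calc 2 * |A| * |x| ≤ 2 * (δ * D) * R := by gcongr
        _ ≤ β / 4 * D := by
            have : 2 * (δ * D) * R = (β / 4) * D * (1 / (E ^ 2 * R)) := by
              rw [hδ]; field_simp; ring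
            rw [this]
            exact mul_le_of_le_one_right (by positivity) ((div_le_one (by positivity)).mpr hER)
    linarith
  · push Not at hB
    have hC : 3 / 4 * D ≤ |C| := by
      have h1 : β * D ≤ 1 / 8 * D := by gcongr
      have h2 : δ * D ≤ 1 / 8 * D := by
        have : δ ≤ 1 / 8 := by linarith
        gcongr
      linarith
    have hm1 : 1 / E ≤ Real.exp (-t) := by
      rw [one_div, hE, ← Real.exp_neg]
      exact Real.exp_le_exp.mpr (by linarith [le_abs_self t])
    have hm2 : Real.exp (-t) ≤ E := hE ▸ Real.exp_le_exp.mpr (by linarith [neg_abs_le t])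
    have hm3 : Real.exp t ≤ E := hE ▸ Real.exp_le_exp.mpr (by linarith [le_abs_self t])
    have h1 : |C * Real.exp (-t)| - |A * Real.exp t - (A * x ^ 2 + B * x) * Real.exp (-t)|
        ≤ |gradT (A, B, C) (x, t)| := by
      refine (abs_sub_abs_le_abs_sub _ _).trans (le_of_eq ?_)
      rw [← abs_neg]
      simp only [gradT]; congr 1; ring
    have h2 : 3 / 4 * D * (1 / E) ≤ |C * Real.exp (-t)| := by
      rw [abs_mul, abs_of_pos (Real.exp_pos _)]; gcongr
    have h3 : |A * Real.exp t - (A * x ^ 2 + B * x) * Real.exp (-t)|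
        ≤ (δ * D) * E + ((δ * D) * R ^ 2 + (β * D) * R) * E := by
      refine (abs_sub _ _).trans ?_
      rw [abs_mul, abs_mul, abs_of_pos (Real.exp_pos _), abs_of_pos (Real.exp_pos _)]
      have h4 : |A * x ^ 2 + B * x| ≤ (δ * D) * R ^ 2 + (β * D) * R := by
        refine (abs_add_le _ _).trans ?_
        rw [abs_mul, abs_mul, abs_pow]
        gcongr
      gcongr
    have h5 : (δ * D) * E + ((δ * D) * R ^ 2 + (β * D) * R) * E ≤ 1 / 4 * D * (1 / E) := by
      have e1 : (β * D) * R * E = 1 / 8 * D * (1 / E) := by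
        rw [hβ]; field_simp
      have e2 : (δ * D) * R ^ 2 * E = β / 8 * D * (1 / E) := by
        rw [hδ]; field_simp
      have e3 : (δ * D) * E ≤ β / 8 * D * (1 / E) := by
        rw [← e2]
        have : 1 ≤ R ^ 2 := one_le_pow₀ hR
        calc δ * D * E = δ * D * 1 * E := by ring
          _ ≤ δ * D * R ^ 2 * E := by gcongr
      have e4 : β / 8 * D * (1 / E) ≤ 1 / 64 * D * (1 / E) := by
        have : β / 8 ≤ 1 / 64 := by linarith
        gcongr
      have e5 : 0 ≤ D * (1 / E) := by positivity
      linarith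
    have h6 : β / 2 ≤ 1 / 2 * (1 / E) := by
      have : β ≤ 1 / E := by
        rw [hβ]
        apply one_div_le_one_div_of_le hE0
        have : E * 1 ≤ E * (E * R) :=
          mul_le_mul_of_nonneg_left (one_le_mul_of_one_le_of_one_le hE1 hR) hE0.le
        nlinarith
      linarith
    have h7 : β / 2 * D ≤ 1 / 2 * (1 / E) * D := by gcongr
    linarith

/-- On bounded sets, the gradient of `quad v` vanishes at most like the distance to one point,
uniformly with respect to the size of the coefficients. -/
theorem exists_grad_lower_bound {R : ℝ} (hR : 1 ≤ R) : ∃ c R₀ : ℝ, 0 < c ∧ 0 ≤ R₀ ∧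
    ∀ v : ℝ × ℝ × ℝ, 0 < coefNorm v → ∃ x₀ t₀ : ℝ, |x₀| ≤ R₀ ∧ |t₀| ≤ R₀ ∧
      ∀ p : ℝ × ℝ, |p.1| ≤ R → |p.2| ≤ R →
        c * coefNorm v * (|p.1 - x₀| + |p.2 - t₀|) ≤ |gradX v p| + |gradT v p| := by
  set E := Real.exp R
  have hE1 : 1 ≤ E := Real.one_le_exp (by linarith)
  set β := 1 / (8 * E ^ 2 * R) with hβ
  set δ := β / (8 * E ^ 2 * R ^ 2) with hδ
  have hβ0 : 0 < β := by positivity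
  have hδ0 : 0 < δ := by positivity
  set L := R + 1 / δ
  have hL0 : 0 < L := by positivity
  set c₁ := δ / (E ^ 4 * L)
  set c₂ := β / (4 * R) with hc₂
  have hc10 : 0 < c₁ := by positivity
  have hc20 : 0 < c₂ := by positivity
  refine ⟨min c₁ c₂, L, lt_min hc10 hc20, hL0.le, fun v hD => ?_⟩
  by_cases hA : δ * coefNorm v ≤ |v.1|
  · obtain ⟨x₀, t₀, h1, h2, h3⟩ := grad_lower_bound_of_le hR hδ0 hA hD
    refine ⟨x₀, t₀, h1, h2, fun p hp1 hp2 => le_trans ?_ (h3 p hp1 hp2)⟩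
    gcongr
    exact min_le_left _ _
  · push Not at hA
    refine ⟨0, 0, by simpa using hL0.le, by simpa using hL0.le, ?_⟩
    obtain ⟨A, B, C⟩ := v
    rintro ⟨x, t⟩ hx ht
    simp only at hx ht hA
    set D := coefNorm (A, B, C)
    have hlow := grad_lower_bound_of_lt hR hβ hδ hA hx ht
    refine le_trans ?_ hlow
    calc min c₁ c₂ * D * (|x - 0| + |t - 0|) ≤ c₂ * D * (R + R) := by
          rw [sub_zero, sub_zero]
          gcongr
          exact min_le_right _ _
      _ = β / 2 * D := by rw [hc₂]; field_simp; norm_num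

/-! ### Integration by parts on the hyperbolic plane -/

theorem hasFDerivAt_quad (v : ℝ × ℝ × ℝ) (p : ℝ × ℝ) : HasFDerivAt (quad v)
    ((gradX v p * Real.exp (-p.2)) • ContinuousLinearMap.fst ℝ ℝ ℝ
      + gradT v p • ContinuousLinearMap.snd ℝ ℝ ℝ) p := by
  have h1 : HasFDerivAt (fun p : ℝ × ℝ => p.1) (ContinuousLinearMap.fst ℝ ℝ ℝ) p := hasFDerivAt_fst
  have h2 : HasFDerivAt (fun p : ℝ × ℝ => p.2) (ContinuousLinearMap.snd ℝ ℝ ℝ) p := hasFDerivAt_snd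
  have h3 := (h2.exp.const_mul v.1).add (((((h1.pow 2).const_mul v.1).add
    (h1.const_mul v.2.1)).add_const v.2.2).mul h2.neg.exp)
  refine h3.congr_fderiv ?_
  ext <;> simp [gradX, gradT] <;> ring

theorem hasFDerivAt_gradX (v : ℝ × ℝ × ℝ) (p : ℝ × ℝ) : HasFDerivAt (gradX v)
    ((2 * v.1) • ContinuousLinearMap.fst ℝ ℝ ℝ) p := by
  have h1 : HasFDerivAt (fun p : ℝ × ℝ => p.1) (ContinuousLinearMap.fst ℝ ℝ ℝ) p := hasFDerivAt_fst
  exact (h1.const_mul (2 * v.1)).add_const v.2.1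

theorem hasFDerivAt_gradT (v : ℝ × ℝ × ℝ) (p : ℝ × ℝ) : HasFDerivAt (gradT v)
    ((-(gradX v p * Real.exp (-p.2))) • ContinuousLinearMap.fst ℝ ℝ ℝ
      + quad v p • ContinuousLinearMap.snd ℝ ℝ ℝ) p := by
  have h1 : HasFDerivAt (fun p : ℝ × ℝ => p.1) (ContinuousLinearMap.fst ℝ ℝ ℝ) p := hasFDerivAt_fst
  have h2 : HasFDerivAt (fun p : ℝ × ℝ => p.2) (ContinuousLinearMap.snd ℝ ℝ ℝ) p := hasFDerivAt_snd
  have h3 := (h2.exp.const_mul v.1).sub (((((h1.pow 2).const_mul v.1).add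
    (h1.const_mul v.2.1)).add_const v.2.2).mul h2.neg.exp)
  refine h3.congr_fderiv ?_
  ext
  · simp [gradX]; ring
  · simp [quad]

theorem continuous_quad (v : ℝ × ℝ × ℝ) : Continuous (quad v) := by unfold quad; fun_prop

theorem continuous_gradX (v : ℝ × ℝ × ℝ) : Continuous (gradX v) := by unfold gradX; fun_prop

theorem continuous_gradT (v : ℝ × ℝ × ℝ) : Continuous (gradT v) := by unfold gradT; fun_prop

/-- The regularized squared norm of the gradient. -/
def gradW (v : ℝ × ℝ × ℝ) (ε : ℝ) (p : ℝ × ℝ) : ℝ := gradX v p ^ 2 + gradT v p ^ 2 + ε ^ 2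

theorem continuous_gradW (v : ℝ × ℝ × ℝ) (ε : ℝ) : Continuous (gradW v ε) := by
  have h1 := continuous_gradX v
  have h2 := continuous_gradT v
  unfold gradW; fun_prop

theorem gradW_pos (v : ℝ × ℝ × ℝ) {ε : ℝ} (hε : 0 < ε) (p : ℝ × ℝ) : 0 < gradW v ε p := by
  unfold gradW; positivity

theorem hasFDerivAt_gradW (v : ℝ × ℝ × ℝ) (ε : ℝ) (p : ℝ × ℝ) : HasFDerivAt (gradW v ε)
    ((2 * gradX v p * quad v p * Real.exp (-p.2)) • ContinuousLinearMap.fst ℝ ℝ ℝ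
      + (2 * gradT v p * quad v p) • ContinuousLinearMap.snd ℝ ℝ ℝ) p := by
  have h := (((hasFDerivAt_gradX v p).pow 2).add ((hasFDerivAt_gradT v p).pow 2)).add_const (ε ^ 2)
  refine h.congr_fderiv ?_
  have hE : Real.exp p.2 * Real.exp (-p.2) = 1 := by rw [← Real.exp_add]; simp
  ext
  · simp
    simp only [gradT, quad]
    linear_combination (-4 * gradX v p * v.1) * hE
  · simp

/-- The `x`-component of the regularized normalized gradient field and the part of its derivative
that enters the divergence. -/
theorem hasFDerivAt_fieldX (v : ℝ × ℝ × ℝ) {ε : ℝ} (hε : 0 < ε) (p : ℝ × ℝ) :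
    ∃ L : ℝ × ℝ →L[ℝ] ℝ, HasFDerivAt (fun p => gradX v p / gradW v ε p) L p ∧
      L (1, 0) = 2 * v.1 / gradW v ε p
        - 2 * gradX v p ^ 2 * quad v p * Real.exp (-p.2) / gradW v ε p ^ 2 := by
  have hW := (gradW_pos v hε p).ne'
  refine ⟨_, (hasFDerivAt_gradX v p).mul
    ((hasDerivAt_inv hW).comp_hasFDerivAt p (hasFDerivAt_gradW v ε p)), ?_⟩
  simp
  field_simp
  ring

/-- The `t`-component of the regularized normalized gradient field and the part of its derivative
that enters the divergence. -/
theorem hasFDerivAt_fieldT (v : ℝ × ℝ × ℝ) {ε : ℝ} (hε : 0 < ε) (p : ℝ × ℝ) :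
    ∃ L : ℝ × ℝ →L[ℝ] ℝ, HasFDerivAt (fun p => Real.exp (-p.2) * gradT v p / gradW v ε p) L p ∧
      L (0, 1) = Real.exp (-p.2) * (quad v p - gradT v p) / gradW v ε p
        - 2 * Real.exp (-p.2) * gradT v p ^ 2 * quad v p / gradW v ε p ^ 2 := by
  have hW := (gradW_pos v hε p).ne'
  have h2 : HasFDerivAt (fun p : ℝ × ℝ => p.2) (ContinuousLinearMap.snd ℝ ℝ ℝ) p := hasFDerivAt_snd
  refine ⟨_, (h2.neg.exp.mul (hasFDerivAt_gradT v p)).mul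
    ((hasDerivAt_inv hW).comp_hasFDerivAt p (hasFDerivAt_gradW v ε p)), ?_⟩
  simp
  field_simp
  ring

/-- The field `∇ℓ / (|∇ℓ|² + ε²)` is divergence free up to a term that is concentrated near the
critical point of `ℓ = quad v`. -/
theorem divergence_eq (v : ℝ × ℝ × ℝ) {ε : ℝ} (hε : 0 < ε) (p : ℝ × ℝ) :
    (2 * v.1 / gradW v ε p
        - 2 * gradX v p ^ 2 * quad v p * Real.exp (-p.2) / gradW v ε p ^ 2)
      + (Real.exp (-p.2) * (quad v p - gradT v p) / gradW v ε p
        - 2 * Real.exp (-p.2) * gradT v p ^ 2 * quad v p / gradW v ε p ^ 2)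
      = 2 * Real.exp (-p.2) * quad v p * ε ^ 2 / gradW v ε p ^ 2 := by
  have hW := (gradW_pos v hε p).ne'
  have hE : Real.exp p.2 * Real.exp (-p.2) = 1 := by rw [← Real.exp_add]; simp
  have h1 : 2 * v.1 = Real.exp (-p.2) * (quad v p + gradT v p) := by
    simp only [quad, gradT]
    linear_combination (-2 * v.1) * hE
  rw [h1]
  field_simp
  simp only [gradW]
  ring

/-- The oscillating factor `cos (s δ) / cosh δ`, where `sinh δ = ℓ`. -/
def cosKer (s ℓ : ℝ) : ℝ := Real.cos (s * Real.arsinh ℓ) / √(1 + ℓ ^ 2)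

theorem continuous_cosKer (s : ℝ) : Continuous (cosKer s) := by
  have h := Real.continuous_arsinh
  refine Continuous.div (by fun_prop) (by fun_prop) fun ℓ => ?_
  positivity

theorem abs_cosKer_le (s ℓ : ℝ) : |cosKer s ℓ| ≤ 1 := by
  have h : 1 ≤ √(1 + ℓ ^ 2) := Real.one_le_sqrt.mpr (by nlinarith [sq_nonneg ℓ])
  rw [cosKer, abs_div, abs_of_pos (by linarith : 0 < √(1 + ℓ ^ 2))]
  exact div_le_one_of_le₀ ((Real.abs_cos_le_one _).trans h) (by linarith)

theorem hasDerivAt_sin_arsinh {s : ℝ} (hs : s ≠ 0) (ℓ : ℝ) :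
    HasDerivAt (fun ℓ => Real.sin (s * Real.arsinh ℓ) / s) (cosKer s ℓ) ℓ := by
  have h := (((Real.hasDerivAt_arsinh ℓ).const_mul s).sin).div_const s
  refine h.congr_deriv ?_
  have : √(1 + ℓ ^ 2) ≠ 0 := by positivity
  simp only [cosKer]
  field_simp

/-- The area integral of `a cos (s δ) / cosh δ` after integration by parts along the regularized
normalized gradient field of `ℓ`. -/
theorem integral_cosKer_eq (v : ℝ × ℝ × ℝ) {s ε : ℝ} (hs : s ≠ 0) (hε : 0 < ε) {a : ℝ × ℝ → ℂ}
    (ha : ContDiff ℝ 1 a) (hac : HasCompactSupport a) :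
    ∫ p : ℝ × ℝ, a p * ((Real.exp (-p.2) * cosKer s (quad v p) : ℝ) : ℂ)
      = ∫ p : ℝ × ℝ, (a p * ((Real.exp (-p.2) * cosKer s (quad v p) * (ε ^ 2 / gradW v ε p) : ℝ) : ℂ)
        - (fderiv ℝ a p (1, 0) * ((gradX v p / gradW v ε p : ℝ) : ℂ)
            + fderiv ℝ a p (0, 1) * ((Real.exp (-p.2) * gradT v p / gradW v ε p : ℝ) : ℂ)
            + a p * ((2 * Real.exp (-p.2) * quad v p * ε ^ 2 / gradW v ε p ^ 2 : ℝ) : ℂ))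
          * ((Real.sin (s * Real.arsinh (quad v p)) / s : ℝ) : ℂ)) := by
  have cq := continuous_quad v
  have cx := continuous_gradX v
  have ct := continuous_gradT v
  have cW := continuous_gradW v ε
  have hW : ∀ p, gradW v ε p ≠ 0 := fun p => (gradW_pos v hε p).ne'
  have ck : Continuous fun p => cosKer s (quad v p) := (continuous_cosKer s).comp cq
  have car := Real.continuous_arsinh
  have ca := ha.continuous
  have cda : Continuous (fderiv ℝ a) := ha.continuous_fderiv (by norm_num)
  have cda' : ∀ w : ℝ × ℝ, Continuous fun p => fderiv ℝ a p w := fun w => cda.clm_apply continuous_const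
  have hda' : ∀ w : ℝ × ℝ, HasCompactSupport fun p => fderiv ℝ a p w := fun w => hac.fderiv_apply ℝ w
  set S : ℝ × ℝ → ℂ := fun p => ((Real.sin (s * Real.arsinh (quad v p)) / s : ℝ) : ℂ) with hS
  have cS : Continuous S := by
    simp only [hS]; fun_prop
  -- the field `(X, Y)` satisfies `e^{-t} cosKer = (X, Y) · ∇S` up to the term with `ε² / gradW`
  set X : ℝ × ℝ → ℝ := fun p => gradX v p / gradW v ε p with hX
  set Y : ℝ × ℝ → ℝ := fun p => Real.exp (-p.2) * gradT v p / gradW v ε p with hY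
  have cX : Continuous X := cx.div cW hW
  have cY : Continuous Y := Continuous.div (by fun_prop) cW hW
  have dS : ∀ p, HasFDerivAt S (Complex.ofRealCLM.comp (cosKer s (quad v p) •
      ((gradX v p * Real.exp (-p.2)) • ContinuousLinearMap.fst ℝ ℝ ℝ
      + gradT v p • ContinuousLinearMap.snd ℝ ℝ ℝ))) p := by
    intro p
    have h1 := (hasDerivAt_sin_arsinh hs (quad v p)).comp_hasFDerivAt p (hasFDerivAt_quad v p)
    exact Complex.ofRealCLM.hasFDerivAt.comp p h1
  have dSx : ∀ p, fderiv ℝ S p (1, 0)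
      = ((cosKer s (quad v p) * (gradX v p * Real.exp (-p.2)) : ℝ) : ℂ) := by
    intro p; rw [(dS p).fderiv]; simp
  have dSt : ∀ p, fderiv ℝ S p (0, 1) = ((cosKer s (quad v p) * gradT v p : ℝ) : ℂ) := by
    intro p; rw [(dS p).fderiv]; simp
  have daf : ∀ p, HasFDerivAt a (fderiv ℝ a p) p := fun p =>
    (ha.differentiable (by norm_num) p).hasFDerivAt
  have dfx : ∀ p, DifferentiableAt ℝ (fun p => a p * (X p : ℂ)) p ∧
      fderiv ℝ (fun p => a p * (X p : ℂ)) p (1, 0) = fderiv ℝ a p (1, 0) * X p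
        + a p * ((2 * v.1 / gradW v ε p
        - 2 * gradX v p ^ 2 * quad v p * Real.exp (-p.2) / gradW v ε p ^ 2 : ℝ) : ℂ) := by
    intro p
    obtain ⟨L, h1, h2⟩ := hasFDerivAt_fieldX v hε p
    have h3 := (daf p).mul (Complex.ofRealCLM.hasFDerivAt.comp p h1)
    refine ⟨h3.differentiableAt, ?_⟩
    have h4 : fderiv ℝ (fun p => a p * (X p : ℂ)) p = _ := h3.fderiv
    rw [h4, ← h2]
    simp [hX]
    ring
  have dft : ∀ p, DifferentiableAt ℝ (fun p => a p * (Y p : ℂ)) p ∧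
      fderiv ℝ (fun p => a p * (Y p : ℂ)) p (0, 1) = fderiv ℝ a p (0, 1) * Y p
        + a p * ((Real.exp (-p.2) * (quad v p - gradT v p) / gradW v ε p
        - 2 * Real.exp (-p.2) * gradT v p ^ 2 * quad v p / gradW v ε p ^ 2 : ℝ) : ℂ) := by
    intro p
    obtain ⟨L, h1, h2⟩ := hasFDerivAt_fieldT v hε p
    have h3 := (daf p).mul (Complex.ofRealCLM.hasFDerivAt.comp p h1)
    refine ⟨h3.differentiableAt, ?_⟩
    have h4 : fderiv ℝ (fun p => a p * (Y p : ℂ)) p = _ := h3.fderiv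
    rw [h4, ← h2]
    simp [hY]
    ring
  have hint : ∀ (f : ℝ × ℝ → ℂ) (w : ℝ × ℝ → ℂ), Continuous f → HasCompactSupport f →
      Continuous w → Integrable fun p => f p * w p := fun f w hf hfc hw =>
    (hf.mul hw).integrable_of_hasCompactSupport hfc.mul_right
  have cX' : Continuous fun p => (X p : ℂ) := Complex.continuous_ofReal.comp cX
  have cY' : Continuous fun p => (Y p : ℂ) := Complex.continuous_ofReal.comp cY
  have cdX : Continuous fun p : ℝ × ℝ => ((2 * v.1 / gradW v ε p
        - 2 * gradX v p ^ 2 * quad v p * Real.exp (-p.2) / gradW v ε p ^ 2 : ℝ) : ℂ) :=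
    Complex.continuous_ofReal.comp ((continuous_const.div cW hW).sub
      (Continuous.div (by fun_prop) (by fun_prop) fun p => pow_ne_zero 2 (hW p)))
  have cdY : Continuous fun p : ℝ × ℝ =>
      ((Real.exp (-p.2) * (quad v p - gradT v p) / gradW v ε p
        - 2 * Real.exp (-p.2) * gradT v p ^ 2 * quad v p / gradW v ε p ^ 2 : ℝ) : ℂ) :=
    Complex.continuous_ofReal.comp ((Continuous.div (by fun_prop) cW hW).sub
      (Continuous.div (by fun_prop) (by fun_prop) fun p => pow_ne_zero 2 (hW p)))
  have i1 : Integrable fun p => fderiv ℝ (fun p => a p * (X p : ℂ)) p (1, 0) * S p := by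
    simp only [fun p => (dfx p).2]
    refine ((hint _ _ (cda' (1, 0)) (hda' (1, 0)) (cX'.mul cS)).add
      (hint _ _ ca hac (cdX.mul cS))).congr (Filter.Eventually.of_forall fun p => ?_)
    simp only [Pi.add_apply, Pi.mul_apply]; ring
  have i2 : Integrable fun p => fderiv ℝ (fun p => a p * (Y p : ℂ)) p (0, 1) * S p := by
    simp only [fun p => (dft p).2]
    refine ((hint _ _ (cda' (0, 1)) (hda' (0, 1)) (cY'.mul cS)).add
      (hint _ _ ca hac (cdY.mul cS))).congr (Filter.Eventually.of_forall fun p => ?_)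
    simp only [Pi.add_apply, Pi.mul_apply]; ring
  have j1 : Integrable fun p => (a p * (X p : ℂ)) * fderiv ℝ S p (1, 0) := by
    simp only [dSx, mul_assoc]
    exact hint _ _ ca hac (by fun_prop)
  have j2 : Integrable fun p => (a p * (Y p : ℂ)) * fderiv ℝ S p (0, 1) := by
    simp only [dSt, mul_assoc]
    exact hint _ _ ca hac (by fun_prop)
  have k1 : Integrable fun p => (a p * (X p : ℂ)) * S p := by
    simp only [mul_assoc]
    exact hint _ _ ca hac (cX'.mul cS)
  have k2 : Integrable fun p => (a p * (Y p : ℂ)) * S p := by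
    simp only [mul_assoc]
    exact hint _ _ ca hac (cY'.mul cS)
  have ibx := integral_mul_fderiv_eq_neg_fderiv_mul_of_integrable i1 j1 k1
    (fun p _ => (dfx p).1) (fun p _ => (dS p).differentiableAt)
  have ibt := integral_mul_fderiv_eq_neg_fderiv_mul_of_integrable i2 j2 k2
    (fun p _ => (dft p).1) (fun p _ => (dS p).differentiableAt)
  have iE : Integrable fun p : ℝ × ℝ =>
      a p * ((Real.exp (-p.2) * cosKer s (quad v p) * (ε ^ 2 / gradW v ε p) : ℝ) : ℂ) := by
    refine hint _ _ ca hac (Complex.continuous_ofReal.comp ?_)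
    exact Continuous.mul (by fun_prop) (continuous_const.div cW hW)
  have split : ∀ p : ℝ × ℝ, a p * ((Real.exp (-p.2) * cosKer s (quad v p) : ℝ) : ℂ)
      = a p * ((Real.exp (-p.2) * cosKer s (quad v p) * (ε ^ 2 / gradW v ε p) : ℝ) : ℂ)
        + ((a p * (X p : ℂ)) * fderiv ℝ S p (1, 0) + (a p * (Y p : ℂ)) * fderiv ℝ S p (0, 1)) := by
    intro p
    rw [dSx, dSt]
    have h1 : Real.exp (-p.2) * cosKer s (quad v p)
        = Real.exp (-p.2) * cosKer s (quad v p) * (ε ^ 2 / gradW v ε p)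
          + (X p * (cosKer s (quad v p) * (gradX v p * Real.exp (-p.2)))
            + Y p * (cosKer s (quad v p) * gradT v p)) := by
      have h2 := hW p
      simp only [hX, hY]
      field_simp
      simp only [gradW]
      ring
    conv_lhs => rw [h1]
    push_cast
    ring
  have j12 : Integrable fun p => (a p * (X p : ℂ)) * fderiv ℝ S p (1, 0)
      + (a p * (Y p : ℂ)) * fderiv ℝ S p (0, 1) := j1.add j2
  have i12 : Integrable fun p => fderiv ℝ (fun p => a p * (X p : ℂ)) p (1, 0) * S p
      + fderiv ℝ (fun p => a p * (Y p : ℂ)) p (0, 1) * S p := i1.add i2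
  have e1 : ∫ p : ℝ × ℝ, a p * ((Real.exp (-p.2) * cosKer s (quad v p) : ℝ) : ℂ)
      = (∫ p : ℝ × ℝ, a p *
          ((Real.exp (-p.2) * cosKer s (quad v p) * (ε ^ 2 / gradW v ε p) : ℝ) : ℂ))
        + (-(∫ p, fderiv ℝ (fun p => a p * (X p : ℂ)) p (1, 0) * S p)
          + -(∫ p, fderiv ℝ (fun p => a p * (Y p : ℂ)) p (0, 1) * S p)) := by
    rw [← ibx, ← ibt, ← integral_add j1 j2, ← integral_add iE j12]
    exact integral_congr_ae (Filter.Eventually.of_forall split)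
  rw [e1, ← neg_add, ← sub_eq_add_neg, ← integral_add i1 i2, ← integral_sub iE i12]
  refine integral_congr_ae (Filter.Eventually.of_forall fun p => ?_)
  simp only []
  rw [(dfx p).2, (dft p).2, ← divergence_eq v hε p, Complex.ofReal_add]
  change _ = _ - (fderiv ℝ a p (1, 0) * (X p : ℂ) + fderiv ℝ a p (0, 1) * (Y p : ℂ) + _) * S p
  ring

/-! ### The oscillatory integral over the hyperbolic plane -/

/-- The function `|x|^{-1/2}` cut off to `[-L, L]`. -/
def rootKer (L : ℝ) : ℝ → ℝ := Set.indicator (Set.Icc (-L) L) fun x => (√|x|)⁻¹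

theorem integrable_rootKer (L : ℝ) : Integrable (rootKer L) := by
  rw [rootKer, integrable_indicator_iff measurableSet_Icc]
  rcases lt_or_ge L 0 with hL | hL
  · rw [Set.Icc_eq_empty (by linarith)]
    exact integrableOn_empty
  have h1 : IntervalIntegrable (fun x : ℝ => (√|x|)⁻¹) volume 0 L := by
    have h := intervalIntegral.intervalIntegrable_rpow' (a := 0) (b := L) (r := -(1/2))
      (by norm_num)
    refine h.congr fun x hx => ?_
    rw [Set.uIoc_of_le hL] at hx
    rw [abs_of_pos hx.1, Real.rpow_neg hx.1.le, Real.sqrt_eq_rpow]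
  have h2 : IntervalIntegrable (fun x : ℝ => (√|x|)⁻¹) volume (-L) 0 := by
    have := ((IntervalIntegrable.iff_comp_neg (by simp)).mp h1).symm
    simpa using this
  have h3 := h2.trans h1
  rw [intervalIntegrable_iff_integrableOn_Icc_of_le (by linarith)] at h3
  exact h3

/-- A rescaled Poisson kernel. -/
def poissonKer (m ε x : ℝ) : ℝ := ε / (m ^ 2 * x ^ 2 + ε ^ 2)

theorem integral_poissonKer {m ε : ℝ} (hm : 0 < m) (hε : 0 < ε) :
    Integrable (poissonKer m ε) ∧ ∫ x : ℝ, poissonKer m ε x = Real.pi / m := by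
  have e : poissonKer m ε
      = fun x => ε⁻¹ * (fun y : ℝ => (1 + y ^ 2)⁻¹) ((m / ε) * x) := by
    funext x
    simp only [poissonKer]
    have h2 : 1 + (m / ε * x) ^ 2 = (m ^ 2 * x ^ 2 + ε ^ 2) / ε ^ 2 := by field_simp; ring
    rw [h2]
    field_simp
  have hk : m / ε ≠ 0 := (div_pos hm hε).ne'
  rw [e]
  refine ⟨(integrable_inv_one_add_sq.comp_mul_left' hk).const_mul _, ?_⟩
  rw [integral_const_mul, Measure.integral_comp_mul_left (fun y : ℝ => (1 + y ^ 2)⁻¹), integral_univ_inv_one_add_sq,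
    abs_of_pos (by positivity)]
  simp only [smul_eq_mul]
  field_simp

theorem abs_quad_le {R : ℝ} (hR : 0 ≤ R) (v : ℝ × ℝ × ℝ) {p : ℝ × ℝ} (h1 : |p.1| ≤ R)
    (h2 : |p.2| ≤ R) : |quad v p| ≤ Real.exp R * (2 + R) ^ 2 * coefNorm v := by
  obtain ⟨A, B, C⟩ := v
  have hm2 : Real.exp (-p.2) ≤ Real.exp R := Real.exp_le_exp.mpr (by linarith [neg_abs_le p.2])
  have hm3 : Real.exp p.2 ≤ Real.exp R := Real.exp_le_exp.mpr (by linarith [le_abs_self p.2])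
  simp only [quad, coefNorm]
  refine (abs_add_le _ _).trans ?_
  rw [abs_mul, abs_mul, abs_of_pos (Real.exp_pos _), abs_of_pos (Real.exp_pos _)]
  have k : |A * p.1 ^ 2 + B * p.1 + C| ≤ |A| * R ^ 2 + |B| * R + |C| := by
    refine (abs_add_le _ _).trans (add_le_add ((abs_add_le _ _).trans ?_) le_rfl)
    rw [abs_mul, abs_mul, abs_pow]
    gcongr
  calc _ ≤ |A| * Real.exp R + (|A| * R ^ 2 + |B| * R + |C|) * Real.exp R := by gcongr
    _ = Real.exp R * (|A| * (1 + R ^ 2) + |B| * R + |C|) := by ring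
    _ ≤ Real.exp R * ((2 + R) ^ 2 * (|A| + |B| + |C|)) := by
        have a0 := abs_nonneg A
        have b0 := abs_nonneg B
        have c0 := abs_nonneg C
        gcongr
        nlinarith [mul_nonneg a0 hR, mul_nonneg b0 hR, mul_nonneg c0 hR, mul_nonneg b0 (sq_nonneg R),
          mul_nonneg c0 (sq_nonneg R)]
    _ = _ := by ring

/-- The elementary inequality behind the integrability of `1 / |∇ℓ|`. -/
theorem inv_add_le_rootKer {L m ξ η N : ℝ} (hm : 0 < m) (hξ : ξ ≠ 0) (hη : η ≠ 0)
    (hξL : |ξ| ≤ L) (hηL : |η| ≤ L) (hN : m * (|ξ| + |η|) ≤ N) :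
    1 / N ≤ 1 / m * (rootKer L ξ * rootKer L η) := by
  have h1 : 0 < |ξ| := abs_pos.mpr hξ
  have h2 : 0 < |η| := abs_pos.mpr hη
  have e1 : rootKer L ξ = (√|ξ|)⁻¹ := Set.indicator_of_mem (Set.mem_Icc.mpr (abs_le.mp hξL)) _
  have e2 : rootKer L η = (√|η|)⁻¹ := Set.indicator_of_mem (Set.mem_Icc.mpr (abs_le.mp hηL)) _
  have h3 : √|ξ| * √|η| ≤ |ξ| + |η| := by
    have := Real.sq_sqrt h1.le
    have := Real.sq_sqrt h2.le
    nlinarith [sq_nonneg (√|ξ| - √|η|), sq_nonneg (√|ξ|), sq_nonneg (√|η|)]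
  have h5 : m * (√|ξ| * √|η|) ≤ N := le_trans (by gcongr) hN
  rw [e1, e2, ← mul_inv, one_div, one_div, ← mul_inv]
  exact inv_anti₀ (by positivity) h5

/-- The pointwise bounds for the regularized gradient field, in terms of the distance to the
critical point. -/
theorem gradW_bounds {v : ℝ × ℝ × ℝ} {ε m ξ η : ℝ} (hε : 0 < ε) (hm : 0 < m) {p : ℝ × ℝ}
    (h : 2 * m * (|ξ| + |η|) ≤ |gradX v p| + |gradT v p|) (hpos : 0 < |ξ| + |η|) :
    |gradX v p| / gradW v ε p ≤ 1 / (m * (|ξ| + |η|)) ∧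
    |gradT v p| / gradW v ε p ≤ 1 / (m * (|ξ| + |η|)) ∧
    ε ^ 2 / gradW v ε p ≤ ε * (1 / (m * (|ξ| + |η|))) ∧
    ε ^ 2 / gradW v ε p ^ 2 ≤ poissonKer m ε ξ * poissonKer m ε η := by
  have hW := gradW_pos v hε p
  set N := m * (|ξ| + |η|) with hN
  have hN0 : 0 < N := by positivity
  set u := |gradX v p| with hu
  set w := |gradT v p| with hw
  have hu0 : 0 ≤ u := abs_nonneg _
  have hw0 : 0 ≤ w := abs_nonneg _
  have hWe : gradW v ε p = u ^ 2 + w ^ 2 + ε ^ 2 := by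
    simp only [gradW, hu, hw, sq_abs]
  have hWN : N ^ 2 + ε ^ 2 ≤ gradW v ε p := by
    rw [hWe]; nlinarith [sq_nonneg (u - w)]
  refine ⟨?_, ?_, ?_, ?_⟩
  · rw [div_le_div_iff₀ hW hN0, hWe]
    rcases le_total N u with h3 | h3
    · nlinarith [sq_nonneg w, sq_nonneg ε]
    · have : N ≤ w := by linarith
      nlinarith [sq_nonneg ε, sq_nonneg u]
  · rw [div_le_div_iff₀ hW hN0, hWe]
    rcases le_total N w with h3 | h3
    · nlinarith [sq_nonneg u, sq_nonneg ε]
    · have : N ≤ u := by linarith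
      nlinarith [sq_nonneg ε, sq_nonneg w]
  · rw [mul_one_div, div_le_div_iff₀ hW hN0]
    nlinarith [sq_nonneg (N - ε)]
  · have a1 : m ^ 2 * ξ ^ 2 + ε ^ 2 ≤ gradW v ε p := by
      refine le_trans ?_ hWN
      rw [hN, ← sq_abs ξ]
      have : |ξ| ≤ |ξ| + |η| := le_add_of_nonneg_right (abs_nonneg _)
      rw [mul_pow]; gcongr
    have a2 : m ^ 2 * η ^ 2 + ε ^ 2 ≤ gradW v ε p := by
      refine le_trans ?_ hWN
      rw [hN, ← sq_abs η]
      have : |η| ≤ |ξ| + |η| := le_add_of_nonneg_left (abs_nonneg _)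
      rw [mul_pow]; gcongr
    rw [poissonKer, poissonKer, div_mul_div_comm, ← sq, sq (gradW v ε p)]
    gcongr

/-- The gain of `(|s| D)⁻¹` over the trivial bound, where `D` is the size of the coefficients of
`ℓ = quad v`. -/
theorem exists_bound_integral_cosKer {R : ℝ} (hR : 1 ≤ R) : ∃ C : ℝ, 0 ≤ C ∧
    ∀ v : ℝ × ℝ × ℝ, 0 < coefNorm v → ∀ s : ℝ, s ≠ 0 → ∀ (a : ℝ × ℝ → ℂ) (M : ℝ), 0 ≤ M →
      ContDiff ℝ 1 a → HasCompactSupport a →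
      (∀ p : ℝ × ℝ, ¬ (|p.1| ≤ R ∧ |p.2| ≤ R) → a p = 0 ∧ fderiv ℝ a p = 0) →
      (∀ p, ‖a p‖ ≤ M) → (∀ p, ‖fderiv ℝ a p‖ ≤ M) →
      ‖∫ p : ℝ × ℝ, a p * ((Real.exp (-p.2) * cosKer s (quad v p) : ℝ) : ℂ)‖
        ≤ C * M / (|s| * coefNorm v) := by
  obtain ⟨c, R₀, hc, hR₀, hlow⟩ := exists_grad_lower_bound hR
  set L := R + R₀
  set E := Real.exp R
  have hE1 : 1 ≤ E := Real.one_le_exp (by linarith)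
  set I₁ := ∫ x, rootKer L x
  have hI₁0 : 0 ≤ I₁ := integral_nonneg fun x =>
    Set.indicator_nonneg (fun y _ => by positivity) x
  set Q := E * (2 + R) ^ 2
  refine ⟨E * (3 * (2 / c * (I₁ * I₁)) + 2 * Q * ((2 * Real.pi / c) * (2 * Real.pi / c))),
    by positivity, ?_⟩
  intro v hD s hs a M hM ha hac hsupp hb hdb
  set D := coefNorm v
  obtain ⟨x₀, t₀, hx₀, ht₀, hgrad⟩ := hlow v hD
  -- at this scale the regularization error is of the same order as the main term
  set ε := 1 / |s| with hε
  have hε0 : 0 < ε := by positivity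
  set m := c * D / 2 with hm
  have hm0 : 0 < m := by positivity
  rw [integral_cosKer_eq v hs hε0 ha hac]
  -- majorants: `k₁` for `1 / |∇ℓ|`, and `k₂` for `ε² / gradW²`; the integral of `k₂` is of order
  -- `D⁻²`, which the factor `ℓ = O(D)` of the divergence reduces to `D⁻¹`
  set k₁ : ℝ × ℝ → ℝ := fun p => rootKer L (p.1 - x₀) * rootKer L (p.2 - t₀)
  set k₂ : ℝ × ℝ → ℝ := fun p =>
    poissonKer m ε (p.1 - x₀) * poissonKer m ε (p.2 - t₀) with hk₂
  have ik₁ : Integrable k₁ := by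
    have h := integrable_rootKer L
    exact (h.comp_sub_right x₀).mul_prod (h.comp_sub_right t₀)
  have hp := integral_poissonKer hm0 hε0
  have ik₂ : Integrable k₂ := (hp.1.comp_sub_right x₀).mul_prod (hp.1.comp_sub_right t₀)
  have vk₁ : ∫ p, k₁ p = I₁ * I₁ := by
    have := integral_prod_mul (μ := (volume : Measure ℝ)) (ν := (volume : Measure ℝ))
      (fun x => rootKer L (x - x₀)) (fun t => rootKer L (t - t₀))
    rw [integral_sub_right_eq_self, integral_sub_right_eq_self] at this
    exact this
  have vk₂ : ∫ p, k₂ p = (Real.pi / m) * (Real.pi / m) := by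
    have := integral_prod_mul (μ := (volume : Measure ℝ)) (ν := (volume : Measure ℝ))
      (fun x => poissonKer m ε (x - x₀)) (fun t => poissonKer m ε (t - t₀))
    rw [integral_sub_right_eq_self, integral_sub_right_eq_self, hp.2] at this
    exact this
  have hdom : Integrable fun p => ε * M * E * (3 * (1 / m * k₁ p) + 2 * (Q * D) * k₂ p) :=
    (((ik₁.const_mul _).const_mul _).add (ik₂.const_mul _)).const_mul _
  have hae : ∀ᵐ p : ℝ × ℝ, p.1 - x₀ ≠ 0 ∧ p.2 - t₀ ≠ 0 := by
    have h1 : ∀ᵐ x : ℝ, x - x₀ ≠ 0 := by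
      filter_upwards [Measure.ae_ne volume x₀] with x hx using sub_ne_zero.mpr hx
    have h2 : ∀ᵐ x : ℝ, x - t₀ ≠ 0 := by
      filter_upwards [Measure.ae_ne volume t₀] with x hx using sub_ne_zero.mpr hx
    rw [Measure.volume_eq_prod]
    exact (Measure.quasiMeasurePreserving_fst.ae h1).and (Measure.quasiMeasurePreserving_snd.ae h2)
  refine (norm_integral_le_of_norm_le hdom (hae.mono fun p hpne => ?_)).trans ?_
  · have hk₁0 : 0 ≤ k₁ p := mul_nonneg (Set.indicator_nonneg (fun y _ => by positivity) _)
      (Set.indicator_nonneg (fun y _ => by positivity) _)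
    have hk₂0 : 0 ≤ k₂ p := by simp only [hk₂, poissonKer]; positivity
    by_cases hpR : |p.1| ≤ R ∧ |p.2| ≤ R
    · have hξL : |p.1 - x₀| ≤ L := (abs_sub _ _).trans (by linarith [hpR.1])
      have hηL : |p.2 - t₀| ≤ L := (abs_sub _ _).trans (by linarith [hpR.2])
      have hsum : 0 < |p.1 - x₀| + |p.2 - t₀| :=
        add_pos (abs_pos.mpr hpne.1) (abs_pos.mpr hpne.2)
      have hg2 : 2 * m * (|p.1 - x₀| + |p.2 - t₀|) ≤ |gradX v p| + |gradT v p| := by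
        have := hgrad p hpR.1 hpR.2
        rw [hm]; linarith
      obtain ⟨b1, b2, b3, b4⟩ := gradW_bounds hε0 hm0 hg2 hsum
      have hroot := inv_add_le_rootKer hm0 hpne.1 hpne.2 hξL hηL le_rfl
      have hW := gradW_pos v hε0 p
      have hm2 : Real.exp (-p.2) ≤ E := Real.exp_le_exp.mpr (by linarith [neg_abs_le p.2, hpR.2])
      have hq := abs_quad_le (by linarith) v hpR.1 hpR.2
      have hS : ‖((Real.sin (s * Real.arsinh (quad v p)) / s : ℝ) : ℂ)‖ ≤ ε := by
        rw [Complex.norm_real, Real.norm_eq_abs, abs_div, hε]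
        gcongr
        exact Real.abs_sin_le_one _
      have hκ := abs_cosKer_le s (quad v p)
      have hdx : ‖fderiv ℝ a p (1, 0)‖ ≤ M := by
        refine ((fderiv ℝ a p).le_opNorm _).trans ?_
        rw [Prod.norm_def]
        simpa using hdb p
      have hdt : ‖fderiv ℝ a p (0, 1)‖ ≤ M := by
        refine ((fderiv ℝ a p).le_opNorm _).trans ?_
        rw [Prod.norm_def]
        simpa using hdb p
      have t1 : ‖a p * ((Real.exp (-p.2) * cosKer s (quad v p) * (ε ^ 2 / gradW v ε p) : ℝ) : ℂ)‖
          ≤ M * (E * 1 * (ε * (1 / m * k₁ p))) := by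
        rw [norm_mul, Complex.norm_real, Real.norm_eq_abs, abs_mul, abs_mul,
          abs_of_pos (Real.exp_pos _), abs_of_pos (by positivity : 0 < ε ^ 2 / gradW v ε p)]
        have := b3.trans (mul_le_mul_of_nonneg_left hroot hε0.le)
        have := hb p
        gcongr
      have t2 : ‖fderiv ℝ a p (1, 0) * ((gradX v p / gradW v ε p : ℝ) : ℂ)‖
          ≤ M * (1 * (1 / m * k₁ p)) := by
        rw [norm_mul, Complex.norm_real, Real.norm_eq_abs, abs_div, abs_of_pos hW, one_mul]
        exact mul_le_mul hdx (b1.trans hroot) (by positivity) hM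
      have t3 : ‖fderiv ℝ a p (0, 1) * ((Real.exp (-p.2) * gradT v p / gradW v ε p : ℝ) : ℂ)‖
          ≤ M * (E * (1 / m * k₁ p)) := by
        rw [norm_mul, Complex.norm_real, Real.norm_eq_abs, abs_div, abs_of_pos hW, abs_mul,
          abs_of_pos (Real.exp_pos _), mul_div_assoc]
        have := b2.trans hroot
        refine mul_le_mul hdt ?_ (by positivity) hM
        gcongr
      have t4 : ‖a p * ((2 * Real.exp (-p.2) * quad v p * ε ^ 2 / gradW v ε p ^ 2 : ℝ) : ℂ)‖
          ≤ M * (2 * E * (Q * D) * k₂ p) := by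
        rw [norm_mul, Complex.norm_real, Real.norm_eq_abs, mul_div_assoc, abs_mul, abs_mul, abs_mul,
          abs_two, abs_of_pos (Real.exp_pos _),
          abs_of_pos (by positivity : 0 < ε ^ 2 / gradW v ε p ^ 2)]
        have := hb p
        gcongr
      have t1' : M * (1 * (1 / m * k₁ p)) ≤ M * (E * (1 / m * k₁ p)) := by gcongr
      have t5 := (norm_add_le _ _).trans (add_le_add ((norm_add_le _ _).trans
        (add_le_add (t2.trans t1') t3)) t4)
      have t6 := mul_le_mul t5 hS (norm_nonneg _) (by positivity)
      refine (norm_sub_le _ _).trans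
        ((add_le_add t1 ((norm_mul_le _ _).trans t6)).trans (le_of_eq ?_))
      ring
    · obtain ⟨z1, z2⟩ := hsupp p hpR
      rw [z1, z2]
      simp only [zero_mul, zero_apply, add_zero, sub_zero, norm_zero]
      positivity
  · rw [integral_const_mul, integral_add ((ik₁.const_mul _).const_mul _) (ik₂.const_mul _),
      integral_const_mul, integral_const_mul, integral_const_mul, vk₁, vk₂]
    refine le_of_eq ?_
    rw [hε, hm]
    field_simp

/-! ### The bound for `J(s, g)` -/

/-- The square `[-R, R]²`. -/
def box (R : ℝ) : Set (ℝ × ℝ) := Set.Icc (-R) R ×ˢ Set.Icc (-R) R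

theorem mem_box {R : ℝ} {p : ℝ × ℝ} : p ∈ box R ↔ |p.1| ≤ R ∧ |p.2| ≤ R := by
  simp only [box, Set.mem_prod, Set.mem_Icc, abs_le]

theorem norm_integral_le_of_box {R B : ℝ} (hR : 0 ≤ R) {f : ℝ × ℝ → ℂ}
    (hf : ∀ p ∉ box R, f p = 0) (hb : ∀ p ∈ box R, ‖f p‖ ≤ B) :
    ‖∫ p, f p‖ ≤ B * (2 * R) ^ 2 := by
  have hvol : (volume : Measure (ℝ × ℝ)) (box R) = ENNReal.ofReal ((2 * R) ^ 2) := by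
    rw [box, Measure.volume_eq_prod, Measure.prod_prod, Real.volume_Icc,
      ← ENNReal.ofReal_mul (by linarith)]
    congr 1; ring
  rw [← setIntegral_eq_integral_of_forall_compl_eq_zero hf]
  have h := norm_setIntegral_le_of_norm_le_const (μ := volume)
    (by rw [hvol]; exact ENNReal.ofReal_lt_top) hb
  rwa [Measure.real, hvol, ENNReal.toReal_ofReal (by positivity)] at h

/-- A smooth function supported in `[-R, R]²` whose derivatives of order at most three are bounded
by `M`. -/
structure BoxBounded (R M : ℝ) (b : ℝ × ℝ → ℂ) : Prop where
  contDiff : ContDiff ℝ ∞ b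
  tsupport_subset : tsupport b ⊆ box R
  bound : ∀ j ≤ 3, ∀ x, ‖iteratedFDeriv ℝ j b x‖ ≤ M

theorem exists_box {S : Set (ℝ × ℝ)} (hS : IsCompact S) : ∃ R : ℝ, 1 ≤ R ∧ S ⊆ box R := by
  obtain ⟨R, hR⟩ := hS.isBounded.exists_norm_le
  refine ⟨max 1 R, le_max_left _ _, fun p hp => mem_box.mpr ⟨?_, ?_⟩⟩
  · exact (norm_fst_le p).trans ((hR p hp).trans (le_max_right _ _))
  · exact (norm_snd_le p).trans ((hR p hp).trans (le_max_right _ _))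

theorem Admissible.boxBounded {S : Set (ℝ × ℝ)} {M R : ℝ} {b : ℝ × ℝ → ℂ}
    (hb : Admissible 3 S M b) (hS : S ⊆ box R) : BoxBounded R M b :=
  ⟨hb.1, hb.2.2.1.trans hS, hb.2.2.2⟩

namespace BoxBounded

variable {R M : ℝ} {b : ℝ × ℝ → ℂ}

theorem continuous (hb : BoxBounded R M b) : Continuous b := hb.contDiff.continuous

theorem eq_zero (hb : BoxBounded R M b) {p : ℝ × ℝ} (hp : p ∉ box R) : b p = 0 :=
  image_eq_zero_of_notMem_tsupport fun h => hp (hb.tsupport_subset h)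

theorem hasCompactSupport (hb : BoxBounded R M b) : HasCompactSupport b :=
  HasCompactSupport.of_support_subset_isCompact (isCompact_Icc.prod isCompact_Icc)
    ((subset_tsupport b).trans hb.tsupport_subset)

theorem norm_le (hb : BoxBounded R M b) (p : ℝ × ℝ) : ‖b p‖ ≤ M := by
  have := hb.bound 0 (by norm_num) p
  rwa [norm_iteratedFDeriv_zero] at this

theorem norm_fderiv_le (hb : BoxBounded R M b) (p : ℝ × ℝ) : ‖fderiv ℝ b p‖ ≤ M := by
  have := hb.bound 1 (by norm_num) p
  rwa [norm_iteratedFDeriv_one] at this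

theorem nonneg (hb : BoxBounded R M b) : 0 ≤ M := (norm_nonneg _).trans (hb.norm_le 0)

theorem star (hb : BoxBounded R M b) : BoxBounded R M fun p => conj (b p) where
  contDiff := Complex.conjCLE.contDiff.comp hb.contDiff
  tsupport_subset := by
    refine (closure_mono ?_).trans hb.tsupport_subset
    intro p hp h
    exact hp (by simp [h])
  bound := fun j hj x => by
    have h := Complex.conjLIE.norm_iteratedFDeriv_comp_left b x j
    exact (le_of_eq h).trans (hb.bound j hj x)

end BoxBounded

theorem continuous_mid (g : G) : Continuous fun z : (ℝ × ℝ) × (ℝ × ℝ) => mid z.1 z.2 g := by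
  have hn : Continuous n := by
    have := continuous_na.comp (f := fun z : ℂ => (z, (0:ℝ))) (by fun_prop)
    refine this.congr fun z => ?_
    have h1 : a 0 = 1 := by apply Subtype.ext; ext i j; fin_cases i <;> fin_cases j <;> simp [a]
    simp [h1]
  have ha : Continuous a := by
    have := continuous_na.comp (f := fun t : ℝ => ((0:ℂ), t)) (by fun_prop)
    refine this.congr fun t => ?_
    have h1 : n 0 = 1 := by apply Subtype.ext; ext i j; fin_cases i <;> fin_cases j <;> simp [n]
    simp [h1]
  unfold mid
  fun_prop

/-- The integral over the second copy of `ℍ²`. -/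
def innerInt (b : ℝ × ℝ → ℂ) (s : ℝ) (g : G) (p : ℝ × ℝ) : ℂ :=
  ∫ q : ℝ × ℝ, conj (b q) * sph s (mid p q g) * (Real.exp (-q.2) : ℂ)

theorem continuous_pairing {b : ℝ × ℝ → ℂ} (hb : Continuous b) (s : ℝ) (g : G) :
    Continuous fun z : (ℝ × ℝ) × (ℝ × ℝ) =>
      (b z.1 * (Real.exp (-z.1.2) : ℂ)) *
        (conj (b z.2) * sph s (mid z.1 z.2 g) * (Real.exp (-z.2.2) : ℂ)) := by
  have h1 : Continuous fun z : (ℝ × ℝ) × (ℝ × ℝ) => sph s (mid z.1 z.2 g) :=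
    continuous_sph.comp (continuous_const.prodMk (continuous_mid g))
  fun_prop

theorem hasCompactSupport_pairing {b : ℝ × ℝ → ℂ} (hb : HasCompactSupport b)
    (φ ψ : (ℝ × ℝ) × (ℝ × ℝ) → ℂ) : HasCompactSupport fun z : (ℝ × ℝ) × (ℝ × ℝ) =>
      (b z.1 * φ z) * (conj (b z.2) * ψ z) := by
  refine HasCompactSupport.of_support_subset_isCompact (hb.isCompact.prod hb.isCompact) ?_
  intro z hz
  refine ⟨subset_tsupport b ?_, subset_tsupport b ?_⟩
  · intro h; exact hz (by simp [h])
  · intro h; exact hz (by simp [h])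

theorem J_eq_pairing (b : ℝ × ℝ → ℂ) (s : ℝ) (g : G) :
    J b s g = ∫ z : (ℝ × ℝ) × (ℝ × ℝ), (b z.1 * (Real.exp (-z.1.2) : ℂ)) *
        (conj (b z.2) * sph s (mid z.1 z.2 g) * (Real.exp (-z.2.2) : ℂ)) := by
  refine integral_congr_ae (Filter.Eventually.of_forall fun z => ?_)
  have h : ∀ u : SU2, b0 b g z.1 z.2 u *
      Complex.exp (Complex.I * s * height (u * mid z.1 z.2 g))
      = (b z.1 * conj (b z.2) * (Real.exp (-z.1.2) : ℂ) * (Real.exp (-z.2.2) : ℂ)) *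
        Complex.exp ((1 + Complex.I * s) * height (u * mid z.1 z.2 g)) := by
    intro u
    rw [b0, add_mul, one_mul, Complex.exp_add, Real.exp_sub, Real.exp_sub, Real.exp_neg,
      Real.exp_neg]
    push_cast
    ring
  simp only [h, integral_const_mul]
  rw [sph]
  ring

theorem J_eq {R M : ℝ} {b : ℝ × ℝ → ℂ} (hb : BoxBounded R M b) (s : ℝ) (g : G) :
    J b s g = ∫ p : ℝ × ℝ, b p * (Real.exp (-p.2) : ℂ) * innerInt b s g p := by
  rw [J_eq_pairing]
  have hi : Integrable fun z : (ℝ × ℝ) × (ℝ × ℝ) => (b z.1 * (Real.exp (-z.1.2) : ℂ)) *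
        (conj (b z.2) * sph s (mid z.1 z.2 g) * (Real.exp (-z.2.2) : ℂ)) := by
    refine (continuous_pairing hb.continuous s g).integrable_of_hasCompactSupport ?_
    simp only [mul_assoc (conj _)]
    exact hasCompactSupport_pairing hb.hasCompactSupport _ _
  rw [Measure.volume_eq_prod] at hi ⊢
  rw [integral_prod _ hi]
  refine integral_congr_ae (Filter.Eventually.of_forall fun p => ?_)
  simp only [innerInt]
  rw [integral_const_mul]

theorem arcosh_kap (g : G) (p : ℝ × ℝ) :
    Real.arcosh (kap g p) = |Real.arsinh (quad (coefL g) p)| := by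
  rw [kap, ← Real.cosh_arsinh, ← Real.cosh_abs, Real.arcosh_cosh (abs_nonneg _)]

/-- The spherical function between two points of the planes, in the coordinates centred at the
foot of the perpendicular. -/
theorem sph_mid_moved {s : ℝ} (hs : s ≠ 0) (g : G) (p : ℝ × ℝ) {v : ℝ × ℝ} (hv : v ≠ 0) :
    sph s (mid p (moved (foot g p) v) g) = (sinKer s (kap g p) √(v.1 ^ 2 + v.2 ^ 2) : ℂ) := by
  set ρ := √(v.1 ^ 2 + v.2 ^ 2)
  have hρ0 : 0 < ρ := by
    apply Real.sqrt_pos.mpr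
    have : v.1 ≠ 0 ∨ v.2 ≠ 0 := by
      by_contra h
      push Not at h
      exact hv (Prod.ext h.1 h.2)
    rcases this with h | h
    · have := sq_pos_of_ne_zero h; positivity
    · have := sq_pos_of_ne_zero h; positivity
  have hκ := one_le_kap g p
  have h1 : ch (mid p (moved (foot g p) v) g) = Real.cosh (radius (kap g p) ρ) := by
    rw [ch_mid_moved, cosh_radius hκ]
  have h2 := sph_mul_sinh s _ _ h1
  have h3 : ∫ x in (0:ℝ)..radius (kap g p) ρ, Real.cos (s * x)
      = Real.sin (s * radius (kap g p) ρ) / s := by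
    rw [intervalIntegral.integral_comp_mul_left _ hs, integral_cos]
    simp only [mul_zero, Real.sin_zero, sub_zero, smul_eq_mul]
    field_simp
  rw [h3] at h2
  have h4 : (Real.sinh (radius (kap g p) ρ) : ℂ) ≠ 0 := by
    exact_mod_cast (sinh_radius_pos hκ hρ0).ne'
  have hsC : (s:ℂ) ≠ 0 := by exact_mod_cast hs
  rw [eq_div_of_mul_eq h4 h2, sinKer]
  push_cast
  field_simp

theorem innerInt_eq {b : ℝ × ℝ → ℂ} {s : ℝ} (hs : s ≠ 0) (g : G) (p : ℝ × ℝ) :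
    innerInt b s g p = ∫ v : ℝ × ℝ, conj (b (moved (foot g p) v)) * (planeDensity v : ℂ) *
          (sinKer s (kap g p) √(v.1 ^ 2 + v.2 ^ 2) : ℂ) := by
  rw [innerInt, integral_eq_integral_moved (foot g p) fun q => conj (b q) * sph s (mid p q g)]
  have hae : ∀ᵐ v : ℝ × ℝ, v ≠ 0 := Measure.ae_ne volume 0
  refine integral_congr_ae (hae.mono fun v hv => ?_)
  simp only []
  rw [sph_mid_moved hs g p hv]
  ring

theorem norm_innerInt_le {R M : ℝ} (hR : 0 ≤ R) {b : ℝ × ℝ → ℂ} (hb : BoxBounded R M b)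
    (s : ℝ) (g : G) (p : ℝ × ℝ) : ‖innerInt b s g p‖ ≤ M * Real.exp R * (2 * R) ^ 2 := by
  refine norm_integral_le_of_box hR (fun q hq => by simp [hb.eq_zero hq]) fun q hq => ?_
  rw [norm_mul, norm_mul, RCLike.norm_conj, Complex.norm_real, Real.norm_eq_abs,
    abs_of_pos (Real.exp_pos _)]
  have h1 := hb.norm_le q
  have h2 := norm_sph_le_one s (mid p q g)
  have h3 : Real.exp (-q.2) ≤ Real.exp R :=
    Real.exp_le_exp.mpr (by linarith [neg_abs_le q.2, (mem_box.mp hq).2])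
  have h0 := hb.nonneg
  calc _ ≤ M * 1 * Real.exp R := by gcongr
    _ = _ := by ring

/-- The trivial bound. -/
theorem norm_J_le {R M : ℝ} (hR : 0 ≤ R) {b : ℝ × ℝ → ℂ} (hb : BoxBounded R M b)
    (s : ℝ) (g : G) : ‖J b s g‖ ≤ (M * Real.exp R * (2 * R) ^ 2) ^ 2 := by
  rw [J_eq hb]
  refine (norm_integral_le_of_box (B := M * Real.exp R * (M * Real.exp R * (2 * R) ^ 2)) hR
    (fun p hp => by simp [hb.eq_zero hp]) fun p hp => ?_).trans (le_of_eq (by ring))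
  rw [norm_mul, norm_mul, Complex.norm_real, Real.norm_eq_abs, abs_of_pos (Real.exp_pos _)]
  have h1 := hb.norm_le p
  have h2 := norm_innerInt_le hR hb s g p
  have h3 : Real.exp (-p.2) ≤ Real.exp R :=
    Real.exp_le_exp.mpr (by linarith [neg_abs_le p.2, (mem_box.mp hp).2])
  have h0 := hb.nonneg
  gcongr

/-- The amplitude that remains after the integration over the second copy of `ℍ²`. -/
def amp (b : ℝ × ℝ → ℂ) (g : G) (p : ℝ × ℝ) : ℂ := b p * conj (b (foot g p))

theorem contDiff_amp {R M : ℝ} {b : ℝ × ℝ → ℂ} (hb : BoxBounded R M b) (g : G) :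
    ContDiff ℝ ∞ (amp b g) :=
  hb.contDiff.mul (hb.star.contDiff.comp (contDiff_foot g))

theorem norm_amp_le {R M : ℝ} {b : ℝ × ℝ → ℂ} (hb : BoxBounded R M b) (g : G) (p : ℝ × ℝ) :
    ‖amp b g p‖ ≤ M ^ 2 := by
  rw [amp, norm_mul, RCLike.norm_conj, sq]
  exact mul_le_mul (hb.norm_le p) (hb.norm_le _) (norm_nonneg _) hb.nonneg

theorem amp_eq_zero {R M : ℝ} {b : ℝ × ℝ → ℂ} (hb : BoxBounded R M b) (g : G) {p : ℝ × ℝ}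
    (hp : p ∉ box R) : amp b g p = 0 ∧ fderiv ℝ (amp b g) p = 0 := by
  have h1 : p ∉ tsupport b := fun h => hp (hb.tsupport_subset h)
  refine ⟨by simp [amp, hb.eq_zero hp], ?_⟩
  have h2 : amp b g =ᶠ[nhds p] fun _ => 0 := by
    filter_upwards [notMem_tsupport_iff_eventuallyEq.mp h1] with q hq
    simp [amp, hq]
  rw [h2.fderiv_eq]
  simp

theorem norm_fderiv_amp_le {R M C : ℝ} {b : ℝ × ℝ → ℂ} (hb : BoxBounded R M b) (hC : 0 ≤ C)
    {g : G} (hfoot : ∀ p ∈ box R, ‖fderiv ℝ (foot g) p‖ ≤ C) (p : ℝ × ℝ) :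
    ‖fderiv ℝ (amp b g) p‖ ≤ M ^ 2 * (1 + C) := by
  have hM := hb.nonneg
  by_cases hp : p ∈ box R
  · have h1 : HasFDerivAt b (fderiv ℝ b p) p :=
      (hb.contDiff.differentiable (by simp) p).hasFDerivAt
    have h2 : HasFDerivAt (foot g) (fderiv ℝ (foot g) p) p :=
      ((contDiff_foot g).differentiable (by simp) p).hasFDerivAt
    have h3 : HasFDerivAt (fun q => conj (b q)) (fderiv ℝ (fun q => conj (b q)) (foot g p))
        (foot g p) := (hb.star.contDiff.differentiable (by simp) _).hasFDerivAt
    have h4 : fderiv ℝ (amp b g) p = _ := (h1.mul (h3.comp p h2)).fderiv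
    rw [h4]
    refine (norm_add_le _ _).trans ?_
    rw [norm_smul, norm_smul]
    have k1 : ‖(fderiv ℝ (fun q => conj (b q)) (foot g p)).comp (fderiv ℝ (foot g) p)‖ ≤ M * C :=
      (ContinuousLinearMap.opNorm_comp_le _ _).trans
        (mul_le_mul (hb.star.norm_fderiv_le _) (hfoot p hp) (norm_nonneg _) hM)
    have k2 := mul_le_mul (hb.norm_le p) k1 (norm_nonneg _) hM
    have k3 := mul_le_mul (hb.star.norm_le (foot g p)) (hb.norm_fderiv_le p) (norm_nonneg _) hM
    refine (add_le_add k2 k3).trans (le_of_eq ?_)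
    ring
  · rw [(amp_eq_zero hb g hp).2, norm_zero]
    positivity

/-- After the integration over the second copy of `ℍ²`, the integral `J` becomes, up to an error
of lower order, an oscillatory integral over the first copy with the signed distance to the plane
`g ℍ²` as its phase. -/
theorem exists_bound_J_sub {R : ℝ} (hR : 1 ≤ R) (c : ℝ) : ∃ C : ℝ, 0 ≤ C ∧
    ∀ (b : ℝ × ℝ → ℂ) (M : ℝ), BoxBounded R M b → ∀ s : ℝ, 1 ≤ |s| → ∀ g : G, ch g ≤ c →
      ‖J b s g - (2 * Real.pi / s ^ 2 : ℝ) *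
          ∫ p : ℝ × ℝ, amp b g p * ((Real.exp (-p.2) * cosKer s (quad (coefL g) p) : ℝ) : ℂ)‖
        ≤ C * M ^ 2 / |s| ^ 3 := by
  obtain ⟨Cf, hCf1, hCf⟩ := exists_bound_foot c R
  obtain ⟨C, hC0, hC⟩ := exists_bound_integral_sinKer R Cf
  refine ⟨Real.exp R * C * (2 * R) ^ 2, by positivity, ?_⟩
  intro b M hb s hs g hg
  have hM := hb.nonneg
  have hs0 : 0 < |s| := by linarith
  have hsne : s ≠ 0 := abs_pos.mp hs0
  have hsC : (s:ℂ) ≠ 0 := by exact_mod_cast hsne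
  set main : ℝ × ℝ → ℂ := fun p => (2 * Real.pi / s ^ 2 : ℝ) *
    (amp b g p * ((Real.exp (-p.2) * cosKer s (quad (coefL g) p) : ℝ) : ℂ)) with hmain
  have hcamp : HasCompactSupport (amp b g) := hb.hasCompactSupport.mul_right
  have i2 : Integrable main := by
    have h1 := (contDiff_amp hb g).continuous
    have h2 : Continuous fun p => cosKer s (quad (coefL g) p) :=
      (continuous_cosKer s).comp (continuous_quad _)
    have h3 : Continuous fun p : ℝ × ℝ =>
        amp b g p * ((Real.exp (-p.2) * cosKer s (quad (coefL g) p) : ℝ) : ℂ) := by fun_prop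
    exact (h3.integrable_of_hasCompactSupport hcamp.mul_right).const_mul _
  have i1 : Integrable fun p : ℝ × ℝ => b p * (Real.exp (-p.2) : ℂ) * innerInt b s g p := by
    have hi : Integrable fun z : (ℝ × ℝ) × (ℝ × ℝ) => (b z.1 * (Real.exp (-z.1.2) : ℂ)) *
        (conj (b z.2) * sph s (mid z.1 z.2 g) * (Real.exp (-z.2.2) : ℂ)) := by
      refine (continuous_pairing hb.continuous s g).integrable_of_hasCompactSupport ?_
      simp only [mul_assoc (conj _)]
      exact hasCompactSupport_pairing hb.hasCompactSupport _ _
    rw [Measure.volume_eq_prod] at hi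
    refine hi.integral_prod_left.congr (Filter.Eventually.of_forall fun p => ?_)
    simp only [innerInt]
    rw [integral_const_mul]
  rw [J_eq hb, ← integral_const_mul, ← integral_sub i1 i2]
  refine (norm_integral_le_of_box (R := R) (B := M * Real.exp R * (C * M / |s| ^ 3)) (by linarith)
    (fun p hp => ?_) fun p hp => ?_).trans (le_of_eq (by ring))
  · simp [hmain, amp, hb.eq_zero hp]
  · have hpb := mem_box.mp hp
    have hpn : ‖p‖ ≤ R := max_le hpb.1 hpb.2
    have hf := (hCf g hg p hpn).1
    have h := hC (fun q => conj (b q)) hb.star.contDiff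
      (fun q hq => mem_box.mp (by
        by_contra hn
        exact hq (hb.star.eq_zero hn))) M hb.star.bound (foot g p)
      ((norm_fst_le _).trans hf) ((norm_snd_le _).trans hf) (kap g p) (one_le_kap g p) s hs
    rw [← innerInt_eq hsne] at h
    have e : b p * (Real.exp (-p.2) : ℂ) * innerInt b s g p - main p
        = b p * (Real.exp (-p.2) : ℂ) * (innerInt b s g p - 2 * Real.pi * (conj (b (foot g p)) *
          ((Real.cos (s * Real.arcosh (kap g p)) / (s ^ 2 * kap g p) : ℝ) : ℂ))) := by
      have hcos : Real.cos (s * Real.arcosh (kap g p))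
          = Real.cos (s * Real.arsinh (quad (coefL g) p)) := by
        rw [arcosh_kap, ← Real.cos_abs, abs_mul, abs_abs, ← abs_mul, Real.cos_abs]
      have hk : (kap g p : ℂ) ≠ 0 := by
        have := one_le_kap g p
        exact_mod_cast (by linarith : 0 < kap g p).ne'
      simp only [hmain, amp, cosKer]
      rw [hcos]
      change _ = b p * _ * (_ - 2 * (Real.pi : ℂ) * (_ * ((_ / (s ^ 2 * kap g p) : ℝ) : ℂ)))
      rw [show √(1 + quad (coefL g) p ^ 2) = kap g p from rfl]
      push_cast
      field_simp
    rw [e, norm_mul, norm_mul, Complex.norm_real, Real.norm_eq_abs, abs_of_pos (Real.exp_pos _)]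
    have h1 := hb.norm_le p
    have h3 : Real.exp (-p.2) ≤ Real.exp R :=
      Real.exp_le_exp.mpr (by linarith [neg_abs_le p.2, hpb.2])
    gcongr

/-- The bound for `J(s, g)`. The main term of `exists_bound_J_sub` gains a factor
`(|s| dHprime g)⁻¹` from its oscillation, the error term a factor `|s|⁻¹`. -/
theorem exists_bound_J {R : ℝ} (hR : 1 ≤ R) (M : ℝ) : ∃ C : ℝ, 0 < C ∧
    ∀ b : ℝ × ℝ → ℂ, BoxBounded R M b → ∀ s : ℝ, s ≠ 0 → ∀ g : G, dG g 1 ≤ 1 →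
      ‖J b s g‖ ≤ C * (s ^ 2)⁻¹ * (1 + |s| * dHprime g)⁻¹ := by
  obtain ⟨C₁, hC₁0, hC₁⟩ := exists_bound_J_sub hR (Real.exp 8)
  obtain ⟨C₂, hC₂0, hC₂⟩ := exists_bound_integral_cosKer hR
  obtain ⟨Cf, hCf1, hCf⟩ := exists_bound_foot (Real.exp 8) R
  set L := 2 * Real.exp 8 with hL
  have hL1 : 1 ≤ L := by
    have := Real.one_le_exp (by norm_num : (0:ℝ) ≤ 8); linarith
  set Cd := 400 * L ^ 5
  set T := (M * Real.exp R * (2 * R) ^ 2) ^ 2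
  set K := M ^ 2 * Real.exp R * (2 * R) ^ 2
  have hR0 : 0 ≤ R := by linarith
  refine ⟨2 * T + 2 * Real.pi * (K + Cd * (C₂ * (M ^ 2 * (1 + Cf)))) + 2 * (C₁ * M ^ 2) + 1,
    by positivity, ?_⟩
  intro b hb s hs g hg
  have hs0 : 0 < |s| := abs_pos.mpr hs
  have hd0 := dHprime_nonneg g
  have hd1 := dHprime_le_one hg
  have hchg := ch_le_of_dG_le_one hg
  have hent : ∀ i j, ‖g i j‖ ≤ L := fun i j => (norm_entry_le g i j).trans (by rw [hL]; gcongr)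
  have hdD : dHprime g ≤ Cd * qD g := dHprime_le hL1 hent
  have hs2 : 0 < s ^ 2 := by positivity
  have hpos : 0 < 1 + |s| * dHprime g := by positivity
  rw [← div_eq_mul_inv, ← div_eq_mul_inv, le_div_iff₀ hpos, le_div_iff₀ hs2]
  have x1 : 0 ≤ 2 * Real.pi * (K + Cd * (C₂ * (M ^ 2 * (1 + Cf)))) := by positivity
  have x2 : 0 ≤ 2 * (C₁ * M ^ 2) := by positivity
  have x3 : 0 ≤ 2 * T := by positivity
  -- for `|s| < 1` the trivial bound suffices
  rcases lt_or_ge |s| 1 with hs1 | hs1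
  · have h1 : s ^ 2 ≤ 1 := by rw [← sq_abs]; exact pow_le_one₀ hs0.le hs1.le
    have h2 : 1 + |s| * dHprime g ≤ 2 := by nlinarith
    calc ‖J b s g‖ * (1 + |s| * dHprime g) * s ^ 2 ≤ T * 2 * 1 := by
          have := norm_J_le hR0 hb s g
          gcongr
      _ ≤ _ := by linarith
  · have hJ := hC₁ b M hb s hs1 g hchg
    set A := ∫ p : ℝ × ℝ, amp b g p *
      ((Real.exp (-p.2) * cosKer s (quad (coefL g) p) : ℝ) : ℂ)
    have hA1 : ‖A‖ ≤ K := by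
      refine norm_integral_le_of_box hR0 (fun p hp => by simp [(amp_eq_zero hb g hp).1])
        fun p hp => ?_
      rw [norm_mul, Complex.norm_real, Real.norm_eq_abs, abs_mul, abs_of_pos (Real.exp_pos _)]
      have h1 := norm_amp_le hb g p
      have h2 := abs_cosKer_le s (quad (coefL g) p)
      have h3 : Real.exp (-p.2) ≤ Real.exp R :=
        Real.exp_le_exp.mpr (by linarith [neg_abs_le p.2, (mem_box.mp hp).2])
      calc _ ≤ M ^ 2 * (Real.exp R * 1) := by gcongr
        _ = _ := by ring
    have hA2 : |s| * dHprime g * ‖A‖ ≤ Cd * (C₂ * (M ^ 2 * (1 + Cf))) := by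
      -- if all coefficients vanish, then `g` lies in `H'` and there is nothing to gain
      rcases (qD_nonneg g).eq_or_lt with hD | hD
      · have : dHprime g = 0 := le_antisymm (by rw [← hD] at hdD; linarith) hd0
        rw [this]
        simp only [mul_zero, zero_mul]
        positivity
      · have h := hC₂ (coefL g) hD s hs (amp b g) (M ^ 2 * (1 + Cf)) (by positivity)
          ((contDiff_amp hb g).of_le (by simp)) hb.hasCompactSupport.mul_right
          (fun p hp => amp_eq_zero hb g fun h => hp (mem_box.mp h))
          (fun p => (norm_amp_le hb g p).trans (le_mul_of_one_le_right (by positivity)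
            (by linarith)))
          (norm_fderiv_amp_le hb (by linarith) fun p hp => (hCf g hchg p
            (max_le (mem_box.mp hp).1 (mem_box.mp hp).2)).2)
        have hcn : coefNorm (coefL g) = qD g := rfl
        rw [hcn] at h
        calc |s| * dHprime g * ‖A‖
            ≤ |s| * (Cd * qD g) * (C₂ * (M ^ 2 * (1 + Cf)) / (|s| * qD g)) := by gcongr
          _ = _ := by field_simp
    have hJ2 : ‖J b s g‖ * s ^ 2 ≤ 2 * Real.pi * ‖A‖ + C₁ * M ^ 2 / |s| := by
      have h1 : ‖J b s g‖ ≤ 2 * Real.pi / s ^ 2 * ‖A‖ + C₁ * M ^ 2 / |s| ^ 3 := by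
        have h2 := norm_sub_norm_le (J b s g) ((2 * Real.pi / s ^ 2 : ℝ) * A)
        rw [norm_mul, Complex.norm_real, Real.norm_eq_abs, abs_of_pos (by positivity)] at h2
        linarith
      calc ‖J b s g‖ * s ^ 2 ≤ (2 * Real.pi / s ^ 2 * ‖A‖ + C₁ * M ^ 2 / |s| ^ 3) * s ^ 2 := by
            gcongr
        _ = _ := by
            rw [← sq_abs s]
            field_simp
    -- the error term gains from `|s|⁻¹` what `dHprime g ≤ 1` allows it to lose
    have hfrac : C₁ * M ^ 2 / |s| * (1 + |s| * dHprime g) ≤ 2 * (C₁ * M ^ 2) := by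
      have h1 : (1 + |s| * dHprime g) / |s| ≤ 2 := by
        rw [div_le_iff₀ hs0]; nlinarith
      calc _ = C₁ * M ^ 2 * ((1 + |s| * dHprime g) / |s|) := by ring
        _ ≤ C₁ * M ^ 2 * 2 := by gcongr
        _ = _ := by ring
    calc ‖J b s g‖ * (1 + |s| * dHprime g) * s ^ 2
        = (‖J b s g‖ * s ^ 2) * (1 + |s| * dHprime g) := by ring
      _ ≤ (2 * Real.pi * ‖A‖ + C₁ * M ^ 2 / |s|) * (1 + |s| * dHprime g) := by gcongr
      _ = 2 * Real.pi * (‖A‖ + |s| * dHprime g * ‖A‖)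
          + C₁ * M ^ 2 / |s| * (1 + |s| * dHprime g) := by ring
      _ ≤ 2 * Real.pi * (K + Cd * (C₂ * (M ^ 2 * (1 + Cf)))) + 2 * (C₁ * M ^ 2) := by
          gcongr
      _ ≤ _ := by linarith

/-! ### The bound for `I(λ, g)` -/

theorem IsEvenPW.exists_bound {H w : ℝ → ℂ} (hH : IsEvenPW H w) : ∃ B : ℝ, 0 ≤ B ∧ ∀ s, ‖H s‖ ≤ B := by
  obtain ⟨F, hF⟩ := hH.exists_schwartz
  exact ⟨_, apply_nonneg _ _, fun s => by rw [hF s]; exact F.norm_le_seminorm ℝ _⟩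

theorem IsEvenPW.integrable_sq_mul_sq {H w : ℝ → ℂ} (hH : IsEvenPW H w) :
    Integrable fun s : ℝ => H s ^ 2 * (s : ℂ) ^ 2 := by
  obtain ⟨B, -, hB⟩ := hH.exists_bound
  refine ((hH.integrable_pow 2).mul_bdd hH.continuous.aestronglyMeasurable
    (Filter.Eventually.of_forall hB)).congr (Filter.Eventually.of_forall fun s => ?_)
  ring

/-- The square integral that controls the constant in the bound for `I`. -/
theorem IsEvenPW.integrable_weight {H w : ℝ → ℂ} (hH : IsEvenPW H w) :
    Integrable fun s : ℝ => ‖H s‖ ^ 2 * (1 + |s|) := by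
  obtain ⟨B, -, hB⟩ := hH.exists_bound
  have h1 := ((hH.integrable_pow 0).norm.add (hH.integrable_pow 1).norm).mul_bdd
    hH.continuous.norm.aestronglyMeasurable (Filter.Eventually.of_forall fun s => by
      rw [norm_norm]; exact hB s)
  refine h1.congr (Filter.Eventually.of_forall fun s => ?_)
  simp only [Pi.add_apply, norm_mul, Complex.norm_real, Real.norm_eq_abs, pow_zero,
    pow_one, norm_one]
  ring

/-- The period integral `I` as a superposition of the oscillatory integrals `J`. -/
theorem I_eq {h : ℝ → ℝ} (hh : PaleyWiener h) {R M : ℝ} {b : ℝ × ℝ → ℂ} (hb : BoxBounded R M b)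
    (l : ℝ) (g : G) : I b h l g = (1 / (2 * (Real.pi : ℂ) ^ 2)) *
      ∫ s in Set.Ioi (0 : ℝ), h0 h l s ^ 2 * (s : ℂ) ^ 2 * J b s g := by
  obtain ⟨w, hH⟩ := hh.exists_isEvenPW l
  set W : (ℝ × ℝ) × (ℝ × ℝ) → ℂ := fun z =>
    (b z.1 * (Real.exp (-z.1.2) : ℂ)) * (conj (b z.2) * (Real.exp (-z.2.2) : ℂ)) with hW
  have hWi : Integrable W := by
    have h1 := hb.continuous
    have h3 : Continuous W := by simp only [hW]; fun_prop
    exact h3.integrable_of_hasCompactSupport (hasCompactSupport_pairing hb.hasCompactSupport _ _)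
  have hsph : Continuous fun y : ((ℝ × ℝ) × (ℝ × ℝ)) × ℝ => sph y.2 (mid y.1.1 y.1.2 g) :=
    continuous_sph.comp (continuous_snd.prodMk ((continuous_mid g).comp continuous_fst))
  have hΦ : Integrable (Function.uncurry fun (z : (ℝ × ℝ) × (ℝ × ℝ)) (s : ℝ) =>
      W z * (h0 h l s ^ 2 * (s : ℂ) ^ 2) * sph s (mid z.1 z.2 g))
      (volume.prod (volume.restrict (Set.Ioi (0:ℝ)))) :=
    (hWi.mul_prod hH.integrable_sq_mul_sq.integrableOn).mul_bdd hsph.aestronglyMeasurable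
      (Filter.Eventually.of_forall fun y => norm_sph_le_one _ _)
  have e1 : I b h l g = (1 / (2 * (Real.pi : ℂ) ^ 2)) * ∫ z : (ℝ × ℝ) × (ℝ × ℝ),
      ∫ s in Set.Ioi (0:ℝ), W z * (h0 h l s ^ 2 * (s : ℂ) ^ 2) * sph s (mid z.1 z.2 g) := by
    rw [← integral_const_mul]
    refine integral_congr_ae (Filter.Eventually.of_forall fun z => ?_)
    have hk : kl h l (mid z.1 z.2 g)
        = invSphTransform (fun s => h0 h l s ^ 2) (mid z.1 z.2 g) := hH.conv_invSph _
    simp only []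
    rw [hk, invSphTransform]
    simp only [mul_assoc (W z)]
    rw [integral_const_mul]
    have e2 : ∫ s in Set.Ioi (0:ℝ), h0 h l s ^ 2 * (s : ℂ) ^ 2 * sph s (mid z.1 z.2 g)
        = ∫ s in Set.Ioi (0:ℝ), h0 h l s ^ 2 * sph s (mid z.1 z.2 g) * (s : ℂ) ^ 2 :=
      integral_congr_ae (Filter.Eventually.of_forall fun s => by ring)
    rw [e2]
    have e3 : (Real.exp (-z.1.2 - z.2.2) : ℂ)
        = (Real.exp (-z.1.2) : ℂ) * (Real.exp (-z.2.2) : ℂ) := by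
      rw [sub_eq_add_neg, Real.exp_add, Complex.ofReal_mul]
    rw [e3]
    simp only [hW]
    ring
  rw [e1, integral_integral_swap hΦ]
  congr 1
  refine integral_congr_ae (Filter.Eventually.of_forall fun s => ?_)
  simp only []
  rw [J_eq_pairing, ← integral_const_mul]
  refine integral_congr_ae (Filter.Eventually.of_forall fun z => ?_)
  simp only [hW]
  ring

/-- As `h` is not negative, it is dominated by `h_0⁰(s) = h(s) + h(-s)`. -/
theorem norm_h0_le {h : ℝ → ℝ} (hpos : ∀ s, 0 ≤ h s) (l s : ℝ) :
    ‖h0 h l s‖ ≤ ‖h0 h 0 (s - l)‖ + ‖h0 h 0 (-s - l)‖ := by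
  have e : ∀ x, ‖h0 h 0 x‖ = h x + h (-x) := fun x => by
    rw [h0, Complex.norm_real, Real.norm_eq_abs, sub_zero, sub_zero,
      abs_of_nonneg (add_nonneg (hpos _) (hpos _))]
  rw [e, e, h0, Complex.norm_real, Real.norm_eq_abs,
    abs_of_nonneg (add_nonneg (hpos _) (hpos _))]
  linarith [hpos (-(s - l)), hpos (-(-s - l))]

/-- The spectral weight is concentrated at distance `O(1)` from `|λ|`. -/
theorem norm_h0_sq_mul_le {h : ℝ → ℝ} (hpos : ∀ s, 0 ≤ h s) (l : ℝ) {s d : ℝ} (hs : 0 < s)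
    (hd0 : 0 ≤ d) (hd1 : d ≤ 1) :
    ‖h0 h l s‖ ^ 2 * (1 + s * d)⁻¹ ≤ (1 + |l| * d)⁻¹ *
      (2 * (‖h0 h 0 (s - l)‖ ^ 2 * (1 + |s - l|)) + 2 * (‖h0 h 0 (-s - l)‖ ^ 2 * (1 + |-s - l|))) := by
  have hp1 : 0 < 1 + s * d := by positivity
  have hp2 : 0 < 1 + |l| * d := by positivity
  set u := ‖h0 h 0 (s - l)‖
  set v := ‖h0 h 0 (-s - l)‖
  have h1 : ‖h0 h l s‖ ^ 2 ≤ 2 * u ^ 2 + 2 * v ^ 2 := by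
    have := pow_le_pow_left₀ (norm_nonneg _) (norm_h0_le hpos l s) 2
    nlinarith [sq_nonneg (u - v)]
  -- passing from `s` to `|l|` costs a factor of at most `1 + | |l| - s |`, as `d ≤ 1`
  have k : ∀ x : ℝ, |l| - s ≤ x → 0 ≤ x → (1 + |l| * d) ≤ (1 + x) * (1 + s * d) := by
    intro x hx hx0
    have : |l| * d ≤ (s + x) * d := by gcongr; linarith
    nlinarith [mul_nonneg hx0 (mul_nonneg hs.le hd0), mul_le_of_le_one_right hx0 hd1]
  have k1 := k |s - l| (by
    have := abs_sub_abs_le_abs_sub l s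
    rw [abs_of_pos hs, abs_sub_comm] at this; exact this) (abs_nonneg _)
  have k2 := k |-s - l| (by
    have := abs_sub_abs_le_abs_sub l (-s)
    rw [abs_neg, abs_of_pos hs, abs_sub_comm] at this; exact this) (abs_nonneg _)
  rw [← div_eq_mul_inv, inv_mul_eq_div, div_le_div_iff₀ hp1 hp2]
  calc ‖h0 h l s‖ ^ 2 * (1 + |l| * d) ≤ (2 * u ^ 2 + 2 * v ^ 2) * (1 + |l| * d) := by gcongr
    _ = 2 * u ^ 2 * (1 + |l| * d) + 2 * v ^ 2 * (1 + |l| * d) := by ring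
    _ ≤ 2 * u ^ 2 * ((1 + |s - l|) * (1 + s * d)) + 2 * v ^ 2 * ((1 + |-s - l|) * (1 + s * d)) := by
        gcongr
    _ = _ := by ring

/-- The bound for `I(λ, g)`, by integrating the bound for `J(s, g)` against the spectral weight. -/
theorem exists_bound_I {h : ℝ → ℝ} (hh : PaleyWiener h) (hpos : ∀ s, 0 ≤ h s) {R : ℝ}
    (hR : 1 ≤ R) (M : ℝ) : ∃ C : ℝ, 0 < C ∧ ∀ b : ℝ × ℝ → ℂ, BoxBounded R M b → ∀ l : ℝ,
      ∀ g : G, dG g 1 ≤ 1 → ‖I b h l g‖ ≤ C * (1 + |l| * dHprime g)⁻¹ := by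
  obtain ⟨C, hC0, hC⟩ := exists_bound_J hR M
  obtain ⟨w, hH⟩ := hh.exists_isEvenPW 0
  -- the constant depends on `h` through the integral of `φ`, which is translation invariant and
  -- so independent of `l`
  set φ : ℝ → ℝ := fun s => ‖h0 h 0 s‖ ^ 2 * (1 + |s|)
  have hφi : Integrable φ := hH.integrable_weight
  have hφ0 : ∀ s, 0 ≤ φ s := fun s => by positivity
  refine ⟨C * (4 * ∫ s, φ s) + 1,
    add_pos_of_nonneg_of_pos (mul_nonneg hC0.le (mul_nonneg (by norm_num) (integral_nonneg hφ0)))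
      one_pos, ?_⟩
  intro b hb l g hg
  have hd0 := dHprime_nonneg g
  have hd1 := dHprime_le_one hg
  set d := dHprime g
  set ψ : ℝ → ℝ := fun s => C * ((1 + |l| * d)⁻¹ * (2 * φ (s - l) + 2 * φ (-s - l))) with hψ
  have i1 : Integrable fun s => φ (s - l) := hφi.comp_sub_right l
  have i2 : Integrable fun s => φ (-s - l) := (hφi.comp_sub_right l).comp_neg
  have hψi : Integrable ψ := (((i1.const_mul 2).add (i2.const_mul 2)).const_mul _).const_mul _
  have hψ0 : ∀ s, 0 ≤ ψ s := fun s => by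
    have := hφ0 (s - l); have := hφ0 (-s - l); positivity
  have e1 : ∫ s, ψ s = C * ((1 + |l| * d)⁻¹ * (4 * ∫ s, φ s)) := by
    have j1 : ∫ s, φ (s - l) = ∫ s, φ s := integral_sub_right_eq_self φ l
    have j2 : ∫ s, φ (-s - l) = ∫ s, φ s := by
      rw [integral_neg_eq_self (fun s => φ (s - l)), j1]
    rw [hψ, integral_const_mul, integral_const_mul, integral_add (i1.const_mul 2) (i2.const_mul 2),
      integral_const_mul, integral_const_mul, j1, j2]
    ring
  have hI : ‖I b h l g‖ ≤ ∫ s, ψ s := by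
    rw [I_eq hh hb, norm_mul]
    have hπ : ‖1 / (2 * (Real.pi : ℂ) ^ 2)‖ ≤ 1 := by
      rw [norm_div, norm_one, norm_mul, norm_pow, Complex.norm_real, Complex.norm_ofNat,
        Real.norm_eq_abs, abs_of_pos Real.pi_pos]
      apply div_le_one_of_le₀ _ (by positivity)
      nlinarith [Real.pi_gt_three]
    refine (mul_le_of_le_one_left (norm_nonneg _) hπ).trans ?_
    refine (norm_integral_le_of_norm_le hψi.integrableOn ?_).trans
      (setIntegral_le_integral hψi (Filter.Eventually.of_forall hψ0))
    refine (ae_restrict_mem measurableSet_Ioi).mono fun s hs => ?_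
    have hs0 : 0 < s := hs
    have h1 := hC b hb s hs0.ne' g hg
    rw [norm_mul, norm_mul, norm_pow, norm_pow, Complex.norm_real, Real.norm_eq_abs, sq_abs]
    rw [abs_of_pos hs0] at h1
    calc ‖h0 h l s‖ ^ 2 * s ^ 2 * ‖J b s g‖
        ≤ ‖h0 h l s‖ ^ 2 * s ^ 2 * (C * (s ^ 2)⁻¹ * (1 + s * d)⁻¹) := by gcongr
      _ = C * (‖h0 h l s‖ ^ 2 * (1 + s * d)⁻¹) := by field_simp
      _ ≤ _ := by
          simp only [hψ]
          exact mul_le_mul_of_nonneg_left (norm_h0_sq_mul_le hpos l hs0 hd0 hd1) hC0.le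
  rw [e1] at hI
  refine hI.trans ?_
  calc _ = C * (4 * ∫ s, φ s) * (1 + |l| * d)⁻¹ := by ring
    _ ≤ _ := by gcongr; linarith

end HypPeriod

end

theorem mainTheorem3 :
    -- `k_λ⁰` is the compactly supported bi-invariant function with spherical transform `h_λ⁰`
    (∀ h : ℝ → ℝ, HypPeriod.PaleyWiener h → (∀ s, 0 ≤ h s) → h 0 = 1 → ∀ l : ℝ,
      Continuous (HypPeriod.k0 h l) ∧ HasCompactSupport (HypPeriod.k0 h l) ∧
      (∀ k ∈ HypPeriod.SU2, ∀ k' ∈ HypPeriod.SU2, ∀ g,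
        HypPeriod.k0 h l (k * g * k') = HypPeriod.k0 h l g) ∧
      ∀ s : ℝ, HypPeriod.sphTransform (HypPeriod.k0 h l) s = HypPeriod.h0 h l s) ∧
    -- the bound for `I(λ, g)`
    (∃ N : ℕ, ∀ h : ℝ → ℝ, HypPeriod.PaleyWiener h → (∀ s, 0 ≤ h s) → h 0 = 1 →
      ∀ S : Set (ℝ × ℝ), IsCompact S → ∀ M : ℝ, ∃ C : ℝ, 0 < C ∧
      ∀ b : ℝ × ℝ → ℂ, HypPeriod.Admissible N S M b →
      ∀ l : ℝ, ∀ g : HypPeriod.G, HypPeriod.dG g 1 ≤ 1 →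
        ‖HypPeriod.I b h l g‖ ≤ C * (1 + |l| * HypPeriod.dHprime g)⁻¹) ∧
    -- the bound for `J(s, g)`
    (∃ N : ℕ, ∀ S : Set (ℝ × ℝ), IsCompact S → ∀ M : ℝ, ∃ C : ℝ, 0 < C ∧
      ∀ b : ℝ × ℝ → ℂ, HypPeriod.Admissible N S M b →
      ∀ s : ℝ, s ≠ 0 → ∀ g : HypPeriod.G, HypPeriod.dG g 1 ≤ 1 →
        ‖HypPeriod.J b s g‖ ≤ C * (s ^ 2)⁻¹ * (1 + |s| * HypPeriod.dHprime g)⁻¹) := by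
  refine ⟨fun h hh _ _ l => ?_, ⟨3, fun h hh hpos _ S hS M => ?_⟩, ⟨3, fun S hS M => ?_⟩⟩
  · obtain ⟨w, hH⟩ := hh.exists_isEvenPW l
    refine ⟨hH.continuous_invSph, hH.hasCompactSupport_invSph, fun k hk k' hk' g => ?_,
      hH.sphTransform_invSph⟩
    exact HypPeriod.invSph_eq_of_ch_eq _
      (by rw [HypPeriod.ch_mul_SU2 _ _ hk', HypPeriod.ch_SU2_mul _ _ hk])
  · obtain ⟨R, hR, hSR⟩ := HypPeriod.exists_box hS
    obtain ⟨C, hC, hI⟩ := HypPeriod.exists_bound_I hh hpos hR M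
    exact ⟨C, hC, fun b hb l g hg => hI b (hb.boxBounded hSR) l g hg⟩
  · obtain ⟨R, hR, hSR⟩ := HypPeriod.exists_box hS
    obtain ⟨C, hC, hJ⟩ := HypPeriod.exists_bound_J hR M
    exact ⟨C, hC, fun b hb s hs g hg => hJ b (hb.boxBounded hSR) s hs g hg⟩
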